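/- Let $n\ge 1$. Let $K$ be a field of characteristic $0$ and let $q\in K^\times$ not be a root of unity (for instance, $q$ may be an indeterminate); put $[m]=\frac{q^m-q^{-m}}{q-q^{-1}}$. In the cases $D^{(2)}_{n+1}$ and $A^{(2)}_{2n}$ assume moreover that $K$ contains a fixed square root $q^{1/2}$ of $q$, itself not a root of unity, and an element $i$ with $i^2=-1$, and put $\kappa=\frac{q+1}{q-1}$. **Algebras.** Set $q_j=q$ for $0<j<n$, $q_0=q^{1/2}$ for $D^{(2)}_{n+1}$ and $A^{(2)}_{2n}$, $q_0=q^2$ for $C^{(1)}_n$, $q_n=q^{1/2}$ for $D^{(2)}_{n+1}$, and $q_n=q^2$ for $A^{(2)}_{2n}$ and $C^{(1)}_n$. Let $a_{jj}=2$, $a_{jk}=-\max\left(\frac{\log q_k}{\log q_j},1\right)$ for $|j-k|=1$, and $a_{jk}=0$ otherwise, where $\log q^{r}/\log q^{t}$ means $r/t$, except that $a_{01}=a_{10}=-2$ for $D^{(2)}_2$ and $C^{(1)}_1$. The algebra $U_q$ of the given type is the $K$-algebra generated by $e_j,f_j,k_j^{\pm1}$ $(0\le j\le n)$ with the relations $k_jk_j^{-1}=k_j^{-1}k_j=1$,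 $[k_j,k_l]=0$, $k_je_lk_j^{-1}=q_j^{a_{jl}}e_l$, $k_jf_lk_j^{-1}=q_j^{-a_{jl}}f_l$, $[e_j,f_l]=\delta_{jl}\frac{k_j-k_j^{-1}}{q_j-q_j^{-1}}$ and the quantum Serre relations $\sum_{\nu=0}^{1-a_{jl}}(-1)^\nu e_j^{(1-a_{jl}-\nu)}e_le_j^{(\nu)}=0=\sum_{\nu=0}^{1-a_{jl}}(-1)^\nu f_j^{(1-a_{jl}-\nu)}f_lf_j^{(\nu)}$ $(j\ne l)$, where $g_j^{(\nu)}=g_j^\nu/[\nu]_{q_j}!$. It acts on tensor products through the coproduct $\Delta k_j^{\pm1}=k_j^{\pm1}\otimes k_j^{\pm1}$, $\Delta e_j=1\otimes e_j+e_j\otimes k_j$, $\Delta f_j=f_j\otimes1+k_j^{-1}\otimes f_j$. **Representations.** Let $V$ be the $K$-vector space with basis $|\mathbf m\rangle$, $\mathbf m\in(\mathbb Z_{\ge0})^n$, and let $\mathbf e_1,\dots,\mathbf e_n$ be the standard basis of $\mathbb Z^n$. For $x\in K^\times$ let $V_x$ be $V$ with the following action of $U_q$ (vectors with a negative entry are read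 as zero). In all types, for $1\le j\le n-1$, $$e_j|\mathbf m\rangle=[m_j]\,|\mathbf m-\mathbf e_j+\mathbf e_{j+1}\rangle,\quad f_j|\mathbf m\rangle=[m_{j+1}]\,|\mathbf m+\mathbf e_j-\mathbf e_{j+1}\rangle,\quad k_j|\mathbf m\rangle=q^{-m_j+m_{j+1}}|\mathbf m\rangle.$$ For $D^{(2)}_{n+1}$ and $A^{(2)}_{2n}$: $e_0|\mathbf m\rangle=x|\mathbf m+\mathbf e_1\rangle$, $f_0|\mathbf m\rangle=i\kappa[m_1]x^{-1}|\mathbf m-\mathbf e_1\rangle$, $k_0|\mathbf m\rangle=-iq^{m_1+1/2}|\mathbf m\rangle$. For $C^{(1)}_n$: $e_0|\mathbf m\rangle=x|\mathbf m+2\mathbf e_1\rangle$, $f_0|\mathbf m\rangle=\frac{[m_1][m_1-1]}{[2]^2}x^{-1}|\mathbf m-2\mathbf e_1\rangle$, $k_0|\mathbf m\rangle=-q^{2m_1+1}|\mathbf m\rangle$. For $D^{(2)}_{n+1}$: $e_n|\mathbf m\rangle=i\kappa[m_n]|\mathbf m-\mathbf e_n\rangle$, $f_n|\mathbf m\rangle=|\mathbf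 m+\mathbf e_n\rangle$, $k_n|\mathbf m\rangle=iq^{-m_n-1/2}|\mathbf m\rangle$. For $A^{(2)}_{2n}$ and $C^{(1)}_n$: $e_n|\mathbf m\rangle=\frac{[m_n][m_n-1]}{[2]^2}|\mathbf m-2\mathbf e_n\rangle$, $f_n|\mathbf m\rangle=|\mathbf m+2\mathbf e_n\rangle$, $k_n|\mathbf m\rangle=-q^{-2m_n-1}|\mathbf m\rangle$. For $C^{(1)}_n$ and $\epsilon=\pm1$ let $V_x^{\epsilon}\subset V_x$ be the submodule spanned by the $|\mathbf m\rangle$ with $(-1)^{m_1+\cdots+m_n}=\epsilon$. **Proposition 3.9.** Let $x,y\in K^\times$ and $z=x/y$. 1. As a $U_q(D^{(2)}_{n+1})$-module, $V_x\otimes V_y$ is irreducible, provided $z\ne -q^{\pm l}$ for all integers $l\ge1$. 2. As a $U_q(A^{(2)}_{2n})$-module, $V_x\otimes V_y$ is irreducible, provided $z^2\neq -q^{\pm(2l-1)}$ for all integers $l\ge1$. 3. As a $U_q(C^{(1)}_n)$-module, each $V_x^{\epsilon_1}\otimes V_y^{\epsilon_2}$ $(\epsilon_1,\epsilon_2=\pm1)$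 is irreducible, provided $z\ne q^{\pm(4l-2)}$ for all integers $l\ge1$ if $\epsilon_1=\epsilon_2$, and $z\ne q^{\pm4l}$ for all integers $l\ge1$ if $\epsilon_1\neq\epsilon_2$. In particular all these modules are irreducible when $x$ and $y$ are independent indeterminates. -/

import Mathlib

open scoped TensorProduct

namespace QOsc

/-! ### Drinfeld-Jimbo quantum algebras -/

/-- The `q`-integer `[m]_q`. -/
noncomputable def qInt {K : Type*} [Field K] (q : K) (m : ℤ) : K :=
  (q ^ m - q ^ (-m)) / (q - q⁻¹)

/-- The `q`-factorial `[m]_q!`. -/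
noncomputable def qFact {K : Type*} [Field K] (q : K) (m : ℕ) : K :=
  ∏ k ∈ Finset.range m, qInt q ((k : ℤ) + 1)

/-- The divided power `X ^ m / [m]_q!`. -/
noncomputable def divPow {K A : Type*} [Field K] [Ring A] [Algebra K A] (q : K) (m : ℕ) (X : A) :
    A :=
  (qFact q m)⁻¹ • X ^ m

/-- The sum `∑_{ν = 0}^{r} (-1)^ν X^{(r-ν)} Y X^{(ν)}` of the quantum Serre relations. -/
noncomputable def serreSum {K A : Type*} [Field K] [Ring A] [Algebra K A] (q : K) (r : ℕ)
    (X Y : A) : A :=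
  ∑ ν ∈ Finset.range (r + 1), (-1) ^ ν * (divPow q (r - ν) X * Y * divPow q ν X)

/-- The data `(a_{ij})`, `(q_i)` defining a Drinfeld-Jimbo algebra: a generalized Cartan matrix
and nonzero scalars `q_i`, not roots of unity, with `q_i ^ a_{ij} = q_j ^ a_{ji}`. -/
structure Datum (J K : Type*) [Field K] where
  a : J → J → ℤ
  q : J → K
  q_ne : ∀ i, q i ≠ 0
  q_pow : ∀ i (m : ℕ), 0 < m → q i ^ m ≠ 1
  diag : ∀ i, a i i = 2
  offdiag : ∀ i j, i ≠ j → a i j ≤ 0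
  symm : ∀ i j, q i ^ a i j = q j ^ a j i

/-- The generators `e_i`, `f_i`, `k_i`, `k_i⁻¹`. -/
inductive Gen (J : Type*)
  | e (i : J)
  | f (i : J)
  | k (i : J)
  | kinv (i : J)

/-- The elements `E i`, `F i`, `Kp i`, `Km i` of an algebra satisfy the defining relations of
the Drinfeld-Jimbo algebra, `Km i` being the inverse of `Kp i`. -/
structure Datum.Relations {J K A : Type*} [Field K] [DecidableEq J] [Ring A] [Algebra K A]
    (D : Datum J K) (E F Kp Km : J → A) : Prop where
  k_kinv : ∀ i, Kp i * Km i = 1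
  kinv_k : ∀ i, Km i * Kp i = 1
  k_k : ∀ i j, Kp i * Kp j = Kp j * Kp i
  k_e : ∀ i j, Kp i * E j * Km i = D.q i ^ D.a i j • E j
  k_f : ∀ i j, Kp i * F j * Km i = D.q i ^ (-D.a i j) • F j
  e_f : ∀ i j, E i * F j - F j * E i =
    if i = j then (D.q i - (D.q i)⁻¹)⁻¹ • (Kp i - Km i) else 0
  serre_e : ∀ i j, i ≠ j → serreSum (D.q i) (1 - D.a i j).toNat (E i) (E j) = 0
  serre_f : ∀ i j, i ≠ j → serreSum (D.q i) (1 - D.a i j).toNat (F i) (F j) = 0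

open Gen in
/-- The defining relations of the Drinfeld-Jimbo algebra, in the free algebra on its
generators. -/
inductive Datum.Rel {J K : Type*} [Field K] [DecidableEq J] (D : Datum J K) :
    FreeAlgebra K (Gen J) → FreeAlgebra K (Gen J) → Prop
  | k_kinv (i : J) : D.Rel (FreeAlgebra.ι K (k i) * FreeAlgebra.ι K (kinv i)) 1
  | kinv_k (i : J) : D.Rel (FreeAlgebra.ι K (kinv i) * FreeAlgebra.ι K (k i)) 1
  | k_k (i j : J) : D.Rel (FreeAlgebra.ι K (k i) * FreeAlgebra.ι K (k j)) (FreeAlgebra.ι K (k j) * FreeAlgebra.ι K (k i))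
  | k_e (i j : J) :
      D.Rel (FreeAlgebra.ι K (k i) * FreeAlgebra.ι K (e j) * FreeAlgebra.ι K (kinv i)) (D.q i ^ D.a i j • FreeAlgebra.ι K (e j))
  | k_f (i j : J) :
      D.Rel (FreeAlgebra.ι K (k i) * FreeAlgebra.ι K (f j) * FreeAlgebra.ι K (kinv i)) (D.q i ^ (-D.a i j) • FreeAlgebra.ι K (f j))
  | e_f (i j : J) :
      D.Rel (FreeAlgebra.ι K (e i) * FreeAlgebra.ι K (f j) - FreeAlgebra.ι K (f j) * FreeAlgebra.ι K (e i))
        (if i = j then (D.q i - (D.q i)⁻¹)⁻¹ • (FreeAlgebra.ι K (k i) - FreeAlgebra.ι K (kinv i)) else 0)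
  | serre_e (i j : J) : i ≠ j →
      D.Rel (serreSum (D.q i) (1 - D.a i j).toNat (FreeAlgebra.ι K (e i)) (FreeAlgebra.ι K (e j))) 0
  | serre_f (i j : J) : i ≠ j →
      D.Rel (serreSum (D.q i) (1 - D.a i j).toNat (FreeAlgebra.ι K (f i)) (FreeAlgebra.ι K (f j))) 0

/-- The Drinfeld-Jimbo algebra (without derivation operator), by generators and relations. -/
abbrev Uq {J K : Type*} [Field K] [DecidableEq J] (D : Datum J K) : Type _ := RingQuot D.Rel

section lift

variable {J K : Type*} [Field K] [DecidableEq J] (D : Datum J K)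

/-- The class of a generator in the Drinfeld-Jimbo algebra. -/
noncomputable def Uq.gen (g : Gen J) : Uq D := RingQuot.mkAlgHom K D.Rel (FreeAlgebra.ι K g)

theorem map_serreSum {A B : Type*} [Ring A] [Algebra K A] [Ring B] [Algebra K B] (φ : A →ₐ[K] B)
    (q : K) (r : ℕ) (X Y : A) : φ (serreSum q r X Y) = serreSum q r (φ X) (φ Y) := by
  simp [serreSum, divPow]

theorem Uq.relations : D.Relations (fun i => Uq.gen D (.e i)) (fun i => Uq.gen D (.f i))
    (fun i => Uq.gen D (.k i)) (fun i => Uq.gen D (.kinv i)) where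
  k_kinv i := by simpa [Uq.gen] using RingQuot.mkAlgHom_rel K (Datum.Rel.k_kinv (D := D) i)
  kinv_k i := by simpa [Uq.gen] using RingQuot.mkAlgHom_rel K (Datum.Rel.kinv_k (D := D) i)
  k_k i j := by simpa [Uq.gen] using RingQuot.mkAlgHom_rel K (Datum.Rel.k_k (D := D) i j)
  k_e i j := by simpa only [Uq.gen, map_mul, map_smul] using
    RingQuot.mkAlgHom_rel K (Datum.Rel.k_e (D := D) i j)
  k_f i j := by simpa only [Uq.gen, map_mul, map_smul] using
    RingQuot.mkAlgHom_rel K (Datum.Rel.k_f (D := D) i j)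
  e_f i j := by
    have := RingQuot.mkAlgHom_rel K (Datum.Rel.e_f (D := D) i j)
    split_ifs at this ⊢ <;> simpa only [Uq.gen, map_mul, map_smul, map_sub, map_zero] using this
  serre_e i j h := by simpa [Uq.gen, map_serreSum] using
    RingQuot.mkAlgHom_rel K (Datum.Rel.serre_e (D := D) i j h)
  serre_f i j h := by simpa [Uq.gen, map_serreSum] using
    RingQuot.mkAlgHom_rel K (Datum.Rel.serre_f (D := D) i j h)

variable {D}

/-- Elements satisfying the defining relations define an algebra homomorphism. -/
noncomputable def Uq.lift {A : Type*} [Ring A] [Algebra K A] {E F Kp Km : J → A}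
    (h : D.Relations E F Kp Km) : Uq D →ₐ[K] A :=
  RingQuot.liftAlgHom K ⟨FreeAlgebra.lift K fun g => match g with
    | .e i => E i
    | .f i => F i
    | .k i => Kp i
    | .kinv i => Km i, by
      intro x y hxy
      induction hxy with
      | k_kinv i => simpa using h.k_kinv i
      | kinv_k i => simpa using h.kinv_k i
      | k_k i j => simpa using h.k_k i j
      | k_e i j => simpa only [map_mul, map_smul, FreeAlgebra.lift_ι_apply] using h.k_e i j
      | k_f i j => simpa only [map_mul, map_smul, FreeAlgebra.lift_ι_apply] using h.k_f i j
      | e_f i j =>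
        have := h.e_f i j
        split_ifs at this ⊢ <;>
          simpa only [map_mul, map_smul, map_sub, map_zero, FreeAlgebra.lift_ι_apply] using this
      | serre_e i j hij => simpa [map_serreSum] using h.serre_e i j hij
      | serre_f i j hij => simpa [map_serreSum] using h.serre_f i j hij⟩

section
variable {A : Type*} [Ring A] [Algebra K A] {E F Kp Km : J → A} (h : D.Relations E F Kp Km)

@[simp] theorem Uq.lift_e (i : J) : Uq.lift h (Uq.gen D (.e i)) = E i := by
  simp [Uq.lift, Uq.gen]
@[simp] theorem Uq.lift_f (i : J) : Uq.lift h (Uq.gen D (.f i)) = F i := by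
  simp [Uq.lift, Uq.gen]
@[simp] theorem Uq.lift_k (i : J) : Uq.lift h (Uq.gen D (.k i)) = Kp i := by
  simp [Uq.lift, Uq.gen]
@[simp] theorem Uq.lift_kinv (i : J) : Uq.lift h (Uq.gen D (.kinv i)) = Km i := by
  simp [Uq.lift, Uq.gen]
end

end lift

/-! ### The Serre sum as an iterated `q`-commutator -/

section serre

variable {K A : Type*} [Field K] [Ring A] [Algebra K A]

/-- Iterated `q`-commutators `Z ↦ X Z - c_k Z X`. -/
def iter (X : A) (c : ℕ → K) (Y : A) : ℕ → A
  | 0 => Y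
  | k + 1 => X * iter X c Y k - c k • (iter X c Y k * X)

variable {q : K}

theorem qsub_ne (hq : q ≠ 0) (hq1 : ∀ m : ℕ, 0 < m → q ^ m ≠ 1) : q - q⁻¹ ≠ 0 := by
  intro h
  apply hq1 2 (by norm_num)
  field_simp at h
  linear_combination h

theorem qInt_ne (hq : q ≠ 0) (hq1 : ∀ m : ℕ, 0 < m → q ^ m ≠ 1) (m : ℕ) :
    qInt q ((m : ℤ) + 1) ≠ 0 := by
  rw [qInt]
  refine div_ne_zero ?_ (qsub_ne hq hq1)
  intro h
  apply hq1 (2 * (m + 1)) (by omega)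
  rw [sub_eq_zero] at h
  have h2 : q ^ ((m : ℤ) + 1) * q ^ ((m : ℤ) + 1) = 1 := by
    nth_rewrite 1 [h]
    rw [← zpow_add₀ hq]; simp
  have h3 : q ^ ((m : ℤ) + 1) = q ^ (m + 1) := by exact_mod_cast zpow_natCast q (m + 1)
  rw [h3] at h2
  rw [two_mul, pow_add, h2]

theorem qFact_ne (hq : q ≠ 0) (hq1 : ∀ m : ℕ, 0 < m → q ^ m ≠ 1) (m : ℕ) : qFact q m ≠ 0 :=
  Finset.prod_ne_zero_iff.2 fun k _ => qInt_ne hq hq1 k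

theorem qFact_succ (m : ℕ) : qFact q (m + 1) = qFact q m * qInt q ((m : ℤ) + 1) := by
  simp [qFact, Finset.prod_range_succ]

theorem qInt_inv (m : ℤ) : qInt q⁻¹ m = qInt q m := by
  rw [qInt, qInt, ← neg_div_neg_eq]
  simp

theorem qFact_inv (m : ℕ) : qFact q⁻¹ m = qFact q m := by
  simp [qFact, qInt_inv]

theorem qInt_split (hq : q ≠ 0) (a b : ℤ) :
    qInt q (a + b) * q ^ a = qInt q b + q ^ (a + b) * qInt q a := by
  simp only [qInt, neg_add, zpow_add₀ hq, zpow_neg]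
  have := zpow_ne_zero a hq
  have := zpow_ne_zero b hq
  field_simp
  ring

/-- Coefficients of the expansion of the iterated `q`-commutator. -/
noncomputable def coef (q : K) (a : ℤ) (k ν : ℕ) : K :=
  (-1) ^ ν * q ^ ((ν : ℤ) * (a + k - 1)) * qFact q k / (qFact q ν * qFact q (k - ν))

theorem iter_eq_sum (hq : q ≠ 0) (hq1 : ∀ m : ℕ, 0 < m → q ^ m ≠ 1) (X Y : A) (a : ℤ) (k : ℕ) :
    iter X (fun t => q ^ (a + 2 * t)) Y k =
      ∑ ν ∈ Finset.range (k + 1), coef q a k ν • (X ^ (k - ν) * Y * X ^ ν) := by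
  have hF := qFact_ne hq hq1
  induction k with
  | zero => simp [iter, coef, qFact]
  | succ k ih =>
    have c0 : ∀ k, coef q a k 0 = 1 := by
      intro k; simp [coef, hF k, show qFact q 0 = 1 from by simp [qFact]]
    have e1 : X * iter X (fun t => q ^ (a + 2 * t)) Y k =
        X ^ (k + 1) * Y + ∑ ν ∈ Finset.range k,
          coef q a k (ν + 1) • (X ^ (k - ν) * Y * X ^ (ν + 1)) := by
      rw [ih, Finset.sum_range_succ', mul_add, c0, add_comm]
      simp only [Nat.sub_zero, pow_zero, mul_one, one_smul, ← mul_assoc, ← pow_succ']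
      congr 1
      rw [Finset.mul_sum]
      refine Finset.sum_congr rfl fun ν hν => ?_
      rw [mul_smul_comm, ← mul_assoc, ← mul_assoc, ← pow_succ']
      congr 4
      have := Finset.mem_range.1 hν
      omega
    have e2 : iter X (fun t => q ^ (a + 2 * t)) Y k * X =
        ∑ ν ∈ Finset.range k, coef q a k ν • (X ^ (k - ν) * Y * X ^ (ν + 1)) +
          coef q a k k • (Y * X ^ (k + 1)) := by
      rw [ih, Finset.sum_range_succ, add_mul, Finset.sum_mul]
      simp [pow_succ, mul_assoc]
    rw [iter, e1, e2, Finset.sum_range_succ', Finset.sum_range_succ, c0]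
    have last : coef q a (k + 1) (k + 1) = - (q ^ (a + 2 * (k : ℤ)) * coef q a k k) := by
      have h0 : qFact q 0 = 1 := by simp [qFact]
      have z : q ^ (((k + 1 : ℕ) : ℤ) * (a + ((k + 1 : ℕ) : ℤ) - 1)) =
          q ^ (a + 2 * (k : ℤ)) * q ^ ((k : ℤ) * (a + k - 1)) := by
        rw [← zpow_add₀ hq]; congr 1; push_cast; ring
      simp only [coef, Nat.sub_self, h0, z]
      have h1 := hF k
      have h2 := hF (k + 1)
      field_simp
      ring
    have mid : ∀ ν ∈ Finset.range k, coef q a (k + 1) (ν + 1) =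
        coef q a k (ν + 1) - q ^ (a + 2 * (k : ℤ)) * coef q a k ν := by
      intro ν hν
      obtain ⟨t, rfl⟩ : ∃ t, k = ν + 1 + t := ⟨k - (ν + 1), by
        have := Finset.mem_range.1 hν; omega⟩
      have s1 : ν + 1 + t + 1 - (ν + 1) = t + 1 := by omega
      have s2 : ν + 1 + t - (ν + 1) = t := by omega
      have s3 : ν + 1 + t - ν = t + 1 := by omega
      simp only [coef, s1, s2, s3, qFact_succ (ν + 1 + t), qFact_succ t, qFact_succ ν]
      have key := qInt_split hq ((ν : ℤ) + 1) ((t : ℤ) + 1)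
      have h1 := hF ν
      have h2 := hF t
      have h3 := qInt_ne hq hq1 ν
      have h4 := qInt_ne hq hq1 t
      have z1 : q ^ (((ν + 1 : ℕ) : ℤ) * (a + ((ν + 1 + t + 1 : ℕ) : ℤ) - 1)) =
          q ^ (((ν + 1 : ℕ) : ℤ) * (a + ((ν + 1 + t : ℕ) : ℤ) - 1)) * q ^ ((ν : ℤ) + 1) := by
        rw [← zpow_add₀ hq]; congr 1; push_cast; ring
      have z2 : q ^ (a + 2 * ((ν + 1 + t : ℕ) : ℤ)) *
          q ^ ((ν : ℤ) * (a + ((ν + 1 + t : ℕ) : ℤ) - 1)) =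
          q ^ (((ν + 1 : ℕ) : ℤ) * (a + ((ν + 1 + t : ℕ) : ℤ) - 1)) *
            q ^ (((ν : ℤ) + 1) + ((t : ℤ) + 1)) := by
        rw [← zpow_add₀ hq, ← zpow_add₀ hq]; congr 1; push_cast; ring
      have c1 : (((ν + 1 + t : ℕ) : ℤ) + 1) = ((ν : ℤ) + 1) + ((t : ℤ) + 1) := by
        push_cast; ring
      rw [c1, z1]
      have : ∀ B C D E : K, q ^ (a + 2 * ((ν + 1 + t : ℕ) : ℤ)) *
          (B * q ^ ((ν : ℤ) * (a + ((ν + 1 + t : ℕ) : ℤ) - 1)) * D / E) =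
          B * (q ^ (((ν + 1 : ℕ) : ℤ) * (a + ((ν + 1 + t : ℕ) : ℤ) - 1)) *
            q ^ (((ν : ℤ) + 1) + ((t : ℤ) + 1))) * D / E := by
        intro B C D E
        rw [← z2]; ring
      rw [this _ 1]
      generalize q ^ (((ν + 1 : ℕ) : ℤ) * (a + ((ν + 1 + t : ℕ) : ℤ) - 1)) = W at *
      rw [pow_succ]
      generalize qInt q ((ν : ℤ) + 1) = u1 at *
      generalize qInt q ((t : ℤ) + 1) = u2 at *
      field_simp
      linear_combination (-(W * qFact q (ν + 1 + t))) * key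
    have e3 : ∑ ν ∈ Finset.range k,
        coef q a (k + 1) (ν + 1) • (X ^ (k + 1 - (ν + 1)) * Y * X ^ (ν + 1)) =
        ∑ ν ∈ Finset.range k, (coef q a k (ν + 1) - q ^ (a + 2 * (k : ℤ)) * coef q a k ν) •
          (X ^ (k - ν) * Y * X ^ (ν + 1)) :=
      Finset.sum_congr rfl fun ν hν => by rw [mid ν hν, Nat.add_sub_add_right]
    rw [last, e3]
    simp only [sub_smul, Finset.sum_sub_distrib, smul_add, Finset.smul_sum, smul_smul, neg_smul,
      Nat.sub_self, Nat.sub_zero, pow_zero, one_mul, mul_one, one_smul]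
    abel

theorem serreSum_eq_iter (hq : q ≠ 0) (hq1 : ∀ m : ℕ, 0 < m → q ^ m ≠ 1) (X Y : A) (r : ℕ) :
    serreSum q r X Y = (qFact q r)⁻¹ • iter X (fun t => q ^ ((1 - r : ℤ) + 2 * t)) Y r := by
  rw [iter_eq_sum hq hq1, serreSum, Finset.smul_sum]
  refine Finset.sum_congr rfl fun ν _ => ?_
  have h := qFact_ne hq hq1
  have : (1 - r : ℤ) + r - 1 = 0 := by ring
  simp only [divPow, coef, this, mul_zero, zpow_zero, mul_one, smul_smul, smul_mul_assoc,
    mul_smul_comm]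
  have e : ((-1 : A)) ^ ν * (X ^ (r - ν) * Y * X ^ ν) =
      ((-1 : K) ^ ν) • (X ^ (r - ν) * Y * X ^ ν) := by
    rcases Nat.even_or_odd ν with hv | hv <;> simp [hv.neg_one_pow]
  rw [e, smul_smul]
  congr 1
  field_simp [h]

theorem serreSum_eq_iter' (hq : q ≠ 0) (hq1 : ∀ m : ℕ, 0 < m → q ^ m ≠ 1) (X Y : A) (r : ℕ) :
    serreSum q r X Y = (qFact q r)⁻¹ • iter X (fun t => q ^ (-((1 - r : ℤ) + 2 * t))) Y r := by
  have h : serreSum q r X Y = serreSum q⁻¹ r X Y := by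
    simp [serreSum, divPow, qFact_inv]
  rw [h, serreSum_eq_iter (inv_ne_zero hq) (by simpa using hq1), qFact_inv]
  simp only [zpow_neg, inv_zpow]

end serre

/-! ### The coproduct -/

section coproduct

variable {K : Type*} [Field K]

section
variable {A : Type*} [Ring A] [Algebra K A]

theorem iter_add (X : A) (c : ℕ → K) (Y Z : A) (k : ℕ) :
    iter X c (Y + Z) k = iter X c Y k + iter X c Z k := by
  induction k with
  | zero => rfl
  | succ k ih => simp only [iter, ih, mul_add, add_mul, smul_add]; abel

theorem iter_absorb {X B C : A} {α β : K} (c : ℕ → K) (hc : ∀ k, c k = α * β ^ k)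
    (h1 : B * C = α • (C * B)) (h2 : B * X = β • (X * B)) (k : ℕ) :
    B * iter X c C k = c k • (iter X c C k * B) ∧ iter (X + B) c C k = iter X c C k := by
  induction k with
  | zero => simp [iter, h1, hc]
  | succ k ih =>
    obtain ⟨i1, i2⟩ := ih
    refine ⟨?_, ?_⟩
    · have e1 : B * (X * iter X c C k) = (β * c k) • (X * iter X c C k * B) := by
        rw [← mul_assoc, h2, smul_mul_assoc, mul_assoc, i1, mul_smul_comm, smul_smul, mul_assoc]
      have e2 : B * (iter X c C k * X) = (β * c k) • (iter X c C k * X * B) := by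
        rw [← mul_assoc, i1, smul_mul_assoc, mul_assoc, h2, mul_smul_comm, smul_smul, mul_assoc,
          mul_comm]
      have e3 : c (k + 1) = β * c k := by rw [hc, hc]; ring
      rw [iter, mul_sub, mul_smul_comm, e1, e2, sub_mul, smul_sub, e3, smul_mul_assoc,
        smul_comm (c k)]
    · rw [iter, iter, i2, add_mul, i1, mul_add, smul_add]
      abel

theorem serreSum_add {q : K} (hq : q ≠ 0) (hq1 : ∀ m : ℕ, 0 < m → q ^ m ≠ 1) {a : ℤ}
    (ha : a ≤ 0) {X B C Y : A} (h1 : B * X = q ^ (2 : ℤ) • (X * B)) (h2 : B * C = q ^ a • (C * B))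
    (h3 : Y * X = q ^ a • (X * Y)) (s1 : serreSum q (1 - a).toNat X C = 0)
    (s2 : serreSum q (1 - a).toNat B Y = 0) :
    serreSum q (1 - a).toNat (X + B) (C + Y) = 0 := by
  obtain ⟨r, hr⟩ : ∃ r : ℕ, (1 - a).toNat = r := ⟨_, rfl⟩
  have ha' : (1 - r : ℤ) = a := by omega
  rw [hr] at s1 s2 ⊢
  have f0 := inv_ne_zero (qFact_ne hq hq1 r)
  have t1 : serreSum q r (X + B) C = 0 := by
    rw [serreSum_eq_iter hq hq1, ha'] at s1 ⊢
    rwa [(iter_absorb _ (α := q ^ a) (β := q ^ (2 : ℤ)) _ h2 h1 r).2]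
    intro k
    rw [zpow_add₀ hq, zpow_mul, zpow_natCast]
  have t2 : serreSum q r (X + B) Y = 0 := by
    rw [serreSum_eq_iter' hq hq1, ha'] at s2 ⊢
    rw [add_comm X B]
    rwa [(iter_absorb _ (α := q ^ (-a)) (β := q ^ (-2 : ℤ)) _ ?_ ?_ r).2]
    · intro k
      rw [neg_add, zpow_add₀ hq, ← neg_mul, zpow_mul, zpow_natCast]
    · rw [h3, smul_smul, ← zpow_add₀ hq]; simp
    · rw [h1, smul_smul, ← zpow_add₀ hq]; simp
  rw [serreSum_eq_iter hq hq1] at t1 t2 ⊢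
  rw [iter_add, smul_add, t1, t2, add_zero]

end

section
variable {A B : Type*} [Ring A] [Algebra K A] [Ring B] [Algebra K B]

theorem iter_tmul {x y : A} {k l : B} (h : k * l = l * k) (c : ℕ → K) (r : ℕ) :
    iter (x ⊗ₜ[K] k) c (y ⊗ₜ[K] l) r = iter x c y r ⊗ₜ[K] (k ^ r * l) := by
  have hc : Commute k l := h
  induction r with
  | zero => simp [iter]
  | succ r ih =>
    have e : k ^ r * l * k = k ^ (r + 1) * l := by
      rw [mul_assoc, ← h, ← mul_assoc, pow_succ]
    rw [iter, iter, ih]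
    simp only [Algebra.TensorProduct.tmul_mul_tmul, TensorProduct.sub_tmul, e, ← mul_assoc,
      ← pow_succ', TensorProduct.smul_tmul']

theorem iter_tmul' {x y : A} {k l : B} (h : x * y = y * x) (c : ℕ → K) (r : ℕ) :
    iter (x ⊗ₜ[K] k) c (y ⊗ₜ[K] l) r = (x ^ r * y) ⊗ₜ[K] iter k c l r := by
  induction r with
  | zero => simp [iter]
  | succ r ih =>
    have e : x ^ r * y * x = x ^ (r + 1) * y := by
      rw [mul_assoc, ← h, ← mul_assoc, pow_succ]
    rw [iter, iter, ih]
    simp only [Algebra.TensorProduct.tmul_mul_tmul, TensorProduct.tmul_sub, e, ← mul_assoc,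
      ← pow_succ', TensorProduct.tmul_smul]

theorem serreSum_tmul {q : K} (hq : q ≠ 0) (hq1 : ∀ m : ℕ, 0 < m → q ^ m ≠ 1) {x y : A}
    {k l : B} (h : k * l = l * k) {r : ℕ}
    (s : serreSum q r x y = 0) : serreSum q r (x ⊗ₜ[K] k) (y ⊗ₜ[K] l) = 0 := by
  have f0 := inv_ne_zero (qFact_ne hq hq1 r)
  rw [serreSum_eq_iter hq hq1, smul_eq_zero_iff_right f0] at s ⊢
  rw [iter_tmul h, s, TensorProduct.zero_tmul]

theorem serreSum_tmul' {q : K} (hq : q ≠ 0) (hq1 : ∀ m : ℕ, 0 < m → q ^ m ≠ 1) {x y : A}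
    {k l : B} (h : x * y = y * x) {r : ℕ}
    (s : serreSum q r k l = 0) : serreSum q r (x ⊗ₜ[K] k) (y ⊗ₜ[K] l) = 0 := by
  have f0 := inv_ne_zero (qFact_ne hq hq1 r)
  rw [serreSum_eq_iter hq hq1, smul_eq_zero_iff_right f0] at s ⊢
  rw [iter_tmul' h, s, TensorProduct.tmul_zero]

end

namespace Datum.Relations

variable {J : Type*} [DecidableEq J] {D : Datum J K} {A B : Type*} [Ring A] [Algebra K A]
  [Ring B] [Algebra K B]

section
variable {E F Kp Km : J → A}

theorem kE (h : D.Relations E F Kp Km) (i j : J) : Kp i * E j = D.q i ^ D.a i j • (E j * Kp i) := by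
  rw [← smul_mul_assoc, ← h.k_e, mul_assoc, h.kinv_k, mul_one]

theorem kF (h : D.Relations E F Kp Km) (i j : J) : Kp i * F j = D.q i ^ (-D.a i j) • (F j * Kp i) := by
  rw [← smul_mul_assoc, ← h.k_f, mul_assoc, h.kinv_k, mul_one]

theorem kmE (h : D.Relations E F Kp Km) (i j : J) : Km i * E j = D.q i ^ (-D.a i j) • (E j * Km i) := by
  have e : E j = D.q i ^ (-D.a i j) • (Kp i * E j * Km i) := by
    rw [h.k_e, smul_smul, ← zpow_add₀ (D.q_ne i)]; simp
  conv_lhs => rw [e]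
  rw [mul_smul_comm, ← mul_assoc, ← mul_assoc, h.kinv_k, one_mul]

theorem kmF (h : D.Relations E F Kp Km) (i j : J) : Km i * F j = D.q i ^ D.a i j • (F j * Km i) := by
  have e : F j = D.q i ^ D.a i j • (Kp i * F j * Km i) := by
    rw [h.k_f, smul_smul, ← zpow_add₀ (D.q_ne i)]; simp
  conv_lhs => rw [e]
  rw [mul_smul_comm, ← mul_assoc, ← mul_assoc, h.kinv_k, one_mul]

theorem km_km (h : D.Relations E F Kp Km) (i j : J) : Km i * Km j = Km j * Km i := by
  calc Km i * Km j = Km i * Km j * (Kp i * Kp j * (Km j * Km i)) := by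
        rw [mul_assoc (Kp i), ← mul_assoc (Kp j), h.k_kinv, one_mul, h.k_kinv, mul_one]
    _ = Km i * Km j * (Kp j * Kp i) * (Km j * Km i) := by rw [h.k_k]; simp only [mul_assoc]
    _ = Km j * Km i := by
        rw [mul_assoc (Km i), ← mul_assoc (Km j), h.kinv_k, one_mul, h.kinv_k, one_mul]

end

/-- The coproduct formulas preserve the defining relations. -/
theorem coproduct {E F Kp Km : J → A} (h : D.Relations E F Kp Km)
    {E' F' Kp' Km' : J → B} (h' : D.Relations E' F' Kp' Km') :
    D.Relations (A := A ⊗[K] B) (fun i => 1 ⊗ₜ E' i + E i ⊗ₜ Kp' i)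
      (fun i => F i ⊗ₜ 1 + Km i ⊗ₜ F' i) (fun i => Kp i ⊗ₜ Kp' i) (fun i => Km i ⊗ₜ Km' i) where
  k_kinv i := by simp [h.k_kinv, h'.k_kinv, Algebra.TensorProduct.one_def]
  kinv_k i := by simp [h.kinv_k, h'.kinv_k, Algebra.TensorProduct.one_def]
  k_k i j := by simp [h.k_k i j, h'.k_k i j]
  k_e i j := by
    simp only [mul_add, add_mul, Algebra.TensorProduct.tmul_mul_tmul, mul_one, h.k_kinv, h'.k_e,
      h.k_e, h'.k_k i j, mul_assoc, h'.k_kinv, smul_add, TensorProduct.tmul_smul]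
    simp only [TensorProduct.smul_tmul']
  k_f i j := by
    have e : Kp i * Km j * Km i = Km j := by
      rw [mul_assoc, h.km_km, ← mul_assoc, h.k_kinv, one_mul]
    simp only [mul_add, add_mul, Algebra.TensorProduct.tmul_mul_tmul, mul_one, h.k_f, h'.k_f,
      h'.k_kinv, e, smul_add, TensorProduct.tmul_smul, TensorProduct.smul_tmul']
  e_f i j := by
    have c1 : (E i * Km j) ⊗ₜ[K] (Kp' i * F' j) = (Km j * E i) ⊗ₜ[K] (F' j * Kp' i) := by
      rw [h.kmE, h'.kF, TensorProduct.tmul_smul, TensorProduct.smul_tmul', zpow_neg, zpow_neg,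
        D.symm i j]
    have c2 : (1 * F j) ⊗ₜ[K] (E' i * 1) = (F j * 1) ⊗ₜ[K] (1 * E' i) := by simp
    have c3 : (1 * Km j) ⊗ₜ[K] (E' i * F' j) - (Km j * 1) ⊗ₜ[K] (F' j * E' i) =
        Km j ⊗ₜ[K] (E' i * F' j - F' j * E' i) := by
      simp [TensorProduct.tmul_sub]
    have c4 : (E i * F j) ⊗ₜ[K] (Kp' i * 1) - (F j * E i) ⊗ₜ[K] (1 * Kp' i) =
        (E i * F j - F j * E i) ⊗ₜ[K] Kp' i := by
      simp [TensorProduct.sub_tmul]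
    have c5 : (1 ⊗ₜ E' i + E i ⊗ₜ Kp' i) * (F j ⊗ₜ 1 + Km j ⊗ₜ F' j) -
        (F j ⊗ₜ 1 + Km j ⊗ₜ F' j) * (1 ⊗ₜ E' i + E i ⊗ₜ Kp' i) =
        Km j ⊗ₜ[K] (E' i * F' j - F' j * E' i) + (E i * F j - F j * E i) ⊗ₜ[K] Kp' i := by
      rw [← c3, ← c4]
      simp only [mul_add, add_mul, Algebra.TensorProduct.tmul_mul_tmul]
      rw [c1, c2]
      abel
    rw [c5, h.e_f, h'.e_f]
    split_ifs with hij
    · subst hij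
      rw [TensorProduct.tmul_smul, ← TensorProduct.smul_tmul', ← smul_add]
      congr 1
      simp [TensorProduct.tmul_sub, TensorProduct.sub_tmul]
    · simp
  serre_e i j hij := by
    refine serreSum_add (D.q_ne i) (D.q_pow i) (D.offdiag i j hij) ?_ ?_ ?_ ?_ ?_
    · simp [h'.kE, D.diag, TensorProduct.tmul_smul]
    · simp [h'.kE, TensorProduct.tmul_smul]
    · simp [h'.kE, TensorProduct.tmul_smul, D.symm i j]
    · exact serreSum_tmul' (D.q_ne i) (D.q_pow i) rfl (h'.serre_e i j hij)
    · exact serreSum_tmul (D.q_ne i) (D.q_pow i) (h'.k_k i j) (h.serre_e i j hij)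
  serre_f i j hij := by
    refine serreSum_add (D.q_ne i) (D.q_pow i) (D.offdiag i j hij) ?_ ?_ ?_ ?_ ?_
    · simp [h.kmF, D.diag, TensorProduct.smul_tmul']
    · simp [h.kmF, TensorProduct.smul_tmul']
    · simp [h.kmF, TensorProduct.smul_tmul', D.symm i j]
    · exact serreSum_tmul (D.q_ne i) (D.q_pow i) rfl (h.serre_f i j hij)
    · exact serreSum_tmul' (D.q_ne i) (D.q_pow i) (h.km_km i j) (h'.serre_f i j hij)

end Datum.Relations

variable {J : Type*} [DecidableEq J] (D : Datum J K)

/-- The coproduct `Δ k_i = k_i ⊗ k_i`, `Δ e_i = 1 ⊗ e_i + e_i ⊗ k_i`,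
`Δ f_i = f_i ⊗ 1 + k_i⁻¹ ⊗ f_i`. -/
noncomputable def Uq.comul : Uq D →ₐ[K] Uq D ⊗[K] Uq D :=
  Uq.lift ((Uq.relations D).coproduct (Uq.relations D))

variable {D}

/-- The tensor product `(ρ ⊗ σ) ∘ Δ` of two representations. -/
noncomputable def Uq.tensor {M N : Type*} [AddCommGroup M] [Module K M] [AddCommGroup N]
    [Module K N] (ρ : Uq D →ₐ[K] Module.End K M) (σ : Uq D →ₐ[K] Module.End K N) :
    Uq D →ₐ[K] Module.End K (M ⊗[K] N) :=
  (Module.endTensorEndAlgHom.comp (Algebra.TensorProduct.map ρ σ)).comp (Uq.comul D)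

/-- A representation of the Drinfeld-Jimbo algebra is irreducible if its space is nonzero and has
no invariant subspaces other than zero and itself. -/
def Uq.IsIrreducible {M : Type*} [AddCommGroup M] [Module K M]
    (ρ : Uq D →ₐ[K] Module.End K M) : Prop :=
  Representation.IsIrreducible (k := K) (G := Uq D) (V := M) (ρ : Uq D →* Module.End K M)

end coproduct

/-! ### The `q`-oscillator representations -/

section oscillator

/-- A vertex of the Dynkin diagrams considered: a `mid` vertex has `q_i = q`; a `short` end vertex
has `q_i = s` with `s ^ 2 = q`, and comes with a square root `I` of `-1`; a `long` end vertex has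
`q_i = q ^ 2`. -/
inductive Node (K : Type*)
  | mid
  | short (s I : K)
  | long

namespace Node

variable {K : Type*} [Field K]

/-- The scalar `q_i`. -/
def qv (q : K) : Node K → K
  | mid => q
  | short s _ => s
  | long => q ^ 2

/-- The integer `log q_i / log q ^ (1/2)`. -/
def len : Node K → ℕ
  | mid => 2
  | short _ _ => 1
  | long => 4

/-- The change of an occupation number made by `e_i` and `f_i`. -/
def step : Node K → ℤ
  | mid => 1
  | short _ _ => 1
  | long => 2

/-- The coefficient with which `e_i` or `f_i` lowers the occupation number `m`:
`[m]`, `i κ [m]` with `κ = (q + 1) / (q - 1)`, or `[m] [m - 1] / [2] ^ 2`. -/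
noncomputable def low (q : K) : Node K → ℤ → K
  | mid, m => qInt q m
  | short _ I, m => I * ((q + 1) / (q - 1)) * qInt q m
  | long, m => qInt q m * qInt q (m - 1) / qInt q 2 ^ 2

/-- The eigenvalues `q ^ m`, `-i q ^ (m + 1/2)`, `-q ^ (2 m + 1)`. -/
noncomputable def kval (q : K) : Node K → ℤ → K
  | mid, m => q ^ m
  | short s I, m => -I * s * q ^ m
  | long, m => -q ^ (2 * m + 1)

/-- Validity of an end vertex. -/
def IsEnd (q : K) : Node K → Prop
  | mid => False
  | short s I => s ^ 2 = q ∧ I ^ 2 = -1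
  | long => True

end Node

/-- Rank, quantum parameter and the two end vertices `0` and `n` of the Dynkin diagram. -/
structure Osc (K : Type*) [Field K] where
  n : ℕ
  q : K
  left : Node K
  right : Node K
  one_le : 1 ≤ n
  q_ne : q ≠ 0
  q_pow : ∀ m : ℕ, 0 < m → q ^ m ≠ 1
  left_isEnd : left.IsEnd q
  right_isEnd : right.IsEnd q

namespace Osc

variable {K : Type*} [Field K] (P : Osc K)

/-- The type of the vertex `i`. -/
def node (i : Fin (P.n + 1)) : Node K :=
  if i.val = 0 then P.left else if i.val = P.n then P.right else .mid

/-- The Cartan integers: `a_{ij} = - max (log q_j / log q_i, 1)` for neighbours, except that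
`a_{01} = a_{10} = -2` for the two vertices of the same length when `n = 1`. -/
def cartan (i j : Fin (P.n + 1)) : ℤ :=
  if i = j then 2
  else if i.val + 1 = j.val ∨ j.val + 1 = i.val then
    if P.n = 1 ∧ (P.node i).len = (P.node j).len then -2
    else -max (((P.node j).len / (P.node i).len : ℕ) : ℤ) 1
  else 0

/-- The occupation number of the `(t + 1)`-st site. -/
def occ {n : ℕ} (m : Fin n → ℤ) (t : ℕ) : ℤ := if h : t < n then m ⟨t, h⟩ else 0

/-- The change of the occupation numbers made by `e_i`; `f_i` makes the opposite change. The
sites are `0, …, n - 1`: the generator `e_i` lowers the site `i - 1` and raises the site `i`. -/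
def shift (i : Fin (P.n + 1)) : Fin P.n → ℤ := fun j =>
  (if j.val = i.val then (P.node i).step else 0) -
    (if j.val + 1 = i.val then (P.node i).step else 0)

/-- The coefficient of `e_i |m⟩`. -/
noncomputable def eCoef (x : K) (i : Fin (P.n + 1)) (m : Fin P.n → ℤ) : K :=
  if i.val = 0 then x else (P.node i).low P.q (occ m (i.val - 1))

/-- The coefficient of `f_i |m⟩`. -/
noncomputable def fCoef (x : K) (i : Fin (P.n + 1)) (m : Fin P.n → ℤ) : K :=
  (if i.val = P.n then 1 else (P.node i).low P.q (occ m i.val)) * (if i.val = 0 then x⁻¹ else 1)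

/-- The eigenvalue of `k_i` on `|m⟩`. -/
noncomputable def kCoef (i : Fin (P.n + 1)) (m : Fin P.n → ℤ) : K :=
  (if i.val = P.n then 1 else (P.node i).kval P.q (occ m i.val)) *
    (if i.val = 0 then 1 else ((P.node i).kval P.q (occ m (i.val - 1)))⁻¹)

end Osc

open Classical in
/-- The operator `|m⟩ ↦ c(m) |m + α⟩` on the space with basis `|m⟩`, `m ∈ S`, where `|m + α⟩` is
read as zero when `m + α` does not lie in `S`. -/
noncomputable def ketOp {K : Type*} [Field K] {n : ℕ} (S : Set (Fin n → ℤ)) (α : Fin n → ℤ)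
    (c : (Fin n → ℤ) → K) : Module.End K (S →₀ K) :=
  Finsupp.linearCombination K fun m : S =>
    if h : m.1 + α ∈ S then Finsupp.single (⟨m.1 + α, h⟩ : S) (c m.1) else 0

section ketOp

variable {K : Type*} [Field K] {n : ℕ} {S : Set (Fin n → ℤ)}

theorem ketOp_single (α : Fin n → ℤ) (c : (Fin n → ℤ) → K) (m : S) (h : m.1 + α ∈ S) :
    ketOp S α c (Finsupp.single m 1) = Finsupp.single ⟨m.1 + α, h⟩ (c m.1) := by
  simp [ketOp, h]

theorem ketOp_single' (α : Fin n → ℤ) (c : (Fin n → ℤ) → K) (m : S) (h : m.1 + α ∉ S) :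
    ketOp S α c (Finsupp.single m 1) = 0 := by
  simp [ketOp, h]

theorem ketOp_ext (α : Fin n → ℤ) {c c' : (Fin n → ℤ) → K} (h : ∀ m ∈ S, c m = c' m) :
    ketOp S α c = ketOp S α c' := by
  refine Finsupp.lhom_ext' fun m => LinearMap.ext_ring ?_
  simp only [LinearMap.comp_apply, Finsupp.lsingle_apply]
  by_cases hm : m.1 + α ∈ S
  · rw [ketOp_single _ _ _ hm, ketOp_single _ _ _ hm, h _ m.2]
  · rw [ketOp_single' _ _ _ hm, ketOp_single' _ _ _ hm]

theorem ketOp_mul {α β : Fin n → ℤ} {c d : (Fin n → ℤ) → K}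
    (h : ∀ m ∈ S, m + β ∉ S → d m = 0) :
    ketOp S α c * ketOp S β d = ketOp S (β + α) fun m => d m * c (m + β) := by
  refine Finsupp.lhom_ext' fun m => LinearMap.ext_ring ?_
  simp only [LinearMap.comp_apply, Finsupp.lsingle_apply, Module.End.mul_apply]
  by_cases hb : m.1 + β ∈ S
  · rw [ketOp_single _ _ _ hb, ← mul_one (d m.1), ← smul_eq_mul, ← Finsupp.smul_single, map_smul]
    by_cases ha : m.1 + β + α ∈ S
    · have ha' : m.1 + (β + α) ∈ S := by rwa [← add_assoc]
      rw [ketOp_single _ _ _ ha, ketOp_single _ _ _ ha']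
      simp [add_assoc]
    · have ha' : m.1 + (β + α) ∉ S := by rwa [← add_assoc]
      rw [ketOp_single' _ _ _ ha, ketOp_single' _ _ _ ha', smul_zero]
  · rw [ketOp_single' _ _ _ hb, map_zero]
    by_cases ha' : m.1 + (β + α) ∈ S
    · rw [ketOp_single _ _ _ ha', h _ m.2 hb]; simp
    · rw [ketOp_single' _ _ _ ha']

theorem ketOp_sub (α : Fin n → ℤ) (c d : (Fin n → ℤ) → K) :
    ketOp S α c - ketOp S α d = ketOp S α fun m => c m - d m := by
  refine Finsupp.lhom_ext' fun m => LinearMap.ext_ring ?_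
  simp only [LinearMap.comp_apply, Finsupp.lsingle_apply, LinearMap.sub_apply]
  by_cases hm : m.1 + α ∈ S
  · simp only [ketOp_single _ _ _ hm, Finsupp.single_sub]
  · simp only [ketOp_single' _ _ _ hm, sub_zero]

theorem ketOp_smul (α : Fin n → ℤ) (a : K) (c : (Fin n → ℤ) → K) :
    a • ketOp S α c = ketOp S α fun m => a * c m := by
  refine Finsupp.lhom_ext' fun m => LinearMap.ext_ring ?_
  simp only [LinearMap.comp_apply, Finsupp.lsingle_apply, LinearMap.smul_apply]
  by_cases hm : m.1 + α ∈ S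
  · simp only [ketOp_single _ _ _ hm, Finsupp.smul_single, smul_eq_mul]
  · simp only [ketOp_single' _ _ _ hm, smul_zero]

theorem ketOp_zero (α : Fin n → ℤ) : ketOp S α (fun _ => (0 : K)) = 0 := by
  have := ketOp_smul (S := S) α (0 : K) (fun _ => 0)
  simpa using this.symm

theorem ketOp_one : ketOp S 0 (fun _ => (1 : K)) = 1 := by
  refine Finsupp.lhom_ext' fun m => LinearMap.ext_ring ?_
  have hm : m.1 + 0 ∈ S := by rw [add_zero]; exact m.2
  simp only [LinearMap.comp_apply, Finsupp.lsingle_apply, ketOp_single _ _ _ hm]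
  simp

end ketOp

/-- The coefficients of an iterated `q`-commutator of operators `ketOp`. -/
def iterCoef {K : Type*} [Field K] {n : ℕ} (α : Fin n → ℤ) (c : (Fin n → ℤ) → K)
    (β : Fin n → ℤ) (d : (Fin n → ℤ) → K) (b : ℕ → K) : ℕ → (Fin n → ℤ) → K
  | 0, m => d m
  | k + 1, m => iterCoef α c β d b k m * c (m + (β + k • α)) -
      b k * (c m * iterCoef α c β d b k (m + α))

theorem iter_ketOp {K : Type*} [Field K] {n : ℕ} {S : Set (Fin n → ℤ)} {α β : Fin n → ℤ}
    {c d : (Fin n → ℤ) → K} (hc : ∀ m ∈ S, m + α ∉ S → c m = 0)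
    (hd : ∀ m ∈ S, m + β ∉ S → d m = 0) (b : ℕ → K) (k : ℕ) :
    iter (ketOp S α c) b (ketOp S β d) k =
      ketOp S (β + k • α) (iterCoef α c β d b k) ∧
      ∀ m ∈ S, m + (β + k • α) ∉ S → iterCoef α c β d b k m = 0 := by
  induction k with
  | zero => exact ⟨by simp only [iter, zero_smul, add_zero]; rfl, by simpa [iterCoef] using hd⟩
  | succ k ih =>
    obtain ⟨i1, i2⟩ := ih
    have e : α + (β + k • α) = β + k • α + α := by abel
    have e' : β + (k + 1) • α = β + k • α + α := by rw [succ_nsmul]; abel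
    refine ⟨?_, ?_⟩
    · rw [iter, i1, ketOp_mul i2, ketOp_mul hc, e, ketOp_smul, ketOp_sub, e']
      rfl
    · intro m hm hm'
      rw [e'] at hm'
      have t1 : iterCoef α c β d b k m * c (m + (β + k • α)) = 0 := by
        by_cases h : m + (β + k • α) ∈ S
        · rw [hc _ h (by rwa [add_assoc]), mul_zero]
        · rw [i2 _ hm h, zero_mul]
      have t2 : c m * iterCoef α c β d b k (m + α) = 0 := by
        by_cases h : m + α ∈ S
        · rw [i2 _ h (by rwa [add_assoc, e]), mul_zero]
        · rw [hc _ hm h, zero_mul]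
      rw [iterCoef, t1, t2]; simp

section scalar

variable {K : Type*} [Field K]

/-- Iterated `q`-commutators of a raising with a lowering operator, at one site. -/
def iterUp (low : ℤ → K) (r : ℤ) (b : ℕ → K) : ℕ → ℤ → K
  | 0, v => low v
  | k + 1, v => iterUp low r b k v - b k * iterUp low r b k (v + r)

/-- Iterated `q`-commutators of a lowering with a raising operator, at one site. -/
def iterDn (low : ℤ → K) (l r : ℤ) (b : ℕ → K) : ℕ → ℤ → K
  | 0, _ => 1
  | k + 1, v => iterDn low l r b k v * low (v + r - k * l) -
      b k * (low v * iterDn low l r b k (v - l))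

namespace Node

/-- The Cartan integer of two neighbours. -/
def adj (A B : Node K) : ℤ :=
  if A.len = B.len ∧ A.len ≠ 2 then -2 else -max ((B.len / A.len : ℕ) : ℤ) 1

/-- A valid vertex. -/
def Ok (q : K) (A : Node K) : Prop := A = mid ∨ A.IsEnd q

theorem qInt_shift0 {q : K} (v : ℤ) :
    qInt q v = (q - q⁻¹)⁻¹ * (q ^ v - (q ^ v)⁻¹) := by
  rw [qInt, zpow_neg, div_eq_inv_mul]

theorem iterUp_eq_zero {q : K} (hq : q ≠ 0) {A B : Node K} (hA : A.Ok q) (hB : B.Ok q) (v : ℤ) :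
    iterUp (B.low q) A.step (fun t => A.qv q ^ (A.adj B + 2 * t)) (1 - A.adj B).toNat v = 0 := by
  have hQ := zpow_ne_zero v hq
  rcases A with _ | ⟨s, I⟩ | _ <;> rcases B with _ | ⟨s', I'⟩ | _ <;>
    simp [Ok, IsEnd] at hA hB <;>
    simp [adj, len, step, qv, iterUp, add_assoc, add_sub_assoc, low] <;>
    (try rw [show s ^ 4 = q ^ 2 by rw [← hA.1]; ring]) <;>
    (try rw [hA.1]) <;>
    (try simp only [div_eq_mul_inv]) <;>
    generalize qInt q 2 = w <;>
    generalize (q - 1)⁻¹ = t <;>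
    simp only [qInt_shift0, zpow_add₀ hq, zpow_sub₀ hq, zpow_ofNat] <;>
    generalize (q - q⁻¹)⁻¹ = d <;>
    generalize (w ^ 2)⁻¹ = w' <;>
    generalize q ^ v = Q at hQ ⊢ <;>
    field_simp <;> ring

theorem iterDn_eq_zero {q : K} (hq : q ≠ 0) {A B : Node K} (hA : A.Ok q) (hB : B.Ok q) (v : ℤ) :
    iterDn (A.low q) A.step B.step (fun t => A.qv q ^ (A.adj B + 2 * t)) (1 - A.adj B).toNat v =
      0 := by
  have hQ := zpow_ne_zero v hq
  rcases A with _ | ⟨s, I⟩ | _ <;> rcases B with _ | ⟨s', I'⟩ | _ <;>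
    simp [Ok, IsEnd] at hA hB <;>
    simp [adj, len, step, qv, iterDn, sub_sub, add_sub_assoc, low] <;>
    (try rw [show s ^ 4 = q ^ 2 by rw [← hA.1]; ring]) <;>
    (try rw [hA.1]) <;>
    (try simp only [div_eq_mul_inv]) <;>
    generalize qInt q 2 = w <;>
    generalize (q - 1)⁻¹ = t <;>
    simp only [qInt_shift0, zpow_add₀ hq, zpow_sub₀ hq, zpow_neg, zpow_ofNat] <;>
    generalize (q - q⁻¹)⁻¹ = d <;>
    generalize (w ^ 2)⁻¹ = w' <;>
    generalize q ^ v = Q at hQ ⊢ <;>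
    field_simp <;> ring

theorem low_comm {q : K} {A B : Node K} (v : ℤ) :
    A.low q v * B.low q (v - A.step) = B.low q v * A.low q (v - B.step) := by
  rcases A with _ | ⟨s, I⟩ | _ <;> rcases B with _ | ⟨s', I'⟩ | _ <;>
    simp [step, low, sub_sub] <;> ring

theorem Ok.qv_ne {q : K} (hq : q ≠ 0) {A : Node K} (hA : A.Ok q) : A.qv q ≠ 0 := by
  rcases A with _ | ⟨s, I⟩ | _
  · exact hq
  · rintro (rfl : s = 0)
    simp [Ok, IsEnd] at hA
    exact hq hA.1.symm
  · exact pow_ne_zero 2 hq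

theorem Ok.qv_pow {q : K} (hq1 : ∀ m : ℕ, 0 < m → q ^ m ≠ 1) {A : Node K} (hA : A.Ok q)
    (m : ℕ) (hm : 0 < m) : A.qv q ^ m ≠ 1 := by
  rcases A with _ | ⟨s, I⟩ | _
  · exact hq1 m hm
  · intro (h : s ^ m = 1)
    simp [Ok, IsEnd] at hA
    apply hq1 m hm
    rw [← hA.1, ← pow_mul, mul_comm, pow_mul, h, one_pow]
  · intro (h : (q ^ 2) ^ m = 1)
    exact hq1 (2 * m) (by omega) (by rw [pow_mul, h])

theorem Ok.kval_ne {q : K} (hq : q ≠ 0) {A : Node K} (hA : A.Ok q) (v : ℤ) :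
    A.kval q v ≠ 0 := by
  rcases A with _ | ⟨s, I⟩ | _
  · exact zpow_ne_zero v hq
  · have hs := hA.qv_ne hq
    simp [Ok, IsEnd] at hA
    have hI : I ≠ 0 := by rintro rfl; simp at hA
    exact mul_ne_zero (mul_ne_zero (neg_ne_zero.2 hI) hs) (zpow_ne_zero v hq)
  · exact neg_ne_zero.2 (zpow_ne_zero _ hq)

theorem adj_symm {q : K} {A B : Node K} (hA : A.Ok q) (hB : B.Ok q) :
    A.qv q ^ A.adj B = B.qv q ^ B.adj A := by
  rcases A with _ | ⟨s, I⟩ | _ <;> rcases B with _ | ⟨s', I'⟩ | _ <;>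
    simp [Ok, IsEnd] at hA hB <;>
    simp [adj, len, qv, hA, hB, zpow_neg, zpow_ofNat] <;>
    (try rw [← hA.1]) <;> (try rw [← hB.1]) <;> ring

theorem kval_sub {q : K} (hq : q ≠ 0) {A B : Node K} (hA : A.Ok q) (hB : B.Ok q) (v : ℤ) :
    A.kval q (v - B.step) = A.qv q ^ A.adj B * A.kval q v := by
  have hQ := zpow_ne_zero v hq
  have hs := hA.qv_ne hq
  rcases A with _ | ⟨s, I⟩ | _ <;> rcases B with _ | ⟨s', I'⟩ | _ <;>
    simp [Ok, IsEnd] at hA hB <;>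
    simp only [qv] at hs <;>
    simp [adj, len, qv, kval, step, zpow_neg, zpow_ofNat, zpow_sub₀ hq, mul_sub, zpow_add₀ hq] <;>
    (try rw [show s ^ 4 = q ^ 2 by rw [← hA.1]; ring]) <;>
    (try rw [hA.1]) <;>
    field_simp

theorem kval_add_step {q : K} (hq : q ≠ 0) {A : Node K} (hA : A.IsEnd q) (v : ℤ) :
    A.kval q (v + A.step) = A.qv q ^ (2 : ℤ) * A.kval q v := by
  rcases A with _ | ⟨s, I⟩ | _ <;>
    simp [IsEnd] at hA <;>
    simp [qv, kval, step, zpow_ofNat, mul_add, zpow_add₀ hq] <;>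
    (try rw [hA.1]) <;> ring

theorem e_f_end {q : K} (hq : q ≠ 0) (hq1 : ∀ m : ℕ, 0 < m → q ^ m ≠ 1) {A : Node K}
    (hA : A.IsEnd q) (v : ℤ) :
    A.low q v - A.low q (v + A.step) =
      (A.qv q - (A.qv q)⁻¹)⁻¹ * (A.kval q v - (A.kval q v)⁻¹) := by
  have hA' : A.Ok q := Or.inr hA
  have hQ := zpow_ne_zero v hq
  have hs := hA'.qv_ne hq
  have h1 := qsub_ne hs (hA'.qv_pow hq1)
  have h2 := qsub_ne hq hq1
  have h3 : q - 1 ≠ 0 := sub_ne_zero.2 (by simpa using hq1 1 one_pos)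
  have h4 : q + 1 ≠ 0 := fun h => hq1 2 (by norm_num) (by linear_combination (q - 1) * h)
  have h5 : q ^ 2 + 1 ≠ 0 := fun h => hq1 4 (by norm_num) (by linear_combination (q ^ 2 - 1) * h)
  rcases A with _ | ⟨s, I⟩ | _
  · exact hA.elim
  · obtain ⟨rfl, hI⟩ := hA
    have hI0 : I ≠ 0 := by rintro rfl; simp at hI
    have hIi : I⁻¹ = -I := by
      field_simp
      linear_combination hI
    have e1 : (-I * s * (s ^ 2) ^ v)⁻¹ = I * s⁻¹ * ((s ^ 2) ^ v)⁻¹ := by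
      rw [mul_inv, mul_inv, inv_neg, hIi, neg_neg]
    have hs' : s ≠ 0 := hs
    have h1' : s ^ 2 - 1 ≠ 0 := h3
    have h6 : s ^ 2 - (s ^ 2)⁻¹ = (s ^ 2 - 1) * (s ^ 2 + 1) / s ^ 2 := by field_simp; ring
    have h7 : s - s⁻¹ = (s ^ 2 - 1) / s := by field_simp
    simp only [kval, e1, low, step, qv, qInt_shift0, zpow_add₀ hq, zpow_one, h6, h7]
    generalize (s ^ 2) ^ v = Q at hQ ⊢
    field_simp
    ring
  · have h6 : q - q⁻¹ = (q - 1) * (q + 1) / q := by field_simp; ring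
    have h7 : q ^ 2 - (q ^ 2)⁻¹ = (q - 1) * (q + 1) * (q ^ 2 + 1) / q ^ 2 := by
      field_simp; ring
    have e2 : qInt q 2 = (q ^ 2 + 1) / q := by
      simp only [qInt_shift0, h6, zpow_ofNat]
      field_simp
      ring
    have e3 : v + 2 - 1 = v + 1 := by ring
    have e4 : q ^ (2 * v + 1) = (q ^ v) ^ 2 * q := by
      rw [zpow_add₀ hq, two_mul, zpow_add₀ hq, zpow_one, sq]
    simp only [kval, low, step, qv, e2, e3, e4, h7]
    simp only [qInt_shift0, zpow_add₀ hq, zpow_sub₀ hq, zpow_ofNat, h6]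
    generalize q ^ v = Q at hQ ⊢
    field_simp
    ring

end Node

section vector

variable {n : ℕ} {α β : Fin n → ℤ} {c d : (Fin n → ℤ) → K} {π : (Fin n → ℤ) → ℤ} {low : ℤ → K}
  {l r : ℤ}

theorem iterCoef_up {e : K} (h1 : ∀ m, c (m + β) = c m) (h2 : ∀ m, d m = e * low (π m))
    (h3 : ∀ m, π (m + α) = π m + r) (b : ℕ → K) (k : ℕ) (m : Fin n → ℤ) :
    iterCoef α c β d b k m =
      e * (∏ t ∈ Finset.range k, c (m + t • α)) * iterUp low r b k (π m) := by
  induction k generalizing m with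
  | zero => simp [iterCoef, iterUp, h2]
  | succ k ih =>
    have e1 : c (m + (β + k • α)) = c (m + k • α) := by
      rw [← h1 (m + k • α)]; congr 1; abel
    have e2 : c m * ∏ t ∈ Finset.range k, c (m + α + t • α) =
        ∏ t ∈ Finset.range (k + 1), c (m + t • α) := by
      rw [Finset.prod_range_succ', mul_comm]
      congr 1
      · refine Finset.prod_congr rfl fun t _ => ?_
        rw [succ_nsmul', add_assoc]
      · simp
    rw [iterCoef, iterUp, ih, ih, e1, h3, ← mul_assoc (c m), mul_left_comm (c m), e2,
      Finset.prod_range_succ]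
    ring

theorem iterCoef_dn {e : K} (h1 : ∀ m, d (m + α) = d m) (h2 : ∀ m, c m = e * low (π m))
    (h3 : ∀ m, π (m + α) = π m - l) (h4 : ∀ m, π (m + β) = π m + r) (b : ℕ → K) (k : ℕ)
    (m : Fin n → ℤ) :
    iterCoef α c β d b k m = e ^ k * d m * iterDn low l r b k (π m) := by
  have h5 : ∀ (k : ℕ) (m : Fin n → ℤ), π (m + k • α) = π m - k * l := by
    intro k
    induction k with
    | zero => simp
    | succ k ih =>
      intro m
      rw [succ_nsmul, ← add_assoc, h3, ih]; push_cast; ring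
  induction k generalizing m with
  | zero => simp [iterCoef, iterDn]
  | succ k ih =>
    have e1 : c (m + (β + k • α)) = e * low (π m + r - k * l) := by
      rw [h2, ← add_assoc, h5, h4]
    rw [iterCoef, iterDn, ih, ih, e1, h1, h3, h2]
    ring

end vector
end scalar

namespace Osc

variable {K : Type*} [Field K] (P : Osc K)

theorem node_ok (i : Fin (P.n + 1)) : (P.node i).Ok P.q := by
  unfold node
  split_ifs
  · exact Or.inr P.left_isEnd
  · exact Or.inr P.right_isEnd
  · exact Or.inl rfl

theorem node_isEnd {i : Fin (P.n + 1)} (h : i.val = 0 ∨ i.val = P.n) :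
    (P.node i).IsEnd P.q := by
  unfold node
  split_ifs with h1 h2
  · exact P.left_isEnd
  · exact P.right_isEnd
  · omega

theorem node_mid {i : Fin (P.n + 1)} (h0 : i.val ≠ 0) (h : i.val ≠ P.n) : P.node i = .mid := by
  simp [node, h0, h]

theorem cartan_adj {i j : Fin (P.n + 1)} (h : i.val + 1 = j.val ∨ j.val + 1 = i.val) :
    P.cartan i j = (P.node i).adj (P.node j) := by
  have hij : i ≠ j := by rintro rfl; omega
  have hlen : ∀ A : Node K, A.IsEnd P.q → A.len ≠ 2 := by
    intro A hA; cases A <;> simp [Node.IsEnd, Node.len] at hA ⊢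
  have key : (P.n = 1 ∧ (P.node i).len = (P.node j).len) ↔
      ((P.node i).len = (P.node j).len ∧ (P.node i).len ≠ 2) := by
    constructor
    · rintro ⟨h1, h2⟩
      exact ⟨h2, hlen _ (P.node_isEnd (by omega))⟩
    · rintro ⟨h1, h2⟩
      refine ⟨?_, h1⟩
      by_contra h3
      have := P.one_le
      have h4 : ∀ k : Fin (P.n + 1), (P.node k).len ≠ 2 → k.val = 0 ∨ k.val = P.n := by
        intro k hk
        by_contra hc
        push Not at hc
        rw [P.node_mid hc.1 hc.2] at hk
        exact hk rfl
      have := h4 i h2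
      have := h4 j (h1 ▸ h2)
      omega
  simp only [cartan, hij, h, if_false, if_true, Node.adj, key]

theorem cartan_far {i j : Fin (P.n + 1)} (hij : i ≠ j)
    (h : ¬ (i.val + 1 = j.val ∨ j.val + 1 = i.val)) : P.cartan i j = 0 := by
  simp [cartan, hij, h]

/-- The Cartan matrix and the scalars `q_i` of the algebra attached to `P`. -/
def datum : Datum (Fin (P.n + 1)) K where
  a := P.cartan
  q i := (P.node i).qv P.q
  q_ne i := (P.node_ok i).qv_ne P.q_ne
  q_pow i := (P.node_ok i).qv_pow P.q_pow
  diag i := by simp [cartan]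
  offdiag i j h := by
    unfold cartan
    rw [if_neg h]
    split_ifs
    · norm_num
    · have := le_max_right (((P.node j).len / (P.node i).len : ℕ) : ℤ) 1
      linarith
    · exact le_rfl
  symm i j := by
    by_cases hij : i = j
    · rw [hij]
    by_cases h : i.val + 1 = j.val ∨ j.val + 1 = i.val
    · rw [P.cartan_adj h, P.cartan_adj h.symm]
      exact Node.adj_symm (P.node_ok i) (P.node_ok j)
    · rw [P.cartan_far hij h, P.cartan_far (Ne.symm hij) (fun h' => h h'.symm)]
      simp

variable {P}

theorem occ_add {m : Fin P.n → ℤ} {j : Fin (P.n + 1)} {t : ℕ} (ht : t < P.n) :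
    occ (m + P.shift j) t = occ m t + (if t = j.val then (P.node j).step else 0) -
      (if t + 1 = j.val then (P.node j).step else 0) := by
  simp only [occ, ht, dif_pos, Pi.add_apply, shift, add_sub_assoc]

theorem occ_neg {m : Fin P.n → ℤ} {j : Fin (P.n + 1)} {t : ℕ} (ht : t < P.n) :
    occ (m + -P.shift j) t = occ m t - (if t = j.val then (P.node j).step else 0) +
      (if t + 1 = j.val then (P.node j).step else 0) := by
  simp only [occ, ht, dif_pos, Pi.add_apply, Pi.neg_apply, shift]
  ring

theorem val_lt {i : Fin (P.n + 1)} (h : i.val ≠ P.n) : i.val < P.n := by omega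

theorem kval_mid_add (v k : ℤ) :
    Node.kval P.q .mid (v + k) = P.q ^ k * Node.kval P.q .mid v := by
  simp only [Node.kval, zpow_add₀ P.q_ne, mul_comm]

theorem kCoef_ne (i : Fin (P.n + 1)) (m : Fin P.n → ℤ) : P.kCoef i m ≠ 0 := by
  have h := fun v => (P.node_ok i).kval_ne P.q_ne v
  unfold kCoef
  split_ifs <;> simp [h]

theorem kCoef_add (i j : Fin (P.n + 1)) (m : Fin P.n → ℤ) :
    P.kCoef i (m + P.shift j) = P.datum.q i ^ P.datum.a i j * P.kCoef i m := by
  have h1 := P.one_le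
  have hk := fun v => (P.node_ok i).kval_ne P.q_ne v
  have hqi := (P.node_ok i).qv_ne P.q_ne
  change _ = (P.node i).qv P.q ^ P.cartan i j * _
  by_cases hij : i = j
  · subst hij
    have ha : P.cartan i i = 2 := by simp [cartan]
    rw [ha]
    by_cases h0 : i.val = 0
    · have hn : i.val ≠ P.n := by omega
      have := Node.kval_add_step P.q_ne (P.node_isEnd (Or.inl h0)) (occ m i.val)
      simp only [kCoef, if_pos h0, if_neg hn, mul_one, occ_add (val_lt hn), if_true]
      rw [if_neg (by omega), sub_zero, this]
    · by_cases hn : i.val = P.n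
      · have := Node.kval_add_step P.q_ne (P.node_isEnd (Or.inr hn))
          (occ m (i.val - 1) - (P.node i).step)
        simp only [kCoef, if_neg h0, if_pos hn, one_mul, occ_add (show i.val - 1 < P.n by omega)]
        rw [if_neg (by omega), if_pos (by omega), add_zero]
        rw [sub_add_cancel] at this
        rw [this, mul_inv, ← mul_assoc, mul_inv_cancel₀ (zpow_ne_zero _ hqi), one_mul]
      · have hm := P.node_mid h0 hn
        simp only [kCoef, if_neg h0, if_neg hn, occ_add (val_lt hn),
          occ_add (show i.val - 1 < P.n by omega), hm, if_true]
        rw [if_neg (by omega), if_neg (by omega), if_pos (by omega), sub_zero, add_zero,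
          sub_eq_add_neg, kval_mid_add, kval_mid_add]
        simp only [Node.step, Node.qv, mul_inv, zpow_neg, inv_inv, zpow_ofNat]
        ring
  by_cases h : i.val + 1 = j.val ∨ j.val + 1 = i.val
  · rw [P.cartan_adj h]
    have ks := fun v => Node.kval_sub P.q_ne (P.node_ok i) (P.node_ok j) v
    rcases h with h | h
    · have hn : i.val ≠ P.n := by omega
      by_cases h0 : i.val = 0
      · simp only [kCoef, if_pos h0, if_neg hn, mul_one, occ_add (val_lt hn), if_pos h]
        rw [if_neg (by omega), add_zero, ks]
      · simp only [kCoef, if_neg h0, if_neg hn, occ_add (val_lt hn),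
          occ_add (show i.val - 1 < P.n by omega), if_pos h]
        rw [if_neg (by omega), if_neg (by omega), if_neg (by omega), add_zero, add_zero, sub_zero,
          ks, mul_assoc]
    · have h0 : i.val ≠ 0 := by omega
      have ks' : ∀ v, ((P.node i).kval P.q (v + (P.node j).step))⁻¹ =
          (P.node i).qv P.q ^ (P.node i).adj (P.node j) * ((P.node i).kval P.q v)⁻¹ := by
        intro v
        have := ks (v + (P.node j).step)
        rw [add_sub_cancel_right] at this
        rw [this, mul_inv, ← mul_assoc, mul_inv_cancel₀ (zpow_ne_zero _ hqi), one_mul]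
      by_cases hn : i.val = P.n
      · simp only [kCoef, if_neg h0, if_pos hn, one_mul, occ_add (show i.val - 1 < P.n by omega)]
        rw [if_pos (by omega), if_neg (by omega), sub_zero, ks']
      · simp only [kCoef, if_neg h0, if_neg hn, occ_add (val_lt hn),
          occ_add (show i.val - 1 < P.n by omega)]
        rw [if_neg (by omega), if_neg (by omega), if_pos (by omega), if_neg (by omega), add_zero,
          sub_zero, sub_zero, ks', mul_left_comm]
  · rw [P.cartan_far hij h, zpow_zero, one_mul]
    have hij' : i.val ≠ j.val := fun h => hij (Fin.ext h)
    by_cases h0 : i.val = 0 <;> by_cases hn : i.val = P.n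
    · omega
    · simp only [kCoef, if_pos h0, if_neg hn, occ_add (val_lt hn)]
      rw [if_neg (by omega), if_neg (by omega), add_zero, sub_zero]
    · simp only [kCoef, if_neg h0, if_pos hn, occ_add (show i.val - 1 < P.n by omega)]
      rw [if_neg (by omega), if_neg (by omega), add_zero, sub_zero]
    · simp only [kCoef, if_neg h0, if_neg hn, occ_add (val_lt hn),
        occ_add (show i.val - 1 < P.n by omega)]
      rw [if_neg (by omega), if_neg (by omega), if_neg (by omega), if_neg (by omega), add_zero,
        sub_zero, add_zero, sub_zero]

theorem kCoef_neg (i j : Fin (P.n + 1)) (m : Fin P.n → ℤ) :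
    P.kCoef i (m + -P.shift j) = P.datum.q i ^ (-P.datum.a i j) * P.kCoef i m := by
  have := kCoef_add i j (m + -P.shift j)
  rw [neg_add_cancel_right] at this
  rw [this, ← mul_assoc, ← zpow_add₀ (P.datum.q_ne i)]
  simp

theorem eCoef_add {x : K} {i j : Fin (P.n + 1)} (h1 : i ≠ j) (h2 : j.val + 1 ≠ i.val)
    (m : Fin P.n → ℤ) : P.eCoef x i (m + P.shift j) = P.eCoef x i m := by
  have h1' : i.val ≠ j.val := fun h => h1 (Fin.ext h)
  unfold eCoef
  split_ifs with h0
  · rfl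
  · rw [occ_add (by omega), if_neg (by omega), if_neg (by omega), add_zero, sub_zero]

theorem eCoef_neg {x : K} {i j : Fin (P.n + 1)} (h1 : i ≠ j) (h2 : j.val + 1 ≠ i.val)
    (m : Fin P.n → ℤ) : P.eCoef x i (m + -P.shift j) = P.eCoef x i m := by
  have := eCoef_add (x := x) h1 h2 (m + -P.shift j)
  rw [neg_add_cancel_right] at this
  exact this.symm

theorem fCoef_add {x : K} {i j : Fin (P.n + 1)} (h1 : i ≠ j) (h2 : i.val + 1 ≠ j.val)
    (m : Fin P.n → ℤ) : P.fCoef x i (m + P.shift j) = P.fCoef x i m := by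
  have h1' : i.val ≠ j.val := fun h => h1 (Fin.ext h)
  unfold fCoef
  congr 1
  split_ifs with h0
  · rfl
  · rw [occ_add (by omega), if_neg (by omega), if_neg (by omega), add_zero, sub_zero]

theorem fCoef_neg {x : K} {i j : Fin (P.n + 1)} (h1 : i ≠ j) (h2 : i.val + 1 ≠ j.val)
    (m : Fin P.n → ℤ) : P.fCoef x i (m + -P.shift j) = P.fCoef x i m := by
  have := fCoef_add (x := x) h1 h2 (m + -P.shift j)
  rw [neg_add_cancel_right] at this
  exact this.symm

/-- The index set `S` is closed under the generators, up to vanishing coefficients. -/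
def Closed (P : Osc K) (x : K) (S : Set (Fin P.n → ℤ)) : Prop :=
  (∀ i, ∀ m ∈ S, m + P.shift i ∉ S → P.eCoef x i m = 0) ∧
    ∀ i, ∀ m ∈ S, m + -P.shift i ∉ S → P.fCoef x i m = 0

theorem serre_aux {S : Set (Fin P.n → ℤ)} {i j : Fin (P.n + 1)} {α β : Fin P.n → ℤ}
    {c d : (Fin P.n → ℤ) → K} (hc : ∀ m ∈ S, m + α ∉ S → c m = 0)
    (hd : ∀ m ∈ S, m + β ∉ S → d m = 0)
    (h : ∀ m, iterCoef α c β d (fun t => P.datum.q i ^ (P.datum.a i j + 2 * t))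
      (1 - P.datum.a i j).toNat m = 0) (hij : i ≠ j) :
    serreSum (P.datum.q i) (1 - P.datum.a i j).toNat (ketOp S α c) (ketOp S β d) = 0 := by
  have ha := P.datum.offdiag i j hij
  obtain ⟨r, hr⟩ : ∃ r : ℕ, (1 - P.datum.a i j).toNat = r := ⟨_, rfl⟩
  have ha' : (1 - r : ℤ) = P.datum.a i j := by omega
  rw [hr] at h ⊢
  rw [serreSum_eq_iter (P.datum.q_ne i) (P.datum.q_pow i), ha', (iter_ketOp hc hd _ r).1,
    ketOp_ext _ (fun m _ => h m), ketOp_zero, smul_zero]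

theorem relations {x : K} (hx : x ≠ 0) {S : Set (Fin P.n → ℤ)} (hS : P.Closed x S) :
    P.datum.Relations (fun i => ketOp S (P.shift i) (P.eCoef x i))
      (fun i => ketOp S (-P.shift i) (P.fCoef x i)) (fun i => ketOp S 0 (P.kCoef i))
      (fun i => ketOp S 0 fun m => (P.kCoef i m)⁻¹) := by
  have h0 : ∀ (c : (Fin P.n → ℤ) → K), ∀ m ∈ S, m + 0 ∉ S → c m = 0 := by
    intro c m hm hm'
    rw [add_zero] at hm'
    exact absurd hm hm'
  have hE := hS.1
  have hF := hS.2
  have h1 := P.one_le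
  constructor
  · intro i
    rw [ketOp_mul (h0 _), ← ketOp_one, add_zero]
    exact ketOp_ext _ fun m _ => by rw [add_zero, inv_mul_cancel₀ (kCoef_ne i m)]
  · intro i
    rw [ketOp_mul (h0 _), ← ketOp_one, add_zero]
    exact ketOp_ext _ fun m _ => by rw [add_zero, mul_inv_cancel₀ (kCoef_ne i m)]
  · intro i j
    rw [ketOp_mul (h0 _), ketOp_mul (h0 _)]
    exact ketOp_ext _ fun m _ => by simp [mul_comm]
  · intro i j
    rw [mul_assoc, ketOp_mul (h0 _), ketOp_mul, ketOp_smul]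
    · simp only [zero_add, add_zero]
      refine ketOp_ext _ fun m _ => ?_
      rw [kCoef_add]
      have := kCoef_ne i m
      field_simp
    · intro m hm hm'
      rw [zero_add] at hm'
      simp [hE j m hm hm']
  · intro i j
    rw [mul_assoc, ketOp_mul (h0 _), ketOp_mul, ketOp_smul]
    · simp only [zero_add, add_zero]
      refine ketOp_ext _ fun m _ => ?_
      rw [kCoef_neg]
      have := kCoef_ne i m
      field_simp
    · intro m hm hm'
      rw [zero_add] at hm'
      simp [hF j m hm hm']
  · intro i j
    rw [ketOp_mul (hF j), ketOp_mul (hE i), add_comm (-P.shift j), ketOp_sub]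
    split_ifs with hij
    · subst hij
      rw [add_neg_cancel, ketOp_sub, ketOp_smul]
      refine ketOp_ext _ fun m _ => ?_
      change _ = ((P.node i).qv P.q - ((P.node i).qv P.q)⁻¹)⁻¹ * _
      by_cases i0 : i.val = 0
      · have hn : i.val ≠ P.n := by omega
        have := Node.e_f_end P.q_ne P.q_pow (P.node_isEnd (Or.inl i0)) (occ m i.val)
        simp only [eCoef, fCoef, kCoef, if_pos i0, if_neg hn, mul_one, occ_add (val_lt hn), if_true]
        rw [if_neg (by omega), sub_zero, ← this]
        field_simp
      · by_cases hn : i.val = P.n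
        · have := Node.e_f_end P.q_ne P.q_pow (P.node_isEnd (Or.inr hn)) (occ m (i.val - 1))
          simp only [eCoef, fCoef, kCoef, if_neg i0, if_pos hn, mul_one, one_mul, inv_inv,
            occ_neg (show i.val - 1 < P.n by omega)]
          rw [if_neg (by omega), if_pos (by omega), sub_zero]
          linear_combination -this
        · have hm := P.node_mid i0 hn
          have hu := zpow_ne_zero (occ m (i.val - 1)) P.q_ne
          have hv := zpow_ne_zero (occ m i.val) P.q_ne
          have hq := P.q_ne
          have h6 := qsub_ne P.q_ne P.q_pow
          simp only [eCoef, fCoef, kCoef, if_neg i0, if_neg hn, mul_one,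
            occ_neg (show i.val - 1 < P.n by omega), occ_add (val_lt hn), hm]
          rw [if_neg (by omega), if_pos (by omega), if_true, if_neg (by omega), sub_zero,
            sub_zero]
          simp only [Node.low, Node.kval, Node.step, Node.qv, Node.qInt_shift0, zpow_add₀ P.q_ne,
            zpow_one, mul_inv, inv_inv]
          have h7 : (P.q - P.q⁻¹)⁻¹ = (P.q ^ 2 - 1)⁻¹ * P.q := by
            rw [show P.q ^ 2 - 1 = (P.q - P.q⁻¹) * P.q by field_simp, mul_inv, mul_assoc,
              inv_mul_cancel₀ hq, mul_one]
          have h8 : P.q ^ 2 - 1 ≠ 0 := sub_ne_zero.2 (P.q_pow 2 (by norm_num))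
          rw [h7]
          generalize P.q ^ occ m (i.val - 1) = U at hu ⊢
          generalize P.q ^ occ m i.val = V at hv ⊢
          field_simp
          ring
    · rw [← ketOp_zero (P.shift i + -P.shift j)]
      refine ketOp_ext _ fun m _ => ?_
      have hji : j ≠ i := Ne.symm hij
      by_cases hb : j.val + 1 = i.val
      · have hn : j.val ≠ P.n := by omega
        have i0 : i.val ≠ 0 := by omega
        have hb' : i.val - 1 = j.val := by omega
        have := Node.low_comm (q := P.q) (A := P.node j) (B := P.node i) (occ m j.val)
        simp only [eCoef, fCoef, if_neg hn, if_neg i0, hb', occ_neg (val_lt hn),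
          occ_add (val_lt hn)]
        simp only [if_true, if_neg (show ¬ j.val + 1 = j.val by omega),
          if_neg (show ¬ j.val = i.val by omega), if_pos hb, add_zero]
        linear_combination (if j.val = 0 then x⁻¹ else 1) * this
      · rw [eCoef_neg hij hb, fCoef_add hji hb]
        ring
  · intro i j hij
    have hji : j ≠ i := Ne.symm hij
    refine serre_aux (hE i) (hE j) (fun m => ?_) hij
    by_cases ha : i.val + 1 = j.val
    · have j0 : j.val ≠ 0 := by omega
      have hb' : j.val - 1 = i.val := by omega
      rw [iterCoef_up (e := 1) (low := (P.node j).low P.q) (π := fun m => occ m i.val)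
        (r := (P.node i).step) (eCoef_add hij (by omega))
        (fun m => by simp [eCoef, j0, hb'])
        (fun m => by
          rw [occ_add (by omega), if_pos rfl, if_neg (by omega), sub_zero])]
      change _ * iterUp _ _ (fun t => (P.node i).qv P.q ^ (P.cartan i j + 2 * (t : ℤ)))
        (1 - P.cartan i j).toNat _ = 0
      rw [P.cartan_adj (Or.inl ha), Node.iterUp_eq_zero P.q_ne (P.node_ok i) (P.node_ok j),
        mul_zero]
    · by_cases hb : j.val + 1 = i.val
      · have i0 : i.val ≠ 0 := by omega
        have hb' : i.val - 1 = j.val := by omega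
        rw [iterCoef_dn (e := 1) (low := (P.node i).low P.q) (π := fun m => occ m j.val)
          (l := (P.node i).step) (r := (P.node j).step) (eCoef_add hji (by omega))
          (fun m => by simp [eCoef, i0, hb'])
          (fun m => by rw [occ_add (by omega), if_neg (by omega), if_pos hb, add_zero])
          (fun m => by rw [occ_add (by omega), if_pos rfl, if_neg (by omega), sub_zero])]
        change _ * iterDn _ _ _ (fun t => (P.node i).qv P.q ^ (P.cartan i j + 2 * (t : ℤ)))
          (1 - P.cartan i j).toNat _ = 0
        rw [P.cartan_adj (Or.inr hb), Node.iterDn_eq_zero P.q_ne (P.node_ok i) (P.node_ok j),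
          mul_zero]
      · have ha0 : P.datum.a i j = 0 := P.cartan_far hij (by tauto)
        rw [ha0]
        change P.eCoef x j m * P.eCoef x i (m + (P.shift j + 0 • P.shift i)) -
          P.datum.q i ^ (0 + 2 * ((0 : ℕ) : ℤ)) *
            (P.eCoef x i m * P.eCoef x j (m + P.shift i)) = 0
        rw [zero_smul, add_zero, eCoef_add hij hb, eCoef_add hji ha]
        simp
        ring
  · intro i j hij
    have hji : j ≠ i := Ne.symm hij
    refine serre_aux (hF i) (hF j) (fun m => ?_) hij
    by_cases hb : j.val + 1 = i.val
    · have jn : j.val ≠ P.n := by omega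
      rw [iterCoef_up (e := if j.val = 0 then x⁻¹ else 1) (low := (P.node j).low P.q)
        (π := fun m => occ m j.val) (r := (P.node i).step) (fCoef_neg hij (by omega))
        (fun m => by rw [fCoef, if_neg jn, mul_comm])
        (fun m => by
          rw [occ_neg (by omega), if_neg (by omega), if_pos hb, sub_zero])]
      change _ * iterUp _ _ (fun t => (P.node i).qv P.q ^ (P.cartan i j + 2 * (t : ℤ)))
        (1 - P.cartan i j).toNat _ = 0
      rw [P.cartan_adj (Or.inr hb), Node.iterUp_eq_zero P.q_ne (P.node_ok i) (P.node_ok j),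
        mul_zero]
    · by_cases ha : i.val + 1 = j.val
      · have hn : i.val ≠ P.n := by omega
        rw [iterCoef_dn (e := if i.val = 0 then x⁻¹ else 1) (low := (P.node i).low P.q)
          (π := fun m => occ m i.val) (l := (P.node i).step) (r := (P.node j).step)
          (fCoef_neg hji (by omega))
          (fun m => by rw [fCoef, if_neg hn, mul_comm])
          (fun m => by rw [occ_neg (by omega), if_pos rfl, if_neg (by omega), add_zero])
          (fun m => by rw [occ_neg (by omega), if_neg (by omega), if_pos ha, sub_zero])]
        change _ * iterDn _ _ _ (fun t => (P.node i).qv P.q ^ (P.cartan i j + 2 * (t : ℤ)))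
          (1 - P.cartan i j).toNat _ = 0
        rw [P.cartan_adj (Or.inl ha), Node.iterDn_eq_zero P.q_ne (P.node_ok i) (P.node_ok j),
          mul_zero]
      · have ha0 : P.datum.a i j = 0 := P.cartan_far hij (by tauto)
        rw [ha0]
        change P.fCoef x j m * P.fCoef x i (m + (-P.shift j + 0 • -P.shift i)) -
          P.datum.q i ^ (0 + 2 * ((0 : ℕ) : ℤ)) *
            (P.fCoef x i m * P.fCoef x j (m + -P.shift i)) = 0
        rw [zero_smul, add_zero, fCoef_neg hij ha, fCoef_neg hji hb]
        simp
        ring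

/-- The `q`-oscillator representation with spectral parameter `x` on the space with basis `|m⟩`,
`m ∈ S`: `e_i`, `f_i` and `k_i` send `|m⟩` to `eCoef |m + shift i⟩`, `fCoef |m - shift i⟩` and
`kCoef |m⟩`. -/
noncomputable def rep {x : K} (hx : x ≠ 0) {S : Set (Fin P.n → ℤ)} (hS : P.Closed x S) :
    Uq P.datum →ₐ[K] Module.End K (S →₀ K) :=
  Uq.lift (relations hx hS)

/-- The index set `(ℤ_{≥ 0})^n`. -/
def nonneg (n : ℕ) : Set (Fin n → ℤ) := {m | ∀ j, 0 ≤ m j}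

/-- The set of the `m ∈ (ℤ_{≥ 0})^n` with `(-1)^{|m|} = ε`. -/
def parity (n : ℕ) (ε : ℤˣ) : Set (Fin n → ℤ) :=
  {m | (∀ j, 0 ≤ m j) ∧ (∑ j, m j).negOnePow = ε}

theorem low_eq_zero {A : Node K} {q : K} {v : ℤ} (h0 : 0 ≤ v) (h1 : v < A.step) :
    A.low q v = 0 := by
  have e : qInt q 0 = 0 := by simp [qInt]
  rcases A with _ | ⟨s, I⟩ | _ <;> simp only [Node.step] at h1 <;> simp only [Node.low]
  · rw [show v = 0 by omega, e]
  · rw [show v = 0 by omega, e, mul_zero]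
  · obtain rfl | rfl : v = 0 ∨ v = 1 := by omega
    · rw [e]; simp
    · rw [sub_self, e]; simp

theorem step_nonneg {K : Type*} (A : Node K) : 0 ≤ A.step := by
  cases A <;> simp [Node.step]

theorem eCoef_nonneg {x : K} {i : Fin (P.n + 1)} {m : Fin P.n → ℤ} (hm : ∀ j, 0 ≤ m j)
    (h : ¬ ∀ j, 0 ≤ (m + P.shift i) j) : P.eCoef x i m = 0 := by
  push Not at h
  obtain ⟨j, hj⟩ := h
  have hj0 := hm j
  have hs := step_nonneg (P.node i)
  simp only [Pi.add_apply, shift] at hj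
  have hji : j.val + 1 = i.val := by
    by_contra hc
    rw [if_neg hc] at hj
    split_ifs at hj <;> omega
  rw [if_neg (by omega), if_pos hji] at hj
  have hi : i.val ≠ 0 := by omega
  have ho : occ m (i.val - 1) = m j := by
    have : i.val - 1 = j.val := by omega
    simp [occ, this]
  rw [eCoef, if_neg hi, ho]
  exact low_eq_zero hj0 (by omega)

theorem fCoef_nonneg {x : K} {i : Fin (P.n + 1)} {m : Fin P.n → ℤ} (hm : ∀ j, 0 ≤ m j)
    (h : ¬ ∀ j, 0 ≤ (m + -P.shift i) j) : P.fCoef x i m = 0 := by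
  push Not at h
  obtain ⟨j, hj⟩ := h
  have hj0 := hm j
  have hs := step_nonneg (P.node i)
  simp only [Pi.add_apply, Pi.neg_apply, shift] at hj
  have hji : j.val = i.val := by
    by_contra hc
    rw [if_neg hc] at hj
    split_ifs at hj <;> omega
  rw [if_pos hji, if_neg (by omega)] at hj
  have hi : i.val ≠ P.n := by omega
  have ho : occ m i.val = m j := by simp [occ, ← hji]
  rw [fCoef, if_neg hi, ho, low_eq_zero hj0 (by omega), zero_mul]

theorem closed_nonneg (P : Osc K) (x : K) : P.Closed x (nonneg P.n) :=
  ⟨fun _ _ hm h => eCoef_nonneg hm h, fun _ _ hm h => fCoef_nonneg hm h⟩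

theorem even_shift (hl : P.left = .long) (hr : P.right = .long) (i : Fin (P.n + 1)) :
    Even (∑ j, P.shift i j) := by
  have h1 := P.one_le
  have e1 : ∑ j : Fin P.n, (if j.val = i.val then (P.node i).step else 0) =
      if i.val < P.n then (P.node i).step else 0 := by
    rw [Fin.sum_univ_eq_sum_range (fun t => if t = i.val then (P.node i).step else 0)]
    simp
  have e2 : ∑ j : Fin P.n, (if j.val + 1 = i.val then (P.node i).step else 0) =
      if 0 < i.val then (P.node i).step else 0 := by
    rw [Fin.sum_univ_eq_sum_range (fun t => if t + 1 = i.val then (P.node i).step else 0)]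
    by_cases hi : 0 < i.val
    · have : ∀ t, t + 1 = i.val ↔ t = i.val - 1 := by omega
      simp only [this, Finset.sum_ite_eq', Finset.mem_range, if_pos hi]
      rw [if_pos (by omega)]
    · rw [if_neg hi]
      exact Finset.sum_eq_zero fun t _ => if_neg (by omega)
  simp only [shift, Finset.sum_sub_distrib, e1, e2]
  by_cases hi : i.val = 0
  · rw [if_pos (by omega), if_neg (by omega)]
    simp [node, hi, hl, Node.step]
  · by_cases hn : i.val = P.n
    · rw [if_neg (by omega), if_pos (by omega)]
      have : P.node i = .long := by rw [node, if_neg hi, if_pos hn, hr]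
      simp [this, Node.step]
    · rw [if_pos (by omega), if_pos (by omega)]
      simp

theorem closed_parity (hl : P.left = .long) (hr : P.right = .long) (x : K) (ε : ℤˣ) :
    P.Closed x (parity P.n ε) := by
  refine ⟨fun i m hm h => eCoef_nonneg hm.1 fun h' => h ⟨h', ?_⟩,
    fun i m hm h => fCoef_nonneg hm.1 fun h' => h ⟨h', ?_⟩⟩
  · simp only [Pi.add_apply, Finset.sum_add_distrib, Int.negOnePow_add, hm.2,
      Int.negOnePow_even _ (even_shift hl hr i), mul_one]
  · simp only [Pi.add_apply, Pi.neg_apply, Finset.sum_add_distrib, Finset.sum_neg_distrib,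
      Int.negOnePow_add, hm.2, Int.negOnePow_neg, Int.negOnePow_even _ (even_shift hl hr i),
      mul_one]

/-- The data for `D^{(2)}_{n+1}`, with `s = q^{1/2}` and `I` a square root of `-1`. -/
abbrev typeD (n : ℕ) (hn : 1 ≤ n) (s I : K) (hs : s ≠ 0) (hs' : ∀ m : ℕ, 0 < m → s ^ m ≠ 1)
    (hI : I ^ 2 = -1) : Osc K where
  n := n
  q := s ^ 2
  left := .short s I
  right := .short s I
  one_le := hn
  q_ne := pow_ne_zero 2 hs
  q_pow m hm := by rw [← pow_mul]; exact hs' _ (by omega)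
  left_isEnd := ⟨rfl, hI⟩
  right_isEnd := ⟨rfl, hI⟩

/-- The data for `A^{(2)}_{2n}`, with `s = q^{1/2}` and `I` a square root of `-1`. -/
abbrev typeA (n : ℕ) (hn : 1 ≤ n) (s I : K) (hs : s ≠ 0) (hs' : ∀ m : ℕ, 0 < m → s ^ m ≠ 1)
    (hI : I ^ 2 = -1) : Osc K where
  n := n
  q := s ^ 2
  left := .short s I
  right := .long
  one_le := hn
  q_ne := pow_ne_zero 2 hs
  q_pow m hm := by rw [← pow_mul]; exact hs' _ (by omega)
  left_isEnd := ⟨rfl, hI⟩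
  right_isEnd := trivial

/-- The data for `C^{(1)}_n`. -/
abbrev typeC (n : ℕ) (hn : 1 ≤ n) (q : K) (hq : q ≠ 0) (hq' : ∀ m : ℕ, 0 < m → q ^ m ≠ 1) :
    Osc K where
  n := n
  q := q
  left := .long
  right := .long
  one_le := hn
  q_ne := hq
  q_pow := hq'
  left_isEnd := trivial
  right_isEnd := trivial

/-- The representation `V_x` of `U_q(D^{(2)}_{n+1})`. -/
noncomputable def repD (n : ℕ) (hn : 1 ≤ n) (s I : K) (hs : s ≠ 0)
    (hs' : ∀ m : ℕ, 0 < m → s ^ m ≠ 1) (hI : I ^ 2 = -1) (x : K) (hx : x ≠ 0) :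
    Uq (typeD n hn s I hs hs' hI).datum →ₐ[K] Module.End K (nonneg n →₀ K) :=
  rep hx (closed_nonneg (typeD n hn s I hs hs' hI) x)

/-- The representation `V_x` of `U_q(A^{(2)}_{2n})`. -/
noncomputable def repA (n : ℕ) (hn : 1 ≤ n) (s I : K) (hs : s ≠ 0)
    (hs' : ∀ m : ℕ, 0 < m → s ^ m ≠ 1) (hI : I ^ 2 = -1) (x : K) (hx : x ≠ 0) :
    Uq (typeA n hn s I hs hs' hI).datum →ₐ[K] Module.End K (nonneg n →₀ K) :=
  rep hx (closed_nonneg (typeA n hn s I hs hs' hI) x)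

/-- The representation `V_x^ε` of `U_q(C^{(1)}_n)`. -/
noncomputable def repC (n : ℕ) (hn : 1 ≤ n) (q : K) (hq : q ≠ 0)
    (hq' : ∀ m : ℕ, 0 < m → q ^ m ≠ 1) (ε : ℤˣ) (x : K) (hx : x ≠ 0) :
    Uq (typeC n hn q hq hq').datum →ₐ[K] Module.End K (parity n ε →₀ K) :=
  rep hx (closed_parity (P := typeC n hn q hq hq') rfl rfl x ε)

end Osc

end oscillator

end QOsc

/-! Let N be a nonzero submodule of the tensor product. Call vacuum the basis vector without
particles; in type C it has at most one particle in each factor, at the first site, as the two signs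
dictate. The proof shows that N contains the vacuum and obtains the rest by duality, so that it is
never necessary to show that the vacuum generates the module.

The vacuum. Weights are graded by a height for which f_0, …, f_{n-1} are lowering, and c is a
nonzero weight vector of N of minimal height (`IsSub.exists_isLowest`). Then f_0, …, f_{n-1} kill c.
Each of these equations relates only two coefficients of c at a time, so particles can be traded
between the two tensor factors until an occupation number would become negative. For a short vertex
0 this empties every site but the first (`IsSingular.site_eq_zero_of_short`). For a long one, f_0
moves particles in pairs, and the only vectors that reach the second site live on the two ways of
placing one particle at each of the first two sites in different factors
(`IsSingular.eq_of_weight_one`).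

Further equations come from a product of powers of the e_j which carries particles from a site to
the last one, where e_n removes them (`IsSub.exists_lowering`). It lowers the height as well, so it
kills c. On the first site, f_0 and this operator give, for each fixed total number of particles, a
linear system whose determinant is a nonzero multiple of x + q^l y, x^2 + q^(2l-1) y^2 or x - q^(2l)
y in types D, A and C. The hypotheses exclude exactly the zeros that matter. The one-particle weight
in type A and the exceptional vector in type C are ruled out by first applying raising operators and
then the lowering product, the height dropping in total.

Duality. For a diagonal pairing with nonzero norms, e_i is adjoint to a multiple of k_i f_i with x
and y replaced by their inverses (`exists_pairing_opE`). Hence the complement of N is a submodule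
for the inverse parameters. If it were nonzero it would contain the vacuum by the same argument; but
the vacuum lies in N and has nonzero norm. So the complement vanishes, and since weight spaces are
finite-dimensional N is everything (`IsSub.single_mem_of_orth_eq_bot`, `isIrreducible_of_vacuum`).
-/

namespace QOsc

/-! ### The tensor product inside the functions on pairs of integer vectors -/

section shiftOp

variable {K ι : Type*} [Field K] [AddGroup ι]

/-- The operator `|p⟩ ↦ w(p) |p + α⟩`. -/
noncomputable def shiftOp (α : ι) (w : ι → K) : (ι →₀ K) →ₗ[K] (ι →₀ K) :=
  Finsupp.linearCombination K fun p => Finsupp.single (p + α) (w p)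

theorem shiftOp_single (α : ι) (w : ι → K) (p : ι) :
    shiftOp α w (Finsupp.single p 1) = Finsupp.single (p + α) (w p) := by
  simp [shiftOp]

theorem shiftOp_apply (α : ι) (w : ι → K) (c : ι →₀ K) (p : ι) :
    shiftOp α w c p = w (p - α) * c (p - α) := by
  classical
  induction c using Finsupp.induction_linear with
  | zero => simp
  | add f g hf hg => simp [hf, hg, mul_add]
  | single a b =>
    rw [shiftOp, Finsupp.linearCombination_single, Finsupp.smul_apply, Finsupp.single_apply,
      Finsupp.single_apply, smul_eq_mul]
    by_cases h : a = p - α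
    · subst h; simp [mul_comm]
    · rw [if_neg h, if_neg (fun h' => h (eq_sub_of_add_eq h'))]; simp

end shiftOp

namespace Osc

variable {K : Type*} [Field K] (P : Osc K)

/-- Pairs of occupation vectors. -/
abbrev Pt : Type := (Fin P.n → ℤ) × (Fin P.n → ℤ)

/-- The action of `e_i` on the tensor product, extended to all integer occupation numbers. -/
noncomputable def opE (x y : K) (i : Fin (P.n + 1)) : (P.Pt →₀ K) →ₗ[K] (P.Pt →₀ K) :=
  shiftOp (0, P.shift i) (fun p => P.eCoef y i p.2) +
    shiftOp (P.shift i, 0) (fun p => P.eCoef x i p.1 * P.kCoef i p.2)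

/-- The action of `f_i` on the tensor product, extended to all integer occupation numbers. -/
noncomputable def opF (x y : K) (i : Fin (P.n + 1)) : (P.Pt →₀ K) →ₗ[K] (P.Pt →₀ K) :=
  shiftOp (-P.shift i, 0) (fun p => P.fCoef x i p.1) +
    shiftOp (0, -P.shift i) (fun p => (P.kCoef i p.1)⁻¹ * P.fCoef y i p.2)

/-- The action of `k_i` on the tensor product, extended to all integer occupation numbers. -/
noncomputable def opK (i : Fin (P.n + 1)) : (P.Pt →₀ K) →ₗ[K] (P.Pt →₀ K) :=
  shiftOp 0 (fun p => P.kCoef i p.1 * P.kCoef i p.2)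

/-- The action of `k_i⁻¹` on the tensor product, extended to all integer occupation numbers. -/
noncomputable def opKinv (i : Fin (P.n + 1)) : (P.Pt →₀ K) →ₗ[K] (P.Pt →₀ K) :=
  shiftOp 0 (fun p => (P.kCoef i p.1)⁻¹ * (P.kCoef i p.2)⁻¹)

variable {P}

theorem opE_apply (x y : K) (i : Fin (P.n + 1)) (c : P.Pt →₀ K) (m m' : Fin P.n → ℤ) :
    P.opE x y i c (m, m') = P.eCoef y i (m' - P.shift i) * c (m, m' - P.shift i) +
      P.eCoef x i (m - P.shift i) * P.kCoef i m' * c (m - P.shift i, m') := by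
  simp [opE, shiftOp_apply]

theorem opF_apply (x y : K) (i : Fin (P.n + 1)) (c : P.Pt →₀ K) (m m' : Fin P.n → ℤ) :
    P.opF x y i c (m, m') = P.fCoef x i (m + P.shift i) * c (m + P.shift i, m') +
      (P.kCoef i m)⁻¹ * P.fCoef y i (m' + P.shift i) * c (m, m' + P.shift i) := by
  simp [opF, shiftOp_apply]

theorem opK_apply (i : Fin (P.n + 1)) (c : P.Pt →₀ K) (p : P.Pt) :
    P.opK i c p = P.kCoef i p.1 * P.kCoef i p.2 * c p := by
  simp [opK, shiftOp_apply]

theorem opKinv_apply (i : Fin (P.n + 1)) (c : P.Pt →₀ K) (p : P.Pt) :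
    P.opKinv i c p = (P.kCoef i p.1)⁻¹ * (P.kCoef i p.2)⁻¹ * c p := by
  simp [opKinv, shiftOp_apply]

theorem opKinv_opK (i : Fin (P.n + 1)) (c : P.Pt →₀ K) : P.opKinv i (P.opK i c) = c := by
  ext p
  have h1 := kCoef_ne i p.1
  have h2 := kCoef_ne i p.2
  rw [opKinv_apply, opK_apply]
  field_simp

theorem opK_opKinv (i : Fin (P.n + 1)) (c : P.Pt →₀ K) : P.opK i (P.opKinv i c) = c := by
  ext p
  have h1 := kCoef_ne i p.1
  have h2 := kCoef_ne i p.2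
  rw [opK_apply, opKinv_apply]
  field_simp

/-- Invariant subspaces of the tensor product, viewed in the space of all finitely supported
functions of two occupation vectors. -/
structure IsSub (x y : K) (S T : Set (Fin P.n → ℤ)) (N : Submodule K (P.Pt →₀ K)) : Prop where
  supp : ∀ c ∈ N, ∀ p : P.Pt, c p ≠ 0 → p.1 ∈ S ∧ p.2 ∈ T
  e : ∀ c ∈ N, ∀ i, P.opE x y i c ∈ N
  f : ∀ c ∈ N, ∀ i, P.opF x y i c ∈ N
  k : ∀ c ∈ N, ∀ i, P.opK i c ∈ N
  kinv : ∀ c ∈ N, ∀ i, P.opKinv i c ∈ N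

/-- The inclusion of the tensor product into the space of functions of two occupation vectors. -/
noncomputable def incl (S T : Set (Fin P.n → ℤ)) :
    (S →₀ K) ⊗[K] (T →₀ K) →ₗ[K] (P.Pt →₀ K) :=
  (Finsupp.lmapDomain K K (Prod.map Subtype.val Subtype.val)) ∘ₗ
    (finsuppTensorFinsupp' K S T).toLinearMap

theorem incl_single {S T : Set (Fin P.n → ℤ)} (m : S) (m' : T) (a b : K) :
    incl S T (Finsupp.single m a ⊗ₜ[K] Finsupp.single m' b) =
      Finsupp.single (m.1, m'.1) (a * b) := by
  rw [incl, LinearMap.comp_apply, LinearEquiv.coe_coe, finsuppTensorFinsupp'_single_tmul_single,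
    Finsupp.lmapDomain_apply, Finsupp.mapDomain_single]
  rfl

theorem incl_injective (S T : Set (Fin P.n → ℤ)) : Function.Injective (incl (P := P) S T) := by
  have h : Function.Injective (Prod.map (Subtype.val : S → _) (Subtype.val : T → _)) :=
    Subtype.val_injective.prodMap Subtype.val_injective
  exact (Finsupp.mapDomain_injective h).comp (finsuppTensorFinsupp' K S T).injective

theorem incl_supp {S T : Set (Fin P.n → ℤ)} (w : (S →₀ K) ⊗[K] (T →₀ K)) (p : P.Pt)
    (hp : incl S T w p ≠ 0) : p.1 ∈ S ∧ p.2 ∈ T := by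
  by_contra h
  refine hp (Finsupp.mapDomain_of_notMem_range _ _ ?_)
  rintro ⟨⟨a, b⟩, rfl⟩
  exact h ⟨a.2, b.2⟩

theorem tensor_lin_ext {S T : Set (Fin P.n → ℤ)} {M : Type*} [AddCommGroup M] [Module K M]
    {f g : (S →₀ K) ⊗[K] (T →₀ K) →ₗ[K] M}
    (h : ∀ m m', f (Finsupp.single m 1 ⊗ₜ[K] Finsupp.single m' 1) =
      g (Finsupp.single m 1 ⊗ₜ[K] Finsupp.single m' 1)) : f = g := by
  refine TensorProduct.ext ?_
  refine Finsupp.lhom_ext' fun m => LinearMap.ext_ring ?_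
  refine Finsupp.lhom_ext' fun m' => LinearMap.ext_ring ?_
  exact h m m'

/-- By hypothesis a coefficient vanishes whenever its shift leaves the index set. Truncation
therefore never discards a nonzero term, and from here on the generators can be handled by formulas
valid at all integer points, without membership proofs. -/
theorem incl_map_ketOp {S T : Set (Fin P.n → ℤ)} {α β : Fin P.n → ℤ}
    {u v : (Fin P.n → ℤ) → K} (hu : ∀ m ∈ S, m + α ∉ S → u m = 0)
    (hv : ∀ m ∈ T, m + β ∉ T → v m = 0) (w : (S →₀ K) ⊗[K] (T →₀ K)) :
    incl S T (TensorProduct.map (ketOp S α u) (ketOp T β v) w) =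
      shiftOp (α, β) (fun p : P.Pt => u p.1 * v p.2) (incl S T w) := by
  refine LinearMap.congr_fun (f := incl S T ∘ₗ TensorProduct.map (ketOp S α u) (ketOp T β v))
    (g := shiftOp (α, β) (fun p : P.Pt => u p.1 * v p.2) ∘ₗ incl S T)
    (tensor_lin_ext fun m m' => ?_) w
  simp only [LinearMap.comp_apply, TensorProduct.map_tmul, incl_single, mul_one, shiftOp_single]
  by_cases h1 : m.1 + α ∈ S
  · by_cases h2 : m'.1 + β ∈ T
    · rw [ketOp_single _ _ _ h1, ketOp_single _ _ _ h2, incl_single]; rfl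
    · rw [ketOp_single' _ _ _ h2, hv _ m'.2 h2]; simp
  · rw [ketOp_single' _ _ _ h1, hu _ m.2 h1]; simp

/-! ### Irreducibility in terms of invariant spaces of functions -/

section transfer

variable {x y : K} {S T : Set (Fin P.n → ℤ)} (hx : x ≠ 0) (hy : y ≠ 0) (hS : P.Closed x S)
  (hT : P.Closed y T)

theorem incl_gen_e (i : Fin (P.n + 1)) (w : (S →₀ K) ⊗[K] (T →₀ K)) :
    incl S T (Uq.tensor (rep hx hS) (rep hy hT) (Uq.gen _ (.e i)) w) =
      P.opE x y i (incl S T w) := by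
  have h0 : ∀ (U : Set (Fin P.n → ℤ)) (c : (Fin P.n → ℤ) → K), ∀ m ∈ U, m + 0 ∉ U → c m = 0 :=
    fun U c m hm hm' => absurd hm (by rwa [add_zero] at hm')
  have e1 := incl_map_ketOp (P := P) (u := fun _ => 1) (h0 S _) (hT.1 i) w
  have e2 := incl_map_ketOp (P := P) (v := P.kCoef i) (hS.1 i) (h0 T _) w
  simp only [Uq.tensor, Uq.comul, AlgHom.comp_apply, Uq.lift_e, map_add,
    Algebra.TensorProduct.map_tmul, map_one, rep, Module.endTensorEndAlgHom_apply,
    TensorProduct.AlgebraTensorModule.map_eq,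
    LinearMap.add_apply, Uq.lift_k, ← ketOp_one]
  rw [e1, e2, opE]
  simp

theorem incl_gen_f (i : Fin (P.n + 1)) (w : (S →₀ K) ⊗[K] (T →₀ K)) :
    incl S T (Uq.tensor (rep hx hS) (rep hy hT) (Uq.gen _ (.f i)) w) =
      P.opF x y i (incl S T w) := by
  have h0 : ∀ (U : Set (Fin P.n → ℤ)) (c : (Fin P.n → ℤ) → K), ∀ m ∈ U, m + 0 ∉ U → c m = 0 :=
    fun U c m hm hm' => absurd hm (by rwa [add_zero] at hm')
  have e1 := incl_map_ketOp (P := P) (v := fun _ => 1) (hS.2 i) (h0 T _) w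
  have e2 := incl_map_ketOp (P := P) (u := fun m => (P.kCoef i m)⁻¹) (h0 S _) (hT.2 i) w
  simp only [Uq.tensor, Uq.comul, AlgHom.comp_apply, Uq.lift_f, map_add,
    Algebra.TensorProduct.map_tmul, map_one, rep, Module.endTensorEndAlgHom_apply,
    TensorProduct.AlgebraTensorModule.map_eq,
    LinearMap.add_apply, Uq.lift_kinv, ← ketOp_one]
  rw [e1, e2, opF]
  simp

theorem incl_gen_k (i : Fin (P.n + 1)) (w : (S →₀ K) ⊗[K] (T →₀ K)) :
    incl S T (Uq.tensor (rep hx hS) (rep hy hT) (Uq.gen _ (.k i)) w) =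
      P.opK i (incl S T w) := by
  have h0 : ∀ (U : Set (Fin P.n → ℤ)) (c : (Fin P.n → ℤ) → K), ∀ m ∈ U, m + 0 ∉ U → c m = 0 :=
    fun U c m hm hm' => absurd hm (by rwa [add_zero] at hm')
  have e1 := incl_map_ketOp (P := P) (u := P.kCoef i) (v := P.kCoef i) (h0 S _) (h0 T _) w
  simp only [Uq.tensor, Uq.comul, AlgHom.comp_apply, Algebra.TensorProduct.map_tmul, rep,
    Module.endTensorEndAlgHom_apply, TensorProduct.AlgebraTensorModule.map_eq, Uq.lift_k]
  rw [e1, opK]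
  rfl

theorem incl_gen_kinv (i : Fin (P.n + 1)) (w : (S →₀ K) ⊗[K] (T →₀ K)) :
    incl S T (Uq.tensor (rep hx hS) (rep hy hT) (Uq.gen _ (.kinv i)) w) =
      P.opKinv i (incl S T w) := by
  have h0 : ∀ (U : Set (Fin P.n → ℤ)) (c : (Fin P.n → ℤ) → K), ∀ m ∈ U, m + 0 ∉ U → c m = 0 :=
    fun U c m hm hm' => absurd hm (by rwa [add_zero] at hm')
  have e1 := incl_map_ketOp (P := P) (u := fun m => (P.kCoef i m)⁻¹)
    (v := fun m => (P.kCoef i m)⁻¹) (h0 S _) (h0 T _) w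
  simp only [Uq.tensor, Uq.comul, AlgHom.comp_apply, Algebra.TensorProduct.map_tmul, rep,
    Module.endTensorEndAlgHom_apply, TensorProduct.AlgebraTensorModule.map_eq, Uq.lift_kinv]
  rw [e1, opKinv]
  rfl

theorem isSub_map (N : Subrepresentation (A := K) (W := (S →₀ K) ⊗[K] (T →₀ K))
    (Uq.tensor (rep hx hS) (rep hy hT) :
      Uq P.datum →* Module.End K ((S →₀ K) ⊗[K] (T →₀ K)))) :
    IsSub x y S T (N.toSubmodule.map (incl S T)) where
  supp := by rintro _ ⟨w, _, rfl⟩ p hp; exact incl_supp w p hp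
  e := by
    rintro _ ⟨w, hw, rfl⟩ i
    exact ⟨_, N.apply_mem_toSubmodule (Uq.gen _ (.e i)) hw, incl_gen_e hx hy hS hT i w⟩
  f := by
    rintro _ ⟨w, hw, rfl⟩ i
    exact ⟨_, N.apply_mem_toSubmodule (Uq.gen _ (.f i)) hw, incl_gen_f hx hy hS hT i w⟩
  k := by
    rintro _ ⟨w, hw, rfl⟩ i
    exact ⟨_, N.apply_mem_toSubmodule (Uq.gen _ (.k i)) hw, incl_gen_k hx hy hS hT i w⟩
  kinv := by
    rintro _ ⟨w, hw, rfl⟩ i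
    exact ⟨_, N.apply_mem_toSubmodule (Uq.gen _ (.kinv i)) hw, incl_gen_kinv hx hy hS hT i w⟩

/-- A subrepresentation is carried by the injection `incl` to an invariant space of functions, and
pure tensors of basis vectors span. The point `v₀` only serves to make the tensor product nonzero.
-/
theorem isIrreducible_of_forall_isSub {v₀ : P.Pt} (h₁ : v₀.1 ∈ S) (h₂ : v₀.2 ∈ T)
    (h : ∀ N : Submodule K (P.Pt →₀ K), IsSub x y S T N → N ≠ ⊥ →
      ∀ m ∈ S, ∀ m' ∈ T, Finsupp.single (m, m') 1 ∈ N) :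
    Uq.IsIrreducible (Uq.tensor (rep hx hS) (rep hy hT)) := by
  have hinj := incl_injective (P := P) (K := K) S T
  have htop : ∀ N : Subrepresentation (A := K) (W := (S →₀ K) ⊗[K] (T →₀ K))
      (Uq.tensor (rep hx hS) (rep hy hT) : Uq P.datum →* Module.End K _),
      N ≠ ⊥ → N = ⊤ := by
    intro N hN
    have hN' : N.toSubmodule.map (incl S T) ≠ ⊥ := by
      intro h0
      refine hN (Subrepresentation.toSubmodule_injective ?_)
      exact Submodule.map_injective_of_injective hinj (h0.trans (Submodule.map_bot _).symm)
    have h' := h _ (isSub_map hx hy hS hT N) hN'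
    have hs : ∀ (m : S) (m' : T), Finsupp.single m 1 ⊗ₜ[K] Finsupp.single m' 1 ∈
        N.toSubmodule := by
      intro m m'
      obtain ⟨w, hw, hw'⟩ := h' m.1 m.2 m'.1 m'.2
      have : w = Finsupp.single m 1 ⊗ₜ[K] Finsupp.single m' 1 :=
        hinj (by rw [hw', incl_single, one_mul])
      rwa [← this]
    refine Subrepresentation.toSubmodule_injective ?_
    generalize N.toSubmodule = M at hs
    change M = ⊤
    refine Submodule.eq_top_iff'.2 fun w => ?_
    induction w with
    | zero => exact M.zero_mem
    | add a b ha hb => exact M.add_mem ha hb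
    | tmul a b =>
      induction a using Finsupp.induction_linear with
      | zero => rw [TensorProduct.zero_tmul]; exact M.zero_mem
      | add f g hf hg => rw [TensorProduct.add_tmul]; exact M.add_mem hf hg
      | single m r =>
        induction b using Finsupp.induction_linear with
        | zero => rw [TensorProduct.tmul_zero]; exact M.zero_mem
        | add f g hf hg => rw [TensorProduct.tmul_add]; exact M.add_mem hf hg
        | single m' r' =>
          have := M.smul_mem (r * r') (hs m m')
          rwa [← TensorProduct.smul_tmul_smul, Finsupp.smul_single_one,
            Finsupp.smul_single_one] at this
  have hnt : Nontrivial ((S →₀ K) ⊗[K] (T →₀ K)) :=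
    ⟨Finsupp.single ⟨_, h₁⟩ 1 ⊗ₜ[K] Finsupp.single ⟨_, h₂⟩ 1, 0, fun h0 => by
      have := congrArg (incl (P := P) S T) h0
      rw [incl_single, map_zero] at this
      simp at this⟩
  exact {
    exists_pair_ne := ⟨⊥, ⊤, fun h0 => bot_ne_top (α := Submodule K ((S →₀ K) ⊗[K] (T →₀ K)))
      (congrArg Subrepresentation.toSubmodule h0)⟩
    eq_bot_or_eq_top := fun N => or_iff_not_imp_left.2 (htop N) }

end transfer

end Osc

/-! ### Powers of a scalar that is not a root of unity -/

theorem zpow_inj_of_not_root {K : Type*} [Field K] {q : K} (hq : q ≠ 0)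
    (hq1 : ∀ m : ℕ, 0 < m → q ^ m ≠ 1) {a b : ℤ} (h : q ^ a = q ^ b) : a = b := by
  have key : ∀ a b : ℤ, a < b → q ^ a ≠ q ^ b := by
    intro a b hab h
    apply hq1 (b - a).toNat (by omega)
    rw [← zpow_natCast, Int.toNat_of_nonneg (by omega), zpow_sub₀ hq, h,
      div_self (zpow_ne_zero b hq)]
  rcases lt_trichotomy a b with h' | h' | h'
  · exact absurd h (key _ _ h')
  · exact h'
  · exact absurd h.symm (key _ _ h')

theorem qInt_ne_zero {K : Type*} [Field K] {q : K} (hq : q ≠ 0)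
    (hq1 : ∀ m : ℕ, 0 < m → q ^ m ≠ 1) {m : ℤ} (hm : m ≠ 0) : qInt q m ≠ 0 := by
  refine div_ne_zero (fun h => hm ?_) (qsub_ne hq hq1)
  have := zpow_inj_of_not_root hq hq1 (sub_eq_zero.1 h)
  omega

/-! ### Projections to joint eigenspaces -/

section projection

variable {K ι : Type*} [Field K] {N : Submodule K (ι →₀ K)}

-- Lagrange interpolation: only finitely many eigenvalues occur on the support of `c`, so on `c` the
-- projection to one eigenspace is a polynomial in the diagonal operator.
open Classical in
theorem filter_eigen_mem {l : ι → K}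
    (h : ∀ c ∈ N, ∃ d ∈ N, ∀ p, d p = l p * c p) {c : ι →₀ K} (hc : c ∈ N) (t : K) :
    c.filter (fun p => l p = t) ∈ N := by
  have key : ∀ A : Finset K, ∃ d ∈ N, ∀ p, d p = (∏ s ∈ A, (l p - s)) * c p := by
    intro A
    induction A using Finset.induction_on with
    | empty => exact ⟨c, hc, by simp⟩
    | insert s A hs ih =>
      obtain ⟨d, hd, hd'⟩ := ih
      obtain ⟨d', h1, h2⟩ := h d hd
      refine ⟨d' - s • d, N.sub_mem h1 (N.smul_mem s hd), fun p => ?_⟩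
      rw [Finset.prod_insert hs, Finsupp.sub_apply, Finsupp.smul_apply, h2, hd', smul_eq_mul]
      ring
  -- This product kills every eigenvalue on the support except `t`, where it takes the nonzero value
  -- divided out below.
  obtain ⟨d, hd, hd'⟩ := key ((c.support.image l).erase t)
  have hne : ∏ s ∈ (c.support.image l).erase t, (t - s) ≠ 0 :=
    Finset.prod_ne_zero_iff.2 fun s hs => sub_ne_zero.2 (Finset.ne_of_mem_erase hs).symm
  convert N.smul_mem (∏ s ∈ (c.support.image l).erase t, (t - s))⁻¹ hd using 1
  ext p
  rw [Finsupp.smul_apply, hd', smul_eq_mul, Finsupp.filter_apply]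
  split_ifs with hp
  · rw [hp, ← mul_assoc, inv_mul_cancel₀ hne, one_mul]
  · by_cases hcp : c p = 0
    · simp [hcp]
    · have hz : ∏ s ∈ (c.support.image l).erase t, (l p - s) = 0 :=
        Finset.prod_eq_zero (Finset.mem_erase.2
          ⟨hp, Finset.mem_image_of_mem _ (Finsupp.mem_support_iff.2 hcp)⟩) (sub_self _)
      rw [hz, zero_mul, mul_zero]

open Classical in
theorem filter_joint_eigen_mem {J : Type*} {l : J → ι → K}
    (h : ∀ j, ∀ c ∈ N, ∃ d ∈ N, ∀ p, d p = l j p * c p) {c : ι →₀ K} (hc : c ∈ N) (t : J → K)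
    (A : Finset J) : c.filter (fun p => ∀ j ∈ A, l j p = t j) ∈ N := by
  induction A using Finset.induction_on with
  | empty =>
    convert hc using 1
    ext p
    simp
  | insert j A hj ih =>
    convert filter_eigen_mem (h j) ih (t j) using 1
    ext p
    simp only [Finsupp.filter_apply, Finset.forall_mem_insert, ite_and]

end projection

/-- Extensionality on the whole basis would not suffice later: the adjointness formulas hold only at
points of the support of `c`, where occupation numbers are nonnegative. -/
theorem eq_of_eq_on_single {K ι M : Type*} [Field K] [AddCommGroup M] [Module K M]
    {f g : (ι →₀ K) →ₗ[K] M} {c : ι →₀ K}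
    (h : ∀ p, c p ≠ 0 → f (Finsupp.single p 1) = g (Finsupp.single p 1)) : f c = g c := by
  rw [← Finsupp.sum_single c, Finsupp.sum, map_sum, map_sum]
  refine Finset.sum_congr rfl fun p hp => ?_
  rw [← Finsupp.smul_single_one, map_smul, map_smul, h p (Finsupp.mem_support_iff.1 hp)]

/-! ### Norms for one oscillator -/

/-- The squared length of the `v`-th basis vector of one oscillator. -/
noncomputable def siteNorm {K : Type*} [Field K] (q : K) (v : ℤ) : K :=
  ∏ k ∈ Finset.range v.toNat, (qInt q ((k : ℤ) + 1) * q ^ ((k : ℤ) + 1))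

section siteNorm

variable {K : Type*} [Field K] {q : K}

theorem siteNorm_ne (hq : q ≠ 0) (hq1 : ∀ m : ℕ, 0 < m → q ^ m ≠ 1) (v : ℤ) :
    siteNorm q v ≠ 0 :=
  Finset.prod_ne_zero_iff.2 fun k _ => mul_ne_zero (qInt_ne hq hq1 k) (zpow_ne_zero _ hq)

theorem siteNorm_add_one {v : ℤ} (hv : 0 ≤ v) :
    siteNorm q (v + 1) = siteNorm q v * (qInt q (v + 1) * q ^ (v + 1)) := by
  obtain ⟨k, rfl⟩ := Int.eq_ofNat_of_zero_le hv
  have h1 : ((k : ℤ) + 1).toNat = k + 1 := by omega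
  have h2 : ((k : ℤ)).toNat = k := by omega
  rw [siteNorm, siteNorm, h1, h2, Finset.prod_range_succ]

theorem qInt_one (hq : q ≠ 0) (hq1 : ∀ m : ℕ, 0 < m → q ^ m ≠ 1) : qInt q 1 = 1 := by
  have := qsub_ne hq hq1
  rw [qInt, zpow_one, zpow_neg_one, div_self this]

namespace Node

theorem kappa_ne (hq1 : ∀ m : ℕ, 0 < m → q ^ m ≠ 1) : (q + 1) / (q - 1) ≠ 0 := by
  refine div_ne_zero (fun h => hq1 2 (by norm_num) ?_) (fun h => hq1 1 (by norm_num) ?_)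
  · linear_combination (q - 1) * h
  · linear_combination h

theorem kval_mul_kval (hq : q ≠ 0) (A : Node K) (v v' : ℤ) :
    A.kval q v * A.kval q v' = A.kval q 0 * A.kval q (v + v') := by
  cases A <;> simp only [kval, zpow_add₀ hq, zpow_zero, mul_add, zpow_one, mul_zero] <;> ring

theorem Ok.kval_injective (hq : q ≠ 0) (hq1 : ∀ m : ℕ, 0 < m → q ^ m ≠ 1) {A : Node K}
    (hA : A.Ok q) {v v' : ℤ} (h : A.kval q v = A.kval q v') : v = v' := by
  rcases A with _ | ⟨s, I⟩ | _
  · exact zpow_inj_of_not_root hq hq1 h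
  · have := hA.kval_ne hq 0
    simp only [kval, zpow_zero, mul_one] at h this
    exact zpow_inj_of_not_root hq hq1 (mul_left_cancel₀ this h)
  · have := zpow_inj_of_not_root hq hq1 (neg_injective h)
    omega

/-- Adjointness at the vertex 0, where `e_0` raises and `f_0` lowers. The powers of `q` in the norm
account for the eigenvalue of `k_0`, so that the partner of `e_0` is `k_0 f_0` and not `f_0`. -/
theorem IsEnd.exists_siteNorm_add (hq : q ≠ 0) (hq1 : ∀ m : ℕ, 0 < m → q ^ m ≠ 1) {A : Node K}
    (hA : A.IsEnd q) : ∃ t : K, t ≠ 0 ∧ ∀ v : ℤ, 0 ≤ v →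
      siteNorm q (v + A.step) = t * (siteNorm q v * A.kval q v * A.low q (v + A.step)) := by
  have h2 : qInt q 2 ≠ 0 := qInt_ne_zero hq hq1 (by norm_num)
  rcases A with _ | ⟨s, I⟩ | _
  · exact hA.elim
  · obtain ⟨hs, hI⟩ := hA
    have hk := kappa_ne hq1
    have hs0 : s ≠ 0 := by rintro rfl; exact hq (by rw [← hs]; simp)
    refine ⟨q / (s * ((q + 1) / (q - 1))), by positivity, fun v hv => ?_⟩
    simp only [step, kval, low, siteNorm_add_one hv, zpow_add_one₀ hq]
    generalize (q + 1) / (q - 1) = k at *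
    field_simp
    linear_combination (siteNorm q v * qInt q (v + 1)) * hI
  · refine ⟨-(q ^ 2 * qInt q 2 ^ 2), neg_ne_zero.2 (by positivity), fun v hv => ?_⟩
    have e1 : v + 2 = v + 1 + 1 := by ring
    have e2 : v + 1 + 1 - 1 = v + 1 := by ring
    simp only [step, kval, low, e1, e2, siteNorm_add_one (show 0 ≤ v + 1 by omega),
      siteNorm_add_one hv, zpow_add_one₀ hq, two_mul, zpow_add₀ hq]
    field_simp

/-- Adjointness at the vertex `n`. Here `e_n` lowers and `f_n` raises, and `k_n` acts by the inverse
eigenvalue, so both sides change roles. -/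
theorem IsEnd.exists_siteNorm_sub (hq : q ≠ 0) (hq1 : ∀ m : ℕ, 0 < m → q ^ m ≠ 1) {A : Node K}
    (hA : A.IsEnd q) : ∃ t : K, t ≠ 0 ∧ ∀ v : ℤ, 0 ≤ v →
      siteNorm q v * A.low q (v + A.step) =
        t * (siteNorm q (v + A.step) * (A.kval q (v + A.step))⁻¹) := by
  have h2 : qInt q 2 ≠ 0 := qInt_ne_zero hq hq1 (by norm_num)
  rcases A with _ | ⟨s, I⟩ | _
  · exact hA.elim
  · obtain ⟨hs, hI⟩ := hA
    have hk := kappa_ne hq1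
    have hs0 : s ≠ 0 := by rintro rfl; exact hq (by rw [← hs]; simp)
    have hI0 : I ≠ 0 := by rintro rfl; simp at hI
    refine ⟨s * ((q + 1) / (q - 1)), by positivity, fun v hv => ?_⟩
    simp only [step, kval, low, siteNorm_add_one hv, zpow_add_one₀ hq]
    generalize (q + 1) / (q - 1) = k at *
    have := zpow_ne_zero v hq
    field_simp
    linear_combination (siteNorm q v * qInt q (v + 1)) * hI
  · refine ⟨-(q ^ 2 / qInt q 2 ^ 2), neg_ne_zero.2 (by positivity), fun v hv => ?_⟩
    have e1 : v + 2 = v + 1 + 1 := by ring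
    have e2 : v + 1 + 1 - 1 = v + 1 := by ring
    have := zpow_ne_zero v hq
    simp only [step, kval, low, e1, e2, siteNorm_add_one (show 0 ≤ v + 1 by omega),
      siteNorm_add_one hv, zpow_add_one₀ hq, two_mul, zpow_add₀ hq]
    field_simp

end Node

end siteNorm

/-! ### Weights of the tensor product -/

namespace Osc

variable {K : Type*} [Field K] {P : Osc K}

theorem occ_add' {n : ℕ} (m m' : Fin n → ℤ) (t : ℕ) : occ (m + m') t = occ m t + occ m' t := by
  unfold occ; split_ifs <;> simp

theorem occ_zero {n : ℕ} (t : ℕ) : occ (0 : Fin n → ℤ) t = 0 := by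
  unfold occ; split_ifs <;> simp

theorem occ_val {n : ℕ} (m : Fin n → ℤ) (j : Fin n) : occ m j.val = m j := by
  simp [occ]

theorem occ_ext {n : ℕ} {m m' : Fin n → ℤ} (h : ∀ t < n, occ m t = occ m' t) : m = m' :=
  funext fun j => by rw [← occ_val m, ← occ_val m', h _ j.2]

/-- Each eigenvalue is a constant times `q` to a power linear in the occupation numbers, so on a
tensor product it depends only on their total. -/
theorem kCoef_mul_kCoef (i : Fin (P.n + 1)) (m m' : Fin P.n → ℤ) :
    P.kCoef i m * P.kCoef i m' = P.kCoef i 0 * P.kCoef i (m + m') := by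
  have h := (P.node i).kval_mul_kval P.q_ne
  have h1 := h (occ m i.val) (occ m' i.val)
  have h2 := h (occ m (i.val - 1)) (occ m' (i.val - 1))
  simp only [kCoef, occ_add', occ_zero]
  split_ifs
  · simp
  · simp only [one_mul, ← mul_inv, h2]
  · simp only [mul_one, h1]
  · rw [mul_mul_mul_comm, mul_mul_mul_comm ((P.node i).kval P.q 0), h1, ← mul_inv, ← mul_inv, h2]

/-- The eigenvalue of `k_0` determines the first site, and each following `k_i` determines a site
from its predecessor. The last generator `k_n` is not needed. -/
theorem eq_of_kCoef_eq {m m' : Fin P.n → ℤ} (h : ∀ i, P.kCoef i m = P.kCoef i m') : m = m' := by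
  refine occ_ext fun t => ?_
  induction t with
  | zero =>
    intro ht
    have h0 := h ⟨0, by omega⟩
    simp only [kCoef, if_pos, if_neg (show (0 : ℕ) ≠ P.n by omega), mul_one] at h0
    exact (P.node_ok _).kval_injective P.q_ne P.q_pow h0
  | succ t ih =>
    intro ht
    have h0 := h ⟨t + 1, by omega⟩
    simp only [kCoef, if_neg (show t + 1 ≠ P.n by omega), if_neg (show t + 1 ≠ 0 by omega),
      Nat.add_sub_cancel, ih (by omega)] at h0
    exact (P.node_ok _).kval_injective P.q_ne P.q_pow
      (mul_right_cancel₀ (inv_ne_zero ((P.node_ok _).kval_ne P.q_ne _)) h0)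

open Classical in
theorem IsSub.filter_weight_mem {x y : K} {S T : Set (Fin P.n → ℤ)}
    {N : Submodule K (P.Pt →₀ K)} (hN : IsSub x y S T N) {c : P.Pt →₀ K} (hc : c ∈ N)
    (μ : Fin P.n → ℤ) : c.filter (fun p => p.1 + p.2 = μ) ∈ N := by
  convert filter_joint_eigen_mem (J := Fin (P.n + 1))
    (l := fun i p => P.kCoef i p.1 * P.kCoef i p.2)
    (fun i c hc => ⟨_, hN.k c hc i, fun p => opK_apply i c p⟩) hc
    (fun i => P.kCoef i 0 * P.kCoef i μ) Finset.univ using 2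
  funext p
  simp only [kCoef_mul_kCoef _ p.1 p.2, Finset.mem_univ, true_implies]
  refine propext ⟨fun h i => by rw [h], fun h => eq_of_kCoef_eq fun i => ?_⟩
  exact mul_left_cancel₀ (kCoef_ne i 0) (h i)

/-! ### The contravariant pairing -/

/-- The squared length of a basis vector. -/
noncomputable def normSq (P : Osc K) (m : Fin P.n → ℤ) : K := ∏ j, siteNorm P.q (m j)

theorem normSq_ne (m : Fin P.n → ℤ) : P.normSq m ≠ 0 :=
  Finset.prod_ne_zero_iff.2 fun _ _ => siteNorm_ne P.q_ne P.q_pow _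

theorem normSq_of_eq_off {m m' : Fin P.n → ℤ} (a : Fin P.n) (h : ∀ j, j ≠ a → m' j = m j) :
    P.normSq m' * siteNorm P.q (m a) = P.normSq m * siteNorm P.q (m' a) := by
  simp only [normSq]
  rw [← Finset.mul_prod_erase _ _ (Finset.mem_univ a),
    ← Finset.mul_prod_erase _ (fun j => siteNorm P.q (m j)) (Finset.mem_univ a),
    Finset.prod_congr rfl fun j hj => by rw [h j (Finset.ne_of_mem_erase hj)]]
  ring

/-- One-factor form of the adjunction between `e_i` at `x` and `t k_i f_i` at `x⁻¹`. That `t`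
depends neither on `x` nor on `m` is essential, since the same constant must serve both tensor
factors. -/
theorem exists_normSq_shift (i : Fin (P.n + 1)) : ∃ t : K, t ≠ 0 ∧ ∀ (x : K) (m : Fin P.n → ℤ),
    (∀ j, 0 ≤ m j) → (∀ j, 0 ≤ (m + P.shift i) j) →
    P.normSq (m + P.shift i) * P.eCoef x i m =
      t * (P.normSq m * P.kCoef i m * P.fCoef x⁻¹ i (m + P.shift i)) := by
  have h1 := P.one_le
  have hn := siteNorm_ne P.q_ne P.q_pow
  by_cases i0 : i.val = 0
  · obtain ⟨t, ht, h⟩ := (node_isEnd P (Or.inl i0)).exists_siteNorm_add P.q_ne P.q_pow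
    refine ⟨t, ht, fun x m hm hm' => ?_⟩
    have hin : i.val ≠ P.n := by omega
    let a : Fin P.n := ⟨0, by omega⟩
    have ha : (m + P.shift i) a = m a + (P.node i).step := by simp [shift, a, i0]
    have ho := normSq_of_eq_off (m := m) (m' := m + P.shift i) a (fun j hj => by
      have : j.val ≠ 0 := fun h => hj (Fin.ext h)
      simp [shift, i0, this])
    have o1 : occ m i.val = m a := by rw [i0]; exact occ_val m a
    have o2 : occ (m + P.shift i) i.val = m a + (P.node i).step := by
      rw [i0, ← ha]; exact occ_val _ a
    have h' := h (m a) (hm a)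
    rw [ha, h'] at ho
    simp only [eCoef, kCoef, fCoef, if_pos i0, if_neg hin, o1, o2, mul_one, inv_inv]
    have hh := hn (m a)
    apply mul_right_cancel₀ hh
    linear_combination x * ho
  · by_cases hin : i.val = P.n
    · obtain ⟨t, ht, h⟩ := (node_isEnd P (Or.inr hin)).exists_siteNorm_sub P.q_ne P.q_pow
      refine ⟨t, ht, fun x m hm hm' => ?_⟩
      let a : Fin P.n := ⟨P.n - 1, by omega⟩
      have ha : m a = (m + P.shift i) a + (P.node i).step := by
        have e1 : P.n - 1 ≠ P.n := by omega
        have e2 : P.n - 1 + 1 = P.n := by omega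
        simp [shift, a, hin, e1, e2]
      have ho := normSq_of_eq_off (m := m) (m' := m + P.shift i) a (fun j hj => by
        have e1 : j.val + 1 ≠ i.val := fun h => hj (Fin.ext (by simp [a]; omega))
        have e2 : j.val ≠ i.val := by omega
        simp [shift, e1, e2])
      have o1 : occ m (i.val - 1) = (m + P.shift i) a + (P.node i).step := by
        rw [← ha, hin]; exact occ_val m a
      have h' := h ((m + P.shift i) a) (hm' a)
      rw [← ha] at h' o1
      simp only [eCoef, kCoef, fCoef, if_pos hin, if_neg i0, o1, mul_one, one_mul]
      have hh := hn (m a)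
      apply mul_right_cancel₀ hh
      linear_combination (P.node i).low P.q (m a) * ho + P.normSq m * h'
    · refine ⟨P.q, P.q_ne, fun x m hm hm' => ?_⟩
      have hmid := P.node_mid i0 hin
      have hst : (P.node i).step = 1 := by rw [hmid]; rfl
      let a : Fin P.n := ⟨i.val - 1, by omega⟩
      let b : Fin P.n := ⟨i.val, by omega⟩
      -- An intermediate vector in which only the raised site has been changed, so that each of the
      -- two norm comparisons involves a single site.
      let m₁ : Fin P.n → ℤ := fun j => if j = a then m j else (m + P.shift i) j
      have e0 : i.val - 1 + 1 = i.val := by omega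
      have e1 : i.val - 1 ≠ i.val := by omega
      have hab : b ≠ a := fun h => by have := congrArg Fin.val h; simp [a, b] at this; omega
      have va : m a = (m + P.shift i) a + 1 := by simp [shift, a, hst, e0, e1]
      have vb : (m + P.shift i) b = m b + 1 := by simp [shift, b, hst]
      have ho1 := normSq_of_eq_off (m := m) (m' := m₁) b (fun j hj => by
        by_cases hja : j = a
        · simp [m₁, hja]
        · have e2 : j.val ≠ i.val := fun h => hj (Fin.ext h)
          have e3 : j.val + 1 ≠ i.val := fun h => hja (Fin.ext (by simp [a]; omega))
          simp [m₁, hja, shift, e2, e3])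
      have ho2 := normSq_of_eq_off (m := m₁) (m' := m + P.shift i) a (fun _ hj => by
        simp only [m₁, if_neg hj])
      have m1a : m₁ a = m a := if_pos rfl
      have m1b : m₁ b = m b + 1 := by rw [← vb]; exact if_neg hab
      rw [m1b, siteNorm_add_one (hm b)] at ho1
      have hva := siteNorm_add_one (q := P.q) (hm' a)
      rw [← va] at hva
      rw [m1a, hva] at ho2
      have o1 : occ m (i.val - 1) = m a := occ_val m a
      have o2 : occ m i.val = m b := occ_val m b
      have o3 : occ (m + P.shift i) i.val = m b + 1 := by rw [← vb]; exact occ_val _ b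
      simp only [eCoef, kCoef, fCoef, if_neg hin, if_neg i0, o1, o2, o3, mul_one, hmid,
        Node.low, Node.kval]
      have z1 := zpow_ne_zero (m a) P.q_ne
      have z2 := hn (m b)
      have z3 := hn ((m + P.shift i) a)
      rw [zpow_add_one₀ P.q_ne] at ho1
      have ho1' : P.normSq m₁ = P.normSq m * (qInt P.q (m b + 1) * (P.q ^ (m b) * P.q)) := by
        apply mul_right_cancel₀ z2
        linear_combination ho1
      have ho2' : P.normSq (m + P.shift i) * (qInt P.q (m a) * P.q ^ (m a)) = P.normSq m₁ := by
        apply mul_right_cancel₀ z3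
        linear_combination ho2
      rw [ho1'] at ho2'
      field_simp
      linear_combination ho2'

/-- The contravariant pairing with a function `d`. -/
noncomputable def pairing (d : P.Pt →₀ K) : (P.Pt →₀ K) →ₗ[K] K :=
  Finsupp.linearCombination K fun p => P.normSq p.1 * P.normSq p.2 * d p

theorem pairing_single (d : P.Pt →₀ K) (p : P.Pt) :
    pairing d (Finsupp.single p 1) = P.normSq p.1 * P.normSq p.2 * d p := by
  simp [pairing]

section adjoint

variable {S T : Set (Fin P.n → ℤ)} (hS : S ⊆ nonneg P.n) (hT : T ⊆ nonneg P.n)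

-- The coproduct of `k_i f_i` is `1 ⊗ k_i f_i + k_i f_i ⊗ k_i`, of the same shape as that of `e_i`,
-- and `k_i` is diagonal, hence self-adjoint. So the one-factor adjunction passes to the tensor
-- product with the same `t`. The second formula is the first one solved for the adjoint of `f_i`.
include hS hT in
theorem exists_pairing_opE (i : Fin (P.n + 1)) : ∃ t : K, t ≠ 0 ∧
    (∀ (x y : K) (c d : P.Pt →₀ K), (∀ p, c p ≠ 0 → p.1 ∈ S ∧ p.2 ∈ T) →
      (∀ p, d p ≠ 0 → p.1 ∈ S ∧ p.2 ∈ T) →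
      pairing d (P.opE x y i c) = t * pairing (P.opK i (P.opF x⁻¹ y⁻¹ i d)) c) ∧
    ∀ (x y : K) (c d : P.Pt →₀ K), (∀ p, c p ≠ 0 → p.1 ∈ S ∧ p.2 ∈ T) →
      (∀ p, d p ≠ 0 → p.1 ∈ S ∧ p.2 ∈ T) →
      t * pairing d (P.opF x y i c) = pairing (P.opE x⁻¹ y⁻¹ i (P.opKinv i d)) c := by
  obtain ⟨t, ht, h⟩ := exists_normSq_shift i
  refine ⟨t, ht, fun x y c d hc hd => ?_, fun x y c d hc hd => ?_⟩
  · refine eq_of_eq_on_single (f := pairing d ∘ₗ P.opE x y i)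
      (g := t • pairing (P.opK i (P.opF x⁻¹ y⁻¹ i d))) fun p hp => ?_
    obtain ⟨m, m'⟩ := p
    obtain ⟨s1, s2⟩ := hc _ hp
    rw [LinearMap.comp_apply, LinearMap.smul_apply, opE, LinearMap.add_apply, shiftOp_single,
      shiftOp_single, ← mul_one (P.eCoef y i _), ← mul_one (P.eCoef x i _ * _),
      ← smul_eq_mul _ (1 : K),
      ← smul_eq_mul _ (1 : K), ← Finsupp.smul_single, ← Finsupp.smul_single, map_add, map_smul,
      map_smul, pairing_single, pairing_single, pairing_single, opK_apply, opF_apply]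
    simp only [smul_eq_mul, Prod.mk_add_mk, add_zero]
    have k1 := kCoef_ne i m
    have e1 : P.normSq (m + P.shift i) * P.eCoef x i m * d (m + P.shift i, m') =
        t * (P.normSq m * P.kCoef i m * P.fCoef x⁻¹ i (m + P.shift i)) *
          d (m + P.shift i, m') := by
      by_cases hz : d (m + P.shift i, m') = 0
      · simp [hz]
      · rw [h x m (hS s1) (hS (hd _ hz).1)]
    have e2 : P.normSq (m' + P.shift i) * P.eCoef y i m' * d (m, m' + P.shift i) =
        t * (P.normSq m' * P.kCoef i m' * P.fCoef y⁻¹ i (m' + P.shift i)) *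
          d (m, m' + P.shift i) := by
      by_cases hz : d (m, m' + P.shift i) = 0
      · simp [hz]
      · rw [h y m' (hT s2) (hT (hd _ hz).2)]
    generalize x⁻¹ = x', y⁻¹ = y' at *
    field_simp
    linear_combination P.normSq m' * P.kCoef i m' * e1 + P.normSq m * e2
  · refine eq_of_eq_on_single (f := t • (pairing d ∘ₗ P.opF x y i))
      (g := pairing (P.opE x⁻¹ y⁻¹ i (P.opKinv i d))) fun p hp => ?_
    obtain ⟨m, m'⟩ := p
    obtain ⟨s1, s2⟩ := hc _ hp
    rw [LinearMap.smul_apply, LinearMap.comp_apply, opF, LinearMap.add_apply, shiftOp_single,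
      shiftOp_single, ← mul_one (P.fCoef x i _), ← mul_one (_ * P.fCoef y i _),
      ← smul_eq_mul _ (1 : K),
      ← smul_eq_mul _ (1 : K), ← Finsupp.smul_single, ← Finsupp.smul_single, map_add, map_smul,
      map_smul, pairing_single, pairing_single, pairing_single, opE_apply, opKinv_apply,
      opKinv_apply]
    simp only [smul_eq_mul, Prod.mk_add_mk, add_zero, ← sub_eq_add_neg]
    have k1 := kCoef_ne i m
    have k2 := kCoef_ne i m'
    have k3 := kCoef_ne i (m - P.shift i)
    have k4 := kCoef_ne i (m' - P.shift i)
    have e1 : P.normSq m * P.eCoef x⁻¹ i (m - P.shift i) * d (m - P.shift i, m') =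
        t * (P.normSq (m - P.shift i) * P.kCoef i (m - P.shift i) * P.fCoef x i m) *
          d (m - P.shift i, m') := by
      by_cases hz : d (m - P.shift i, m') = 0
      · simp [hz]
      · have := h x⁻¹ (m - P.shift i) (hS (hd _ hz).1) (by rw [sub_add_cancel]; exact hS s1)
        rw [sub_add_cancel, inv_inv] at this
        rw [this]
    have e2 : P.normSq m' * P.eCoef y⁻¹ i (m' - P.shift i) * d (m, m' - P.shift i) =
        t * (P.normSq (m' - P.shift i) * P.kCoef i (m' - P.shift i) * P.fCoef y i m') *
          d (m, m' - P.shift i) := by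
      by_cases hz : d (m, m' - P.shift i) = 0
      · simp [hz]
      · have := h y⁻¹ (m' - P.shift i) (hT (hd _ hz).2) (by rw [sub_add_cancel]; exact hT s2)
        rw [sub_add_cancel, inv_inv] at this
        rw [this]
    generalize x⁻¹ = x', y⁻¹ = y' at *
    field_simp
    linear_combination -P.normSq m' * P.kCoef i m * P.kCoef i (m' - P.shift i) * e1 -
      P.normSq m * P.kCoef i (m - P.shift i) * e2

end adjoint

end Osc

/-! ### Orthogonal complements of invariant subspaces -/

namespace Osc

variable {K : Type*} [Field K] {P : Osc K}

theorem pairing_add (d d' : P.Pt →₀ K) : pairing (d + d') = pairing d + pairing d' := by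
  refine LinearMap.ext fun c => eq_of_eq_on_single fun p _ => ?_
  simp only [LinearMap.add_apply, pairing_single, Finsupp.add_apply, mul_add]

theorem pairing_smul (a : K) (d : P.Pt →₀ K) : pairing (a • d) = a • pairing d := by
  refine LinearMap.ext fun c => eq_of_eq_on_single fun p _ => ?_
  simp only [LinearMap.smul_apply, pairing_single, Finsupp.smul_apply, smul_eq_mul]
  ring

theorem pairing_opK (i : Fin (P.n + 1)) (c d : P.Pt →₀ K) :
    pairing (P.opK i d) c = pairing d (P.opK i c) := by
  refine eq_of_eq_on_single (f := pairing (P.opK i d)) (g := pairing d ∘ₗ P.opK i) fun p _ => ?_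
  rw [LinearMap.comp_apply, opK, shiftOp_single, ← mul_one (_ * _), ← smul_eq_mul _ (1 : K),
    ← Finsupp.smul_single, map_smul, add_zero, pairing_single, pairing_single, ← opK, opK_apply,
    smul_eq_mul]
  ring

theorem pairing_opKinv (i : Fin (P.n + 1)) (c d : P.Pt →₀ K) :
    pairing (P.opKinv i d) c = pairing d (P.opKinv i c) := by
  conv_lhs => rw [← opK_opKinv i c]
  rw [← pairing_opK, opK_opKinv]

/-- The orthogonal complement of a subspace in the functions supported on `S × T`. -/
noncomputable def orth (S T : Set (Fin P.n → ℤ)) (N : Submodule K (P.Pt →₀ K)) :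
    Submodule K (P.Pt →₀ K) where
  carrier := {d | (∀ p, d p ≠ 0 → p.1 ∈ S ∧ p.2 ∈ T) ∧ ∀ c ∈ N, pairing d c = 0}
  zero_mem' := ⟨fun p hp => absurd rfl hp, fun c _ => by
    simpa using congrArg (fun f : (P.Pt →₀ K) →ₗ[K] K => f c) (pairing_smul (P := P) 0 0)⟩
  add_mem' := by
    rintro d d' ⟨h1, h2⟩ ⟨h1', h2'⟩
    refine ⟨fun p hp => ?_, fun c hc => ?_⟩
    · by_cases hd : d p = 0
      · refine h1' p fun h => hp ?_
        rw [Finsupp.add_apply, hd, h, add_zero]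
      · exact h1 p hd
    · rw [pairing_add, LinearMap.add_apply, h2 c hc, h2' c hc, add_zero]
  smul_mem' := by
    rintro a d ⟨h1, h2⟩
    refine ⟨fun p hp => h1 p fun h => hp ?_, fun c hc => ?_⟩
    · rw [Finsupp.smul_apply, h, smul_zero]
    · rw [pairing_smul, LinearMap.smul_apply, h2 c hc, smul_zero]

variable {S T : Set (Fin P.n → ℤ)}

theorem opE_supp {x y : K} (hS : P.Closed x S) (hT : P.Closed y T) (i : Fin (P.n + 1))
    {c : P.Pt →₀ K} (hc : ∀ p, c p ≠ 0 → p.1 ∈ S ∧ p.2 ∈ T) (p : P.Pt)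
    (hp : P.opE x y i c p ≠ 0) : p.1 ∈ S ∧ p.2 ∈ T := by
  obtain ⟨m, m'⟩ := p
  rw [opE_apply] at hp
  by_cases h1 : P.eCoef y i (m' - P.shift i) * c (m, m' - P.shift i) = 0
  · rw [h1, zero_add] at hp
    have h2 := right_ne_zero_of_mul hp
    have h3 := left_ne_zero_of_mul (left_ne_zero_of_mul hp)
    refine ⟨?_, (hc _ h2).2⟩
    by_contra h4
    exact h3 (hS.1 i _ (hc _ h2).1 (by rwa [sub_add_cancel]))
  · have h2 := right_ne_zero_of_mul h1
    refine ⟨(hc _ h2).1, ?_⟩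
    by_contra h4
    exact left_ne_zero_of_mul h1 (hT.1 i _ (hc _ h2).2 (by rwa [sub_add_cancel]))

theorem opF_supp {x y : K} (hS : P.Closed x S) (hT : P.Closed y T) (i : Fin (P.n + 1))
    {c : P.Pt →₀ K} (hc : ∀ p, c p ≠ 0 → p.1 ∈ S ∧ p.2 ∈ T) (p : P.Pt)
    (hp : P.opF x y i c p ≠ 0) : p.1 ∈ S ∧ p.2 ∈ T := by
  obtain ⟨m, m'⟩ := p
  rw [opF_apply] at hp
  by_cases h1 : P.fCoef x i (m + P.shift i) * c (m + P.shift i, m') = 0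
  · rw [h1, zero_add] at hp
    have h2 := right_ne_zero_of_mul hp
    refine ⟨(hc _ h2).1, ?_⟩
    by_contra h4
    exact right_ne_zero_of_mul (left_ne_zero_of_mul hp)
      (hT.2 i _ (hc _ h2).2 (by rwa [add_neg_cancel_right]))
  · have h2 := right_ne_zero_of_mul h1
    refine ⟨?_, (hc _ h2).2⟩
    by_contra h4
    exact left_ne_zero_of_mul h1 (hS.2 i _ (hc _ h2).1 (by rwa [add_neg_cancel_right]))

/-- The adjoint of a generator is a multiple of a product of generators at the inverse parameters,
so stability of `N` passes to its complement, with `x` and `y` inverted. -/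
theorem IsSub.orth {x y : K} (hS : ∀ x, P.Closed x S) (hT : ∀ x, P.Closed x T)
    (hSn : S ⊆ nonneg P.n) (hTn : T ⊆ nonneg P.n) {N : Submodule K (P.Pt →₀ K)}
    (hN : IsSub x y S T N) : IsSub x⁻¹ y⁻¹ S T (orth S T N) := by
  have hK : ∀ c ∈ Osc.orth S T N, ∀ i, P.opK i c ∈ Osc.orth S T N := by
    rintro d ⟨h1, h2⟩ i
    refine ⟨fun p hp => h1 p fun h => hp ?_, fun c hc => ?_⟩
    · rw [opK_apply, h, mul_zero]
    · rw [pairing_opK, h2 _ (hN.k c hc i)]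
  have hKi : ∀ c ∈ Osc.orth S T N, ∀ i, P.opKinv i c ∈ Osc.orth S T N := by
    rintro d ⟨h1, h2⟩ i
    refine ⟨fun p hp => h1 p fun h => hp ?_, fun c hc => ?_⟩
    · rw [opKinv_apply, h, mul_zero]
    · rw [pairing_opKinv, h2 _ (hN.kinv c hc i)]
  refine ⟨fun c hc => hc.1, fun d hd i => ⟨opE_supp (hS _) (hT _) i hd.1, fun c hc => ?_⟩,
    fun d hd i => ⟨opF_supp (hS _) (hT _) i hd.1, fun c hc => ?_⟩, hK, hKi⟩
  · obtain ⟨t, ht, -, h⟩ := exists_pairing_opE hSn hTn i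
    -- The adjoint of `f_i` is a multiple of `e_i k_i⁻¹`, so inserting `k_i d` leaves exactly `e_i
    -- d`. The next case cancels the `k_i` in the adjoint of `e_i` by inserting `k_i⁻¹ c`.
    have hd' := hK d hd i
    have := h x y c (P.opK i d) (hN.supp c hc) hd'.1
    rw [opKinv_opK, hd'.2 _ (hN.f c hc i), mul_zero] at this
    exact this.symm
  · obtain ⟨t, ht, h, -⟩ := exists_pairing_opE hSn hTn i
    have hc' := hN.kinv c hc i
    have := h x y (P.opKinv i c) d (hN.supp _ hc') hd.1
    rw [hd.2 _ (hN.e _ hc' i), pairing_opK, opK_opKinv] at this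
    exact (mul_eq_zero.1 this.symm).resolve_left ht

theorem finite_weight (hSn : S ⊆ nonneg P.n) (hTn : T ⊆ nonneg P.n) (μ : Fin P.n → ℤ) :
    {p : P.Pt | (p.1 ∈ S ∧ p.2 ∈ T) ∧ p.1 + p.2 = μ}.Finite := by
  refine ((Set.finite_Icc (0 : Fin P.n → ℤ) μ).prod (Set.finite_Icc (0 : Fin P.n → ℤ) μ)).subset ?_
  rintro ⟨m, m'⟩ ⟨⟨h1, h2⟩, rfl⟩
  have h1' : ∀ j, 0 ≤ m j := hSn h1
  have h2' : ∀ j, 0 ≤ m' j := hTn h2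
  refine ⟨⟨h1', fun j => ?_⟩, ⟨h2', fun j => ?_⟩⟩
  · have := h2' j
    simp only [Pi.add_apply]; omega
  · have := h1' j
    simp only [Pi.add_apply]; omega

-- A functional that kills `N` but not the given basis vector need not be a pairing with a finitely
-- supported function. Its restriction to one weight space is, because that space is
-- finite-dimensional; and since `N` contains the weight components of its elements, the restriction
-- still kills `N`.
open Classical in
theorem IsSub.single_mem_of_orth_eq_bot {x y : K} (hSn : S ⊆ nonneg P.n) (hTn : T ⊆ nonneg P.n)
    {N : Submodule K (P.Pt →₀ K)} (hN : IsSub x y S T N) (h : Osc.orth S T N = ⊥) {p : P.Pt}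
    (h1 : p.1 ∈ S) (h2 : p.2 ∈ T) : Finsupp.single p 1 ∈ N := by
  by_contra hp
  obtain ⟨φ, hφ, hφN⟩ := Submodule.exists_le_ker_of_notMem hp
  let Z := {r : P.Pt | (r.1 ∈ S ∧ r.2 ∈ T) ∧ r.1 + r.2 = p.1 + p.2}
  have hZ : Z.Finite := finite_weight hSn hTn _
  -- Division by the norms makes the pairing with `d` agree with `φ` on the weight space of `p`;
  -- outside that space `d` is zero.
  let d : P.Pt →₀ K := Finsupp.onFinset hZ.toFinset
    (fun r => if r ∈ Z then φ (Finsupp.single r 1) * (P.normSq r.1 * P.normSq r.2)⁻¹ else 0)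
    (fun r hr => by
      rw [Set.Finite.mem_toFinset]
      by_contra hc
      exact hr (if_neg hc))
  have hdZ : ∀ r, r ∈ Z →
      d r = φ (Finsupp.single r 1) * (P.normSq r.1 * P.normSq r.2)⁻¹ := fun r hr => if_pos hr
  have hdZ' : ∀ r, r ∉ Z → d r = 0 := fun r hr => if_neg hr
  have hd : d ∈ Osc.orth S T N := by
    refine ⟨fun r hr => ?_, fun c hc => ?_⟩
    · by_contra hc
      exact hr (hdZ' r fun h' => hc h'.1)
    · have hc' := hN.filter_weight_mem hc (p.1 + p.2)
      have h0 : φ (c.filter fun r => r.1 + r.2 = p.1 + p.2) = 0 := hφN hc'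
      rw [← h0]
      have e1 : pairing d c = pairing d (c.filter fun r => r.1 + r.2 = p.1 + p.2) := by
        rw [← sub_eq_zero, ← map_sub, ← LinearMap.zero_apply (σ₁₂ := RingHom.id K)
          (M₂ := K) (c - c.filter fun r => r.1 + r.2 = p.1 + p.2)]
        refine eq_of_eq_on_single fun r hr => ?_
        rw [pairing_single, LinearMap.zero_apply, hdZ', mul_zero]
        rintro ⟨-, h'⟩
        rw [Finsupp.sub_apply, Finsupp.filter_apply, if_pos h', sub_self] at hr
        exact hr rfl
      rw [e1]
      refine eq_of_eq_on_single fun r hr => ?_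
      rw [Finsupp.filter_apply] at hr
      have hr1 : r.1 + r.2 = p.1 + p.2 := by
        by_contra h'
        rw [if_neg h'] at hr
        exact hr rfl
      rw [if_pos hr1] at hr
      rw [pairing_single, hdZ r ⟨hN.supp c hc r hr, hr1⟩]
      have := normSq_ne (P := P) r.1
      have := normSq_ne (P := P) r.2
      field_simp
  rw [h, Submodule.mem_bot] at hd
  have := hdZ p ⟨⟨h1, h2⟩, rfl⟩
  rw [hd, Finsupp.zero_apply] at this
  exact mul_ne_zero hφ (inv_ne_zero (mul_ne_zero (normSq_ne p.1) (normSq_ne p.2))) this.symm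

/-- A nonzero `N` contains `v₀`, and so would a nonzero complement of `N`; but `v₀` is not
orthogonal to itself. This replaces any proof that `v₀` is cyclic. -/
theorem isIrreducible_of_vacuum {x y : K} (hx : x ≠ 0) (hy : y ≠ 0) (hS : ∀ x, P.Closed x S)
    (hT : ∀ x, P.Closed x T) (hSn : S ⊆ nonneg P.n) (hTn : T ⊆ nonneg P.n) {v₀ : P.Pt}
    (h₁ : v₀.1 ∈ S) (h₂ : v₀.2 ∈ T)
    (h : ∀ N : Submodule K (P.Pt →₀ K), IsSub x y S T N → N ≠ ⊥ → Finsupp.single v₀ 1 ∈ N)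
    (h' : ∀ N : Submodule K (P.Pt →₀ K), IsSub x⁻¹ y⁻¹ S T N → N ≠ ⊥ →
      Finsupp.single v₀ 1 ∈ N) :
    Uq.IsIrreducible (Uq.tensor (rep hx (hS x)) (rep hy (hT y))) := by
  refine isIrreducible_of_forall_isSub hx hy (hS x) (hT y) h₁ h₂ fun N hN hN0 m hm m' hm' => ?_
  refine hN.single_mem_of_orth_eq_bot hSn hTn ?_ hm hm'
  by_contra ho
  have h1 := (h' _ (hN.orth hS hT hSn hTn) ho).2 _ (h N hN hN0)
  rw [pairing_single, Finsupp.single_eq_same, mul_one] at h1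
  exact mul_ne_zero (normSq_ne v₀.1) (normSq_ne v₀.2) h1

/-! ### Vectors of lowest height -/

/-- A grading of weights by which `f_0, …, f_{n-1}` are lowering. -/
def height (μ : Fin P.n → ℤ) : ℤ := ∑ j, ((j.val : ℤ) + 1) * μ j

theorem height_add (μ ν : Fin P.n → ℤ) : height (μ + ν) = height (P := P) μ + height ν := by
  simp only [height, Pi.add_apply, mul_add, Finset.sum_add_distrib]

/-- `c` is a vector of weight `μ`. -/
def HasWeight (c : P.Pt →₀ K) (μ : Fin P.n → ℤ) : Prop := ∀ p, c p ≠ 0 → p.1 + p.2 = μ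

/-- `c` is a nonzero vector of `N` of weight `μ`, of minimal height. -/
structure IsLowest (N : Submodule K (P.Pt →₀ K)) (c : P.Pt →₀ K) (μ : Fin P.n → ℤ) : Prop where
  mem : c ∈ N
  ne : c ≠ 0
  wt : HasWeight c μ
  low : ∀ d ∈ N, ∀ ν, HasWeight d ν → height (P := P) ν < height (P := P) μ → d = 0

/-- The weights that occur have nonnegative entries, so their heights are nonnegative integers and a
minimum exists. Projection to weight components supplies a first weight vector. -/
theorem IsSub.exists_isLowest {x y : K} (hSn : S ⊆ nonneg P.n) (hTn : T ⊆ nonneg P.n)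
    {N : Submodule K (P.Pt →₀ K)} (hN : IsSub x y S T N) (h0 : N ≠ ⊥) :
    ∃ c μ, IsLowest N c μ := by
  classical
  have hpos : ∀ c ∈ N, ∀ μ, c ≠ 0 → HasWeight c μ → 0 ≤ height (P := P) μ := by
    intro c hc μ hc0 hμ
    obtain ⟨p, hp⟩ := Finsupp.ne_iff.1 hc0
    obtain ⟨h1, h2⟩ := hN.supp c hc p hp
    rw [← hμ p hp]
    refine Finset.sum_nonneg fun j _ => mul_nonneg (by positivity) (add_nonneg (hSn h1 j) (hTn h2
      j))
  have hex : ∃ k : ℕ, ∃ c ∈ N, ∃ μ, c ≠ 0 ∧ HasWeight c μ ∧ height (P := P) μ = k := by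
    obtain ⟨c, hc, hc0⟩ := Submodule.exists_mem_ne_zero_of_ne_bot h0
    obtain ⟨p, hp⟩ := Finsupp.ne_iff.1 hc0
    have hd := hN.filter_weight_mem hc (p.1 + p.2)
    have hd0 : c.filter (fun r => r.1 + r.2 = p.1 + p.2) ≠ 0 := by
      intro h
      have := DFunLike.congr_fun h p
      rw [Finsupp.filter_apply, if_pos rfl] at this
      exact hp this
    have hw : HasWeight (c.filter fun r => r.1 + r.2 = p.1 + p.2) (p.1 + p.2) := by
      intro r hr
      rw [Finsupp.filter_apply] at hr
      by_contra h
      rw [if_neg h] at hr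
      exact hr rfl
    exact ⟨(height (P := P) (p.1 + p.2)).toNat, _, hd, _, hd0, hw,
      (Int.toNat_of_nonneg (hpos _ hd _ hd0 hw)).symm⟩
  obtain ⟨c, hc, μ, hc0, hw, hk⟩ := Nat.find_spec hex
  refine ⟨c, μ, hc, hc0, hw, fun d hd ν hν hlt => ?_⟩
  by_contra hd0
  have h1 := hpos d hd ν hd0 hν
  refine Nat.find_min hex (m := (height (P := P) ν).toNat) (by omega)
    ⟨d, hd, ν, hd0, hν, (Int.toNat_of_nonneg h1).symm⟩

theorem HasWeight.opE {c : P.Pt →₀ K} {μ : Fin P.n → ℤ} (h : HasWeight c μ) (x y : K)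
    (i : Fin (P.n + 1)) : HasWeight (P.opE x y i c) (μ + P.shift i) := by
  rintro ⟨m, m'⟩ hp
  rw [opE_apply] at hp
  by_cases h1 : c (m, m' - P.shift i) = 0
  · rw [h1, mul_zero, zero_add] at hp
    rw [← h _ (right_ne_zero_of_mul hp)]
    simp only
    abel
  · rw [← h _ h1]
    simp only
    abel

theorem HasWeight.opF {c : P.Pt →₀ K} {μ : Fin P.n → ℤ} (h : HasWeight c μ) (x y : K)
    (i : Fin (P.n + 1)) : HasWeight (P.opF x y i c) (μ - P.shift i) := by
  rintro ⟨m, m'⟩ hp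
  rw [opF_apply] at hp
  by_cases h1 : c (m, m' + P.shift i) = 0
  · rw [h1, mul_zero, add_zero] at hp
    rw [← h _ (right_ne_zero_of_mul hp)]
    simp only
    abel
  · rw [← h _ h1]
    simp only
    abel

/-- For `i < n` the generator `e_i` creates particles at the first site or moves one a site further,
which raises the height by its step. The generator `e_n` removes particles and lowers the height,
whence the restriction on `i`. -/
theorem height_shift {i : Fin (P.n + 1)} (hi : i.val < P.n) : 0 < height (P.shift i) := by
  have hst : 0 < (P.node i).step := by
    cases P.node i <;> simp [Node.step]
  have h1 : height (P.shift i) = (P.node i).step := by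
    unfold height shift
    simp only [mul_sub, Finset.sum_sub_distrib]
    rw [Finset.sum_eq_single (⟨i.val, hi⟩ : Fin P.n)]
    · by_cases h0 : i.val = 0
      · rw [Finset.sum_eq_zero]
        · simp [h0]
        · intro j _
          rw [if_neg (by omega), mul_zero]
      · rw [Finset.sum_eq_single (⟨i.val - 1, by omega⟩ : Fin P.n)]
        · have e : i.val - 1 + 1 = i.val := by omega
          have e' : ((i.val - 1 : ℕ) : ℤ) = i.val - 1 := by omega
          simp only [e, e', if_true]
          ring
        · intro j _ hj
          rw [if_neg, mul_zero]
          intro h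
          exact hj (Fin.ext (by simp only; omega))
        · intro h; exact absurd (Finset.mem_univ _) h
    · intro j _ hj
      rw [if_neg, mul_zero]
      intro h
      exact hj (Fin.ext h)
    · intro h; exact absurd (Finset.mem_univ _) h
  rw [h1]; exact hst

theorem IsLowest.opF_eq_zero {x y : K} {N : Submodule K (P.Pt →₀ K)} (hN : IsSub x y S T N)
    {c : P.Pt →₀ K} {μ : Fin P.n → ℤ} (h : IsLowest N c μ) {i : Fin (P.n + 1)}
    (hi : i.val < P.n) : P.opF x y i c = 0 := by
  refine h.low _ (hN.f c h.mem i) _ (h.wt.opF x y i) ?_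
  have h1 := height_shift hi
  have h2 := height_add (P := P) (μ - P.shift i) (P.shift i)
  rw [sub_add_cancel] at h2
  omega

end Osc

/-! ### Rising products of q-integers -/

/-- The product `[a + 1] ⋯ [a + r]`. -/
noncomputable def qRise {K : Type*} [Field K] (q : K) (a : ℤ) (r : ℕ) : K :=
  ∏ k ∈ Finset.range r, qInt q (a + k + 1)

section qRise

variable {K : Type*} [Field K] {q : K}

theorem qRise_succ (a : ℤ) (r : ℕ) : qRise q a (r + 1) = qInt q (a + 1) * qRise q (a + 1) r := by
  rw [qRise, Finset.prod_range_succ', mul_comm, qRise]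
  congr 1
  · simp
  · refine Finset.prod_congr rfl fun k _ => ?_
    congr 1
    push_cast
    ring

theorem qRise_one (a : ℤ) : qRise q a 1 = qInt q (a + 1) := by simp [qRise]

theorem qRise_two (a : ℤ) : qRise q a 2 = qInt q (a + 1) * qInt q (a + 2) := by
  rw [qRise_succ, qRise_one, add_assoc]
  norm_num

theorem qRise_ne (hq : q ≠ 0) (hq1 : ∀ m : ℕ, 0 < m → q ^ m ≠ 1) {a : ℤ} (ha : 0 ≤ a) (r : ℕ) :
    qRise q a r ≠ 0 :=
  Finset.prod_ne_zero_iff.2 fun k _ => qInt_ne_zero hq hq1 (by omega)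

namespace Node

omit [Field K] in
theorem step_toNat (A : Node K) : ((A.step.toNat : ℕ) : ℤ) = A.step :=
  Int.toNat_of_nonneg (by cases A <;> simp [step])

/-- Writes the lowering coefficient as a product with as many factors as particles removed. This
lets short and long end vertices be treated together. -/
theorem IsEnd.exists_low_eq (hq : q ≠ 0) (hq1 : ∀ m : ℕ, 0 < m → q ^ m ≠ 1) {A : Node K}
    (hA : A.IsEnd q) : ∃ t : K, t ≠ 0 ∧ ∀ v : ℤ,
      A.low q (v + A.step) = t * qRise q v A.step.toNat := by
  have h2 : qInt q 2 ≠ 0 := qInt_ne_zero hq hq1 (by norm_num)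
  rcases A with _ | ⟨s, I⟩ | _
  · exact hA.elim
  · have hI0 : I ≠ 0 := by
      rintro rfl
      have := hA.2
      simp at this
    refine ⟨I * ((q + 1) / (q - 1)), mul_ne_zero hI0 (kappa_ne hq1), fun v => ?_⟩
    simp only [low, step, Int.toNat_one, qRise_one]
  · refine ⟨(qInt q 2 ^ 2)⁻¹, by positivity, fun v => ?_⟩
    have e1 : v + 2 - 1 = v + 1 := by ring
    simp only [low, step, show (2 : ℤ).toNat = 2 from rfl, qRise_two, e1]
    ring

theorem IsEnd.kval_eq (hq : q ≠ 0) {A : Node K} (hA : A.IsEnd q) (v : ℤ) :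
    A.kval q v = A.kval q 0 * q ^ (A.step * v) := by
  rcases A with _ | ⟨s, I⟩ | _
  · exact hA.elim
  · simp [kval, step]
  · simp only [kval, step, zpow_add₀ hq, mul_zero, zpow_zero]
    ring

end Node

end qRise

/-! ### Explicit formulas for the generators in terms of unit vectors -/

namespace Osc

/-- The unit vector at the site `t`. -/
def ev {n : ℕ} (t : ℕ) : Fin n → ℤ := fun j => if j.val = t then 1 else 0

theorem occ_sub' {n : ℕ} (m m' : Fin n → ℤ) (t : ℕ) : occ (m - m') t = occ m t - occ m' t := by
  unfold occ; split_ifs <;> simp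

theorem occ_smul {n : ℕ} (a : ℤ) (m : Fin n → ℤ) (t : ℕ) : occ (a • m) t = a * occ m t := by
  unfold occ; split_ifs <;> simp

theorem occ_ev {n : ℕ} (s t : ℕ) : occ (ev s : Fin n → ℤ) t = if t = s ∧ t < n then 1 else 0 := by
  by_cases h : t < n <;> simp [occ, ev, h]

variable {K : Type*} [Field K] {P : Osc K}

theorem height_ev {s : ℕ} (hs : s < P.n) : height (P := P) (ev s) = s + 1 := by
  rw [height, Finset.sum_eq_single (⟨s, hs⟩ : Fin P.n)]
  · simp [ev]
  · intro j _ hj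
    have : j.val ≠ s := fun h => hj (Fin.ext h)
    simp [ev, this]
  · intro h; exact absurd (Finset.mem_univ _) h

theorem height_smul (a : ℤ) (μ : Fin P.n → ℤ) : height (P := P) (a • μ) = a * height μ := by
  simp only [height, Pi.smul_apply, smul_eq_mul, Finset.mul_sum]
  refine Finset.sum_congr rfl fun j _ => by ring

theorem shift_mid {t : ℕ} (ht : t + 1 < P.n) :
    P.shift ⟨t + 1, by omega⟩ = ev (t + 1) - ev t := by
  funext j
  have : P.node ⟨t + 1, by omega⟩ = .mid :=
    P.node_mid (by simp) (by simp only; omega)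
  simp [shift, ev, this, Node.step]

theorem shift_first : P.shift ⟨0, by omega⟩ = P.left.step • ev 0 := by
  funext j
  simp [shift, ev, node, -zsmul_eq_mul]

theorem node_last : P.node ⟨P.n, by omega⟩ = P.right := by
  have := P.one_le
  have h : P.n ≠ 0 := by omega
  simp [node, h]

theorem shift_last : P.shift ⟨P.n, by omega⟩ = -(P.right.step • ev (P.n - 1)) := by
  have h := P.one_le
  funext j
  have h1 : j.val ≠ P.n := by omega
  have h2 : j.val + 1 = P.n ↔ j.val = P.n - 1 := by omega
  simp [shift, ev, node_last, h1, h2]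

theorem opE_first (x y : K) (c : P.Pt →₀ K) (m m' : Fin P.n → ℤ) :
    P.opE x y ⟨0, by omega⟩ c (m, m') = y * c (m, m' - P.left.step • ev 0) +
      x * P.left.kval P.q (occ m' 0) * c (m - P.left.step • ev 0, m') := by
  have h := P.one_le
  rw [opE_apply, shift_first]
  have : P.node ⟨0, by omega⟩ = P.left := by simp [node]
  simp only [eCoef, kCoef, this, if_pos, mul_one]
  rw [if_neg (by omega)]

theorem opF_first (x y : K) (c : P.Pt →₀ K) (m m' : Fin P.n → ℤ) :
    P.opF x y ⟨0, by omega⟩ c (m, m') =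
      P.left.low P.q (occ m 0 + P.left.step) * x⁻¹ * c (m + P.left.step • ev 0, m') +
      (P.left.kval P.q (occ m 0))⁻¹ * (P.left.low P.q (occ m' 0 + P.left.step) * y⁻¹) *
        c (m, m' + P.left.step • ev 0) := by
  have h := P.one_le
  have h0 : ¬ (0 : ℕ) = P.n := by omega
  rw [opF_apply, shift_first]
  have h1 : 0 < P.n := h
  simp [fCoef, kCoef, node, h0, -zsmul_eq_mul, occ_add', occ_smul, occ_ev, h1]

theorem opE_last (x y : K) (c : P.Pt →₀ K) (m m' : Fin P.n → ℤ) :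
    P.opE x y ⟨P.n, by omega⟩ c (m, m') =
      P.right.low P.q (occ m' (P.n - 1) + P.right.step) *
        c (m, m' + P.right.step • ev (P.n - 1)) +
      P.right.low P.q (occ m (P.n - 1) + P.right.step) *
        (P.right.kval P.q (occ m' (P.n - 1)))⁻¹ * c (m + P.right.step • ev (P.n - 1), m') := by
  have h := P.one_le
  have h0 : ¬ P.n = 0 := by omega
  have h1 : P.n - 1 < P.n := by omega
  rw [opE_apply, shift_last]
  simp [eCoef, kCoef, node_last, h0, -zsmul_eq_mul, occ_add', occ_smul, occ_ev, h1, sub_neg_eq_add]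

theorem opE_mid (x y : K) {t : ℕ} (ht : t + 1 < P.n) (c : P.Pt →₀ K) (m m' : Fin P.n → ℤ) :
    P.opE x y ⟨t + 1, by omega⟩ c (m, m') =
      qInt P.q (occ m' t + 1) * c (m, m' + ev t - ev (t + 1)) +
      qInt P.q (occ m t + 1) * P.q ^ (occ m' (t + 1) - occ m' t) *
        c (m + ev t - ev (t + 1), m') := by
  have hmid : P.node ⟨t + 1, by omega⟩ = .mid :=
    P.node_mid (by simp) (by simp only; omega)
  have h1 : t + 1 ≠ P.n := by omega
  have h2 : t < P.n := by omega
  have e : ∀ m : Fin P.n → ℤ, m - (ev (t + 1) - ev t) = m + ev t - ev (t + 1) := fun m => by abel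
  rw [opE_apply, shift_mid ht]
  simp [eCoef, kCoef, hmid, e, h1, h2, Node.low, Node.kval, occ_add', occ_sub', occ_ev,
    zpow_sub₀ P.q_ne, div_eq_mul_inv]

theorem opF_mid (x y : K) {t : ℕ} (ht : t + 1 < P.n) (c : P.Pt →₀ K) (m m' : Fin P.n → ℤ) :
    P.opF x y ⟨t + 1, by omega⟩ c (m, m') =
      qInt P.q (occ m (t + 1) + 1) * c (m + ev (t + 1) - ev t, m') +
      P.q ^ (occ m t - occ m (t + 1)) * qInt P.q (occ m' (t + 1) + 1) *
        c (m, m' + ev (t + 1) - ev t) := by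
  have hmid : P.node ⟨t + 1, by omega⟩ = .mid :=
    P.node_mid (by simp) (by simp only; omega)
  have h1 : t + 1 ≠ P.n := by omega
  have e : ∀ m : Fin P.n → ℤ, m + (ev (t + 1) - ev t) = m + ev (t + 1) - ev t :=
    fun m => by abel
  rw [opF_apply, shift_mid ht]
  simp [fCoef, kCoef, hmid, e, h1, ht, Node.low, Node.kval, occ_add', occ_sub', occ_ev,
    zpow_sub₀ P.q_ne, div_eq_mul_inv]

/-! ### Carrying particles to the last site and removing them there -/

section lowering

variable {x y : K} {S T : Set (Fin P.n → ℤ)} {N : Submodule K (P.Pt →₀ K)}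

theorem occ_nonneg {n : ℕ} {m : Fin n → ℤ} (h : m ∈ nonneg n) (t : ℕ) : 0 ≤ occ m t := by
  unfold occ
  split_ifs with ht
  · exact h _
  · exact le_rfl

theorem IsSub.nonneg_of_ne (hN : IsSub x y S T N) (hS : S ⊆ nonneg P.n) (hT : T ⊆ nonneg P.n)
    {c : P.Pt →₀ K} (hc : c ∈ N) {m m' : Fin P.n → ℤ} (h : c (m, m') ≠ 0) (t : ℕ) :
    0 ≤ occ m t ∧ 0 ≤ occ m' t :=
  ⟨occ_nonneg (hS (hN.supp c hc _ h).1) t, occ_nonneg (hT (hN.supp c hc _ h).2) t⟩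

variable (hN : IsSub x y S T N) (hS : S ⊆ nonneg P.n) (hT : T ⊆ nonneg P.n)
include hN hS hT

theorem IsSub.eq_zero_left {c : P.Pt →₀ K} (hc : c ∈ N) {m m' : Fin P.n → ℤ} (t : ℕ)
    (h : occ m t < 0) : c (m, m') = 0 := by
  by_contra h'
  have := (hN.nonneg_of_ne hS hT hc h' t).1
  omega

theorem IsSub.eq_zero_right {c : P.Pt →₀ K} (hc : c ∈ N) {m m' : Fin P.n → ℤ} (t : ℕ)
    (h : occ m' t < 0) : c (m, m') = 0 := by
  by_contra h'
  have := (hN.nonneg_of_ne hS hT hc h' t).2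
  omega

omit hS hT in
theorem IsSub.iterate_opE_mem {c : P.Pt →₀ K} (hc : c ∈ N) (i : Fin (P.n + 1)) (r : ℕ) :
    (P.opE x y i)^[r] c ∈ N := by
  induction r with
  | zero => exact hc
  | succ r ih => rw [Function.iterate_succ_apply']; exact hN.e _ ih i

omit hN hS hT in
theorem HasWeight.iterate_opE {c : P.Pt →₀ K} {μ : Fin P.n → ℤ} (h : HasWeight c μ)
    (i : Fin (P.n + 1)) (r : ℕ) :
    HasWeight ((P.opE x y i)^[r] c) (μ + (r : ℤ) • P.shift i) := by
  induction r with
  | zero => simpa using h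
  | succ r ih =>
    rw [Function.iterate_succ_apply']
    have := ih.opE x y i
    rwa [add_assoc, ← add_one_zsmul] at this

/-- Moving a particle in the left factor would have to put it on its site `t + 1`, which is empty in
the resulting state. So all `r` particles were moved in the right factor, and only one term of the
coproduct contributes. -/
theorem IsSub.iterate_opE_right {c : P.Pt →₀ K} (hc : c ∈ N) {t : ℕ} (ht : t + 1 < P.n)
    {m : Fin P.n → ℤ} (hm : occ m (t + 1) = 0) (r : ℕ) (m' : Fin P.n → ℤ) :
    (P.opE x y ⟨t + 1, by omega⟩)^[r] c (m, m' + (r : ℤ) • ev (t + 1)) =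
      qRise P.q (occ m' t) r * c (m, m' + (r : ℤ) • ev t) := by
  have h2 : t < P.n := by omega
  induction r generalizing m' with
  | zero => simp [qRise]
  | succ r ih =>
    rw [Function.iterate_succ_apply', opE_mid _ _ ht,
      hN.eq_zero_left hS hT (m := m + ev t - ev (t + 1)) (hN.iterate_opE_mem hc _ r) (t + 1),
        mul_zero, add_zero]
    · have e1 : m' + ((r + 1 : ℕ) : ℤ) • ev (t + 1) + ev t - ev (t + 1) =
          m' + ev t + (r : ℤ) • ev (t + 1) := by
        push_cast; rw [add_one_zsmul]; abel
      have e2 : m' + ((r + 1 : ℕ) : ℤ) • ev t = m' + ev t + (r : ℤ) • ev t := by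
        push_cast; rw [add_one_zsmul]; abel
      rw [e1, e2, ih, qRise_succ]
      simp [-zsmul_eq_mul, occ_add', occ_smul, occ_ev, h2, mul_assoc]
    · simp [occ_add', occ_sub', occ_ev, ht, hm]

/-- The mirror image: all particles were moved in the left factor, and each move picks up the
eigenvalue of `k` on the right factor, which produces the power of `q`. -/
theorem IsSub.iterate_opE_left {c : P.Pt →₀ K} (hc : c ∈ N) {t : ℕ} (ht : t + 1 < P.n)
    {m' : Fin P.n → ℤ} (hm' : occ m' (t + 1) = 0) (r : ℕ) (m : Fin P.n → ℤ) :
    (P.opE x y ⟨t + 1, by omega⟩)^[r] c (m + (r : ℤ) • ev (t + 1), m') =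
      qRise P.q (occ m t) r * P.q ^ (-(r : ℤ) * occ m' t) * c (m + (r : ℤ) • ev t, m') := by
  have h2 : t < P.n := by omega
  induction r generalizing m with
  | zero => simp [qRise]
  | succ r ih =>
    rw [Function.iterate_succ_apply', opE_mid _ _ ht,
      hN.eq_zero_right hS hT (m' := m' + ev t - ev (t + 1)) (hN.iterate_opE_mem hc _ r) (t + 1),
        mul_zero, zero_add]
    · have e1 : m + ((r + 1 : ℕ) : ℤ) • ev (t + 1) + ev t - ev (t + 1) =
          m + ev t + (r : ℤ) • ev (t + 1) := by
        push_cast; rw [add_one_zsmul]; abel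
      have e2 : m + ((r + 1 : ℕ) : ℤ) • ev t = m + ev t + (r : ℤ) • ev t := by
        push_cast; rw [add_one_zsmul]; abel
      have e3 : -((r + 1 : ℕ) : ℤ) * occ m' t = (0 - occ m' t) + (-(r : ℤ) * occ m' t) := by
        push_cast; ring
      rw [e1, e2, ih, qRise_succ, hm', e3, zpow_add₀ P.q_ne]
      simp [-zsmul_eq_mul, occ_add', occ_smul, occ_ev, h2]
      ring
    · simp [occ_add', occ_sub', occ_ev, ht, hm']

/-- The vector `d` is obtained by applying `r`-th powers of the successive `e_j` between the sites
`s` and `s + k`. The rising products on the left cover the case `k = 0`, where the target site may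
be occupied; for `k > 0` that site is empty, and they become the constant gained at the next step.
-/
theorem IsSub.exists_transport {c : P.Pt →₀ K} (hc : c ∈ N) {μ : Fin P.n → ℤ}
    (hμ : HasWeight c μ) (r s k : ℕ) (hk : s + k < P.n) :
    ∃ d ∈ N, HasWeight d (μ + (r : ℤ) • ev (s + k) - (r : ℤ) • ev s) ∧ ∃ C : K, C ≠ 0 ∧
      ∀ m m' : Fin P.n → ℤ, (∀ t, s < t → occ m t = 0) → (∀ t, s < t → occ m' t = 0) →
        qRise P.q (occ m' (s + k)) r * d (m, m' + (r : ℤ) • ev (s + k)) =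
          C * (qRise P.q (occ m' s) r * c (m, m' + (r : ℤ) • ev s)) ∧
        qRise P.q (occ m (s + k)) r * P.q ^ (-(r : ℤ) * occ m' (s + k)) *
            d (m + (r : ℤ) • ev (s + k), m') =
          C * (qRise P.q (occ m s) r * P.q ^ (-(r : ℤ) * occ m' s) *
            c (m + (r : ℤ) • ev s, m')) := by
  induction k with
  | zero => exact ⟨c, hc, by simpa using hμ, 1, one_ne_zero, fun m m' _ _ => by simp⟩
  | succ k ih =>
    obtain ⟨d, hd, hw, C, hC, h⟩ := ih (by omega)
    have h0 := qRise_ne P.q_ne P.q_pow (le_refl 0) r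
    refine ⟨_, hN.iterate_opE_mem hd ⟨s + k + 1, by omega⟩ r, ?_, C * qRise P.q 0 r,
      mul_ne_zero hC h0, fun m m' hm hm' => ?_⟩
    · have := hw.iterate_opE (x := x) (y := y) ⟨s + k + 1, by omega⟩ r
      rw [shift_mid (show s + k + 1 < P.n from hk), smul_sub] at this
      convert this using 1
      rw [← add_assoc s k 1]
      abel
    · obtain ⟨h1, h2⟩ := h m m' hm hm'
      rw [← add_assoc s k 1]
      rw [hN.iterate_opE_right hS hT hd (t := s + k) hk (hm _ (by omega)),
        hN.iterate_opE_left hS hT hd (t := s + k) hk (hm' _ (by omega)), h1, h2,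
          hm (s + k + 1) (by omega),
        hm' (s + k + 1) (by omega)]
      simp only [mul_zero, zpow_zero, mul_one]
      constructor <;> ring

/-- The effect is that of `e_n` transplanted from the last site to the site `s`, up to a constant.
Since the height drops, this gives equations for lowest vectors beyond those from the `f_i`. -/
theorem IsSub.exists_lowering {c : P.Pt →₀ K} (hc : c ∈ N) {μ : Fin P.n → ℤ}
    (hμ : HasWeight c μ) {s : ℕ} (hs : s < P.n) :
    ∃ d ∈ N, HasWeight d (μ - P.right.step • ev s) ∧ ∃ C : K, C ≠ 0 ∧
      ∀ m m' : Fin P.n → ℤ, (∀ t, s < t → occ m t = 0) → (∀ t, s < t → occ m' t = 0) →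
        d (m, m') = C * (qRise P.q (occ m' s) P.right.step.toNat *
            c (m, m' + P.right.step • ev s) +
          (P.right.kval P.q 0)⁻¹ * (qRise P.q (occ m s) P.right.step.toNat *
            P.q ^ (-P.right.step * occ m' s) * c (m + P.right.step • ev s, m'))) := by
  -- The transport ends at site `P.n - 1`, the only one on which `e_n` acts, with exactly as many
  -- particles as `e_n` removes.
  obtain ⟨d, hd, hw, C, hC, h⟩ := hN.exists_transport hS hT hc hμ P.right.step.toNat s
    (P.n - 1 - s) (by omega)
  obtain ⟨l, hl, hlow⟩ := P.right_isEnd.exists_low_eq P.q_ne P.q_pow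
  rw [P.right.step_toNat, show s + (P.n - 1 - s) = P.n - 1 by omega] at hw h
  refine ⟨_, hN.e d hd ⟨P.n, by omega⟩, ?_, l * C, mul_ne_zero hl hC, fun m m' hm hm' => ?_⟩
  · have := hw.opE x y ⟨P.n, by omega⟩
    rw [shift_last] at this
    convert this using 1
    abel
  · obtain ⟨h1, h2⟩ := h m m' hm hm'
    rw [opE_last, hlow, hlow, P.right_isEnd.kval_eq P.q_ne (occ m' (P.n - 1))]
    simp only [neg_mul, zpow_neg, mul_inv] at h2 ⊢
    linear_combination l * h1 + l * (P.right.kval P.q 0)⁻¹ * h2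

end lowering

end Osc

/-- The determinant needed in `IsSingular.eq_zero_of_two_le_site_zero`; the right-hand side shows
when it is nonzero. -/
theorem qInt_mul_sub_mul {K : Type*} [Field K] {q : K} (hq : q ≠ 0)
    (hq1 : ∀ m : ℕ, 0 < m → q ^ m ≠ 1) (a b : ℤ) :
    qInt q (a + 2) * qInt q (b + 1) - qInt q a * qInt q (b - 1) =
      qInt q 2 * qInt q (a + b + 1) := by
  have h1 := qsub_ne hq hq1
  have h2 := zpow_ne_zero a hq
  have h3 := zpow_ne_zero b hq
  have e : ∀ v : ℤ, qInt q v = (q ^ v - (q ^ v)⁻¹) / (q - q⁻¹) := fun v => by rw [qInt, zpow_neg]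
  simp only [e, zpow_add₀ hq, zpow_sub₀ hq, zpow_ofNat]
  rw [div_mul_div_comm, div_mul_div_comm, div_mul_div_comm, ← sub_div]
  congr 1
  field_simp
  ring

/-! ### Singular vectors -/

namespace Osc

variable {K : Type*} [Field K] {P : Osc K}

/-- A vector supported on nonnegative occupation numbers and annihilated by
`f_0, …, f_{n-1}`. -/
structure IsSingular (x y : K) (c : P.Pt →₀ K) : Prop where
  nonneg : ∀ m m', c (m, m') ≠ 0 → ∀ t, 0 ≤ occ m t ∧ 0 ≤ occ m' t
  f : ∀ i : Fin (P.n + 1), i.val < P.n → P.opF x y i c = 0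

namespace IsSingular

variable {x y : K} {c : P.Pt →₀ K} (h : IsSingular x y c)
include h

theorem eq_zero_left {m m' : Fin P.n → ℤ} (t : ℕ) (ht : occ m t < 0) : c (m, m') = 0 := by
  by_contra h'
  have := (h.nonneg m m' h' t).1
  omega

theorem eq_zero_right {m m' : Fin P.n → ℤ} (t : ℕ) (ht : occ m' t < 0) : c (m, m') = 0 := by
  by_contra h'
  have := (h.nonneg m m' h' t).2
  omega

theorem first (m m' : Fin P.n → ℤ) :
    P.left.low P.q (occ m 0 + P.left.step) * x⁻¹ * c (m + P.left.step • ev 0, m') +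
      (P.left.kval P.q (occ m 0))⁻¹ * (P.left.low P.q (occ m' 0 + P.left.step) * y⁻¹) *
        c (m, m' + P.left.step • ev 0) = 0 := by
  have h1 := P.one_le
  rw [← opF_first, h.f _ (by simp only; omega), Finsupp.zero_apply]

theorem mid {t : ℕ} (ht : t + 1 < P.n) (m m' : Fin P.n → ℤ) :
    qInt P.q (occ m (t + 1) + 1) * c (m + ev (t + 1) - ev t, m') +
      P.q ^ (occ m t - occ m (t + 1)) * qInt P.q (occ m' (t + 1) + 1) *
        c (m, m' + ev (t + 1) - ev t) = 0 := by
  rw [← opF_mid x y ht, h.f _ ht, Finsupp.zero_apply]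

/-- The equation has two terms, so up to a nonzero factor the coefficient is unchanged by a trade: a
particle of the left factor steps back from site `t + 1` to `t`, while one of the right factor steps
forward. Iterating such trades until an entry becomes negative is the basic vanishing argument. -/
theorem mid_left {t : ℕ} (ht : t + 1 < P.n) {m m' : Fin P.n → ℤ} (hm : 1 ≤ occ m (t + 1))
    (hc : c (m - ev (t + 1) + ev t, m' + ev (t + 1) - ev t) = 0) : c (m, m') = 0 := by
  have h1 := h.mid ht (m - ev (t + 1) + ev t) m'
  have e : m - ev (t + 1) + ev t + ev (t + 1) - ev t = m := by abel
  rw [hc, mul_zero, add_zero, e] at h1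
  refine (mul_eq_zero.1 h1).resolve_left (qInt_ne_zero P.q_ne P.q_pow ?_)
  simp only [occ_add', occ_sub', occ_ev, ht, and_true, if_true]
  rw [if_neg (by omega)]
  omega

theorem mid_right {t : ℕ} (ht : t + 1 < P.n) {m m' : Fin P.n → ℤ} (hm : 1 ≤ occ m' (t + 1))
    (hc : c (m + ev (t + 1) - ev t, m' - ev (t + 1) + ev t) = 0) : c (m, m') = 0 := by
  have h1 := h.mid ht m (m' - ev (t + 1) + ev t)
  have e : m' - ev (t + 1) + ev t + ev (t + 1) - ev t = m' := by abel
  rw [hc, mul_zero, zero_add, e] at h1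
  refine (mul_eq_zero.1 h1).resolve_left (mul_ne_zero (zpow_ne_zero _ P.q_ne)
    (qInt_ne_zero P.q_ne P.q_pow ?_))
  simp only [occ_add', occ_sub', occ_ev, ht, and_true, if_true]
  rw [if_neg (by omega)]
  omega

omit h in
theorem low_left_ne {v : ℤ} (hv : P.left.step ≤ v) : P.left.low P.q v ≠ 0 := by
  obtain ⟨l, hl, hlow⟩ := P.left_isEnd.exists_low_eq P.q_ne P.q_pow
  have := hlow (v - P.left.step)
  rw [sub_add_cancel] at this
  rw [this]
  exact mul_ne_zero hl (qRise_ne P.q_ne P.q_pow (by omega) _)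

/-- The trade given by `f_0`: `P.left.step` particles on the first site pass from the left factor to
the right one. -/
theorem first_left (hx : x ≠ 0) {m m' : Fin P.n → ℤ} (hm : P.left.step ≤ occ m 0)
    (hc : c (m - P.left.step • ev 0, m' + P.left.step • ev 0) = 0) : c (m, m') = 0 := by
  have h1 := h.first (m - P.left.step • ev 0) m'
  rw [hc, mul_zero, add_zero, sub_add_cancel] at h1
  refine (mul_eq_zero.1 h1).resolve_left (mul_ne_zero (low_left_ne ?_) (inv_ne_zero hx))
  have h2 : 0 < P.n := P.one_le
  simp only [occ_sub', occ_smul, occ_ev, h2, and_true, if_true]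
  omega

theorem first_right (hy : y ≠ 0) {m m' : Fin P.n → ℤ} (hm : P.left.step ≤ occ m' 0)
    (hc : c (m + P.left.step • ev 0, m' - P.left.step • ev 0) = 0) : c (m, m') = 0 := by
  have h1 := h.first m (m' - P.left.step • ev 0)
  rw [hc, mul_zero, zero_add, sub_add_cancel] at h1
  refine (mul_eq_zero.1 h1).resolve_left (mul_ne_zero
    (inv_ne_zero (Node.Ok.kval_ne P.q_ne (Or.inr P.left_isEnd) _))
    (mul_ne_zero (low_left_ne ?_) (inv_ne_zero hy)))
  have h2 : 0 < P.n := P.one_le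
  simp only [occ_sub', occ_smul, occ_ev, h2, and_true, if_true]
  omega

/-- Trades through `f_0` empty the first site of the left factor without touching the second site of
the right one. One more trade, through `f_1`, then makes the first site of the left factor negative.
Divisibility by the step is what allows the site to be emptied completely. -/
theorem eq_zero_of_site_one_right (hx : x ≠ 0) (h1 : 1 < P.n) (k : ℕ) (m m' : Fin P.n → ℤ)
    (hk : occ m 0 = P.left.step * k) (hm' : 1 ≤ occ m' 1) : c (m, m') = 0 := by
  have h0 : 0 < P.n := P.one_le
  have hst := step_nonneg P.left
  induction k generalizing m m' with
  | zero =>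
    refine h.mid_right (t := 0) h1 hm' (h.eq_zero_left 0 ?_)
    simp [occ_add', occ_sub', occ_ev, h0, hk]
  | succ k ih =>
    have hk0 : 0 ≤ P.left.step * (k : ℤ) := by positivity
    have e : P.left.step * ((k + 1 : ℕ) : ℤ) = P.left.step * k + P.left.step := by
      push_cast; ring
    refine h.first_left hx (by omega) (ih _ _ ?_ ?_)
    · simp only [occ_sub', occ_smul, occ_ev, h0, and_true, if_true]
      omega
    · simpa [occ_add', occ_smul, occ_ev, -zsmul_eq_mul] using hm'

theorem eq_zero_of_site_one_left (hy : y ≠ 0) (h1 : 1 < P.n) (k : ℕ) (m m' : Fin P.n → ℤ)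
    (hk : occ m' 0 = P.left.step * k) (hm' : 1 ≤ occ m 1) : c (m, m') = 0 := by
  have h0 : 0 < P.n := P.one_le
  have hst := step_nonneg P.left
  induction k generalizing m m' with
  | zero =>
    refine h.mid_left (t := 0) h1 hm' (h.eq_zero_right 0 ?_)
    simp [occ_add', occ_sub', occ_ev, h0, hk]
  | succ k ih =>
    have hk0 : 0 ≤ P.left.step * (k : ℤ) := by positivity
    have e : P.left.step * ((k + 1 : ℕ) : ℤ) = P.left.step * k + P.left.step := by
      push_cast; ring
    refine h.first_right hy (by omega) (ih _ _ ?_ ?_)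
    · simp only [occ_sub', occ_smul, occ_ev, h0, and_true, if_true]
      omega
    · simpa [occ_add', occ_smul, occ_ev, -zsmul_eq_mul] using hm'

/-- A particle at site `t + 1` could be traded back to site `t`, which is already known to be empty
for every point of the support. So emptiness propagates from `s` to all later sites. -/
theorem site_eq_zero_of_le {s : ℕ} (hs : ∀ m m', c (m, m') ≠ 0 → occ m s = 0 ∧ occ m' s = 0)
    {t : ℕ} (hst : s ≤ t) (m m' : Fin P.n → ℤ) (hc : c (m, m') ≠ 0) :
    occ m t = 0 ∧ occ m' t = 0 := by
  induction t, hst using Nat.le_induction generalizing m m' with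
  | base => exact hs m m' hc
  | succ t hst ih =>
    by_cases ht : t + 1 < P.n
    · have ht' : t < P.n := by omega
      obtain ⟨h1, h2⟩ := h.nonneg m m' hc (t + 1)
      obtain ⟨h3, h4⟩ := ih m m' hc
      constructor
      · by_contra h5
        refine hc (h.mid_left ht (by omega) (by_contra fun h6 => ?_))
        have := (ih _ _ h6).1
        simp [occ_add', occ_sub', occ_ev, h3, ht'] at this
      · by_contra h5
        refine hc (h.mid_right ht (by omega) (by_contra fun h6 => ?_))
        have := (ih _ _ h6).2
        simp [occ_add', occ_sub', occ_ev, h4, ht'] at this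
    · simp [occ, ht]

/-- With step 1 the divisibility condition of `eq_zero_of_site_one_left` and
`eq_zero_of_site_one_right` is always met. -/
theorem site_eq_zero_of_short (hx : x ≠ 0) (hy : y ≠ 0) (hl : P.left.step = 1) {t : ℕ}
    (ht : 1 ≤ t) (m m' : Fin P.n → ℤ) (hc : c (m, m') ≠ 0) : occ m t = 0 ∧ occ m' t = 0 := by
  refine h.site_eq_zero_of_le (fun m m' hc => ?_) ht m m' hc
  by_cases h1 : 1 < P.n
  · obtain ⟨a1, a2⟩ := h.nonneg m m' hc 1
    obtain ⟨b1, b2⟩ := h.nonneg m m' hc 0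
    constructor
    · by_contra h2
      refine hc (h.eq_zero_of_site_one_left hy h1 (occ m' 0).toNat m m' ?_ (by omega))
      rw [hl]; omega
    · by_contra h2
      refine hc (h.eq_zero_of_site_one_right hx h1 (occ m 0).toNat m m' ?_ (by omega))
      rw [hl]; omega
  · simp [occ, h1]

/-! ### Singular vectors when the vertex 0 is long: parity at the first site -/

section long

variable (hx : x ≠ 0) (hy : y ≠ 0) (hl : P.left = .long) (h1 : 1 < P.n)
include hl h1

include hx in
theorem eq_zero_of_even_left (m m' : Fin P.n → ℤ) (hm : occ m 0 % 2 = 0) (hm' : 1 ≤ occ m' 1) :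
    c (m, m') = 0 := by
  by_contra hc
  have := (h.nonneg m m' hc 0).1
  refine hc (h.eq_zero_of_site_one_right hx h1 (occ m 0 / 2).toNat m m' ?_ hm')
  rw [hl, Node.step]; omega

include hy in
theorem eq_zero_of_even_right (m m' : Fin P.n → ℤ) (hm : occ m' 0 % 2 = 0) (hm' : 1 ≤ occ m 1) :
    c (m, m') = 0 := by
  by_contra hc
  have := (h.nonneg m m' hc 0).2
  refine hc (h.eq_zero_of_site_one_left hy h1 (occ m' 0 / 2).toNat m m' ?_ hm')
  rw [hl, Node.step]; omega

-- If the first site of the left factor is odd, one trade through `f_1` makes it even and still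
-- leaves a particle on the second site of the right factor.
include hx in
theorem eq_zero_of_two_le_right (m m' : Fin P.n → ℤ) (hm' : 2 ≤ occ m' 1) : c (m, m') = 0 := by
  have h0 : 0 < P.n := P.one_le
  by_cases hm : occ m 0 % 2 = 0
  · exact h.eq_zero_of_even_left hx hl h1 m m' hm (by omega)
  · refine h.mid_right (t := 0) h1 (by simp only [zero_add]; omega)
      (h.eq_zero_of_even_left hx hl h1 _ _ ?_ ?_) <;>
    · simp [occ_add', occ_sub', occ_ev, h0, h1]; omega

include hy in
theorem eq_zero_of_two_le_left (m m' : Fin P.n → ℤ) (hm : 2 ≤ occ m 1) : c (m, m') = 0 := by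
  have h0 : 0 < P.n := P.one_le
  by_cases hm' : occ m' 0 % 2 = 0
  · exact h.eq_zero_of_even_right hy hl h1 m m' hm' (by omega)
  · refine h.mid_left (t := 0) h1 (by simp only [zero_add]; omega)
      (h.eq_zero_of_even_right hy hl h1 _ _ ?_ ?_) <;>
    · simp [occ_add', occ_sub', occ_ev, h0, h1]; omega

include hy in
theorem eq_zero_of_both (m m' : Fin P.n → ℤ) (hm : 1 ≤ occ m 1) (hm' : 1 ≤ occ m' 1) :
    c (m, m') = 0 := by
  refine h.mid_right (t := 0) h1 hm' (h.eq_zero_of_two_le_left hy hl h1 _ _ ?_)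
  simp [occ_add', occ_sub', occ_ev, h1]; omega

include hy in
theorem eq_zero_of_odd_right (m m' : Fin P.n → ℤ) (hm' : 1 ≤ occ m' 1)
    (ho : occ m' 0 % 2 = 1) : c (m, m') = 0 := by
  have h0 : 0 < P.n := P.one_le
  by_contra hc
  have hn := (h.nonneg m m' hc 1).1
  refine hc (h.mid_right (t := 0) h1 hm' (h.eq_zero_of_even_right hy hl h1 _ _ ?_ ?_)) <;>
  · simp [occ_add', occ_sub', occ_ev, h0, h1]; omega

-- Four coefficients form a square: `f_1` links them along two opposite sides and `f_0` along the
-- other two. Going around the square gives an incompatible condition unless the determinant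
-- `[a+2][b+1] - [a][b-1]` vanishes, and by `qInt_mul_sub_mul` it does not.
include hx hy in
theorem eq_zero_of_two_le_site_zero (m m' : Fin P.n → ℤ) (hm : occ m 1 = 0) (hm' : occ m' 1 = 1)
    (h2 : 2 ≤ occ m' 0) : c (m, m') = 0 := by
  have h0 : 0 < P.n := P.one_le
  by_contra hc
  have ha := (h.nonneg m m' hc 0).1
  have r1 := h.mid (t := 0) h1 m (m' - ev 1 + ev 0)
  have r2 := h.mid (t := 0) h1 (m + (2 : ℤ) • ev 0) (m' - (2 : ℤ) • ev 0 - ev 1 + ev 0)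
  have r3 := h.first m (m' - (2 : ℤ) • ev 0)
  have r4 := h.first (m + ev 1 - ev 0) (m' - ev 1 + ev 0 - (2 : ℤ) • ev 0)
  have e1 : m' - ev 1 + ev 0 + ev 1 - ev 0 = m' := by abel
  have e2 : m' - (2 : ℤ) • ev 0 - ev 1 + ev 0 + ev 1 - ev 0 = m' - (2 : ℤ) • ev 0 := by abel
  have e3 : m + ev 1 - ev 0 + (2 : ℤ) • ev 0 = m + (2 : ℤ) • ev 0 + ev 1 - ev 0 := by abel
  have e4 : m' - ev 1 + ev 0 - (2 : ℤ) • ev 0 = m' - (2 : ℤ) • ev 0 - ev 1 + ev 0 := by abel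
  simp only [hl, Node.step, sub_add_cancel, e3] at r3 r4
  rw [e4] at r4
  simp only [zero_add, e1, e2] at r1 r2
  simp only [occ_add', occ_sub', occ_smul, occ_ev, h0, h1, hm, hm', Node.low,
    Node.kval] at r1 r2 r3 r4
  norm_num at r1 r2 r3 r4
  have q1 : qInt P.q 1 = 1 := qInt_one P.q_ne P.q_pow
  rw [q1, one_mul, mul_one] at r1 r2
  obtain ⟨a, haa⟩ : ∃ a, occ m 0 = a := ⟨_, rfl⟩
  obtain ⟨b, hbb⟩ : ∃ b, occ m' 0 = b := ⟨_, rfl⟩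
  rw [haa] at r1 r2 r3 r4 ha
  rw [hbb] at r3 r4 h2
  rw [show a + 2 - 1 = a + 1 by ring, show 2 * a + 1 = a + a + 1 by ring] at r3
  rw [show a - 1 + 2 - 1 = a by ring, show a - 1 + 2 = a + 1 by ring,
    show 2 * (a - 1) + 1 = a + a - 1 by ring, show b - 2 + 1 + 2 - 1 = b by ring,
    show b - 2 + 1 + 2 = b + 1 by ring] at r4
  generalize c (m, m') = α at *
  generalize c (m + ev 1 - ev 0, m' - ev 1 + ev 0) = β at *
  generalize c (m + 2 * ev 0, m' - 2 * ev 0) = γ at *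
  generalize c (m + 2 * ev 0 + ev 1 - ev 0, m' - 2 * ev 0 - ev 1 + ev 0) = δ at *
  obtain rfl : β = -(P.q ^ a * α) := eq_neg_of_add_eq_zero_left r1
  obtain rfl : δ = -(P.q ^ (a + 2) * γ) := eq_neg_of_add_eq_zero_left r2
  have key := qInt_mul_sub_mul P.q_ne P.q_pow a b
  have n1 : qInt P.q b ≠ 0 := qInt_ne_zero P.q_ne P.q_pow (by omega)
  have n2 : qInt P.q 2 ≠ 0 := qInt_ne_zero P.q_ne P.q_pow (by norm_num)
  have n3 : qInt P.q (a + b + 1) ≠ 0 := qInt_ne_zero P.q_ne P.q_pow (by omega)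
  have n4 := zpow_ne_zero a P.q_ne
  have n5 := P.q_ne
  simp only [zpow_add₀ P.q_ne, zpow_sub₀ P.q_ne, zpow_ofNat] at r3 r4
  generalize P.q ^ a = A at *
  field_simp at r3 r4
  have fin : α * (x * qInt P.q b * (qInt P.q 2 * qInt P.q (a + b + 1))) = 0 := by
    rw [← key]
    apply mul_left_cancel₀ n5
    linear_combination qInt P.q (a + 2) * r4 + P.q * qInt P.q a * r3
  have : α * (x * qInt P.q b * (qInt P.q 2 * qInt P.q (a + b + 1))) ≠ 0 :=
    mul_ne_zero hc (by positivity)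
  exact this fin

include hx hy in
theorem occ_of_site_one_right (m m' : Fin P.n → ℤ) (hc : c (m, m') ≠ 0) (hm' : 1 ≤ occ m' 1) :
    occ m 0 = 1 ∧ occ m' 0 = 0 ∧ occ m 1 = 0 ∧ occ m' 1 = 1 := by
  have h0 : 0 < P.n := P.one_le
  obtain ⟨a0, b0⟩ := h.nonneg m m' hc 0
  obtain ⟨a1, b1⟩ := h.nonneg m m' hc 1
  have t1 := mt (h.eq_zero_of_two_le_right hx hl h1 m m') hc
  have t2 := mt (fun hm => h.eq_zero_of_both hy hl h1 m m' hm hm') hc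
  have t3 := mt (h.eq_zero_of_odd_right hy hl h1 m m' hm') hc
  have t4 := mt (fun hm => h.eq_zero_of_even_left hx hl h1 m m' hm hm') hc
  have t5 : ¬ 2 ≤ occ m' 0 := fun h2 =>
    hc (h.eq_zero_of_two_le_site_zero hx hy hl h1 m m' (by omega) (by omega) h2)
  -- With three or more particles, a trade through `f_0` puts two of them on the first site of the
  -- right factor, which is the case just excluded.
  have t6 : ¬ 3 ≤ occ m 0 := fun h3 => by
    refine hc (h.first_left hx (by rw [hl, Node.step]; omega)
      (h.eq_zero_of_two_le_site_zero hx hy hl h1 _ _ ?_ ?_ ?_)) <;>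
    · simp [occ_add', occ_sub', occ_smul, occ_ev, h0, hl, Node.step, -zsmul_eq_mul]
      omega
  omega

include hx hy in
theorem occ_of_site_one_left (m m' : Fin P.n → ℤ) (hc : c (m, m') ≠ 0) (hm : 1 ≤ occ m 1) :
    occ m 0 = 0 ∧ occ m' 0 = 1 ∧ occ m 1 = 1 ∧ occ m' 1 = 0 := by
  have h0 : 0 < P.n := P.one_le
  obtain ⟨a1, b1⟩ := h.nonneg m m' hc 1
  have hne : c (m - ev 1 + ev 0, m' + ev 1 - ev 0) ≠ 0 := fun hz => hc (h.mid_left (t := 0) h1 hm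
    hz)
  have := h.occ_of_site_one_right hx hy hl h1 _ _ hne (by
    simp [occ_add', occ_sub', occ_ev, h1]; omega)
  simp [occ_add', occ_sub', occ_ev, h1, h0] at this
  omega

-- This isolates the only configurations by which a singular weight vector can reach the second
-- site. Such a vector can satisfy all the `f_i` equations, so it has to be excluded later by
-- raising and lowering.
include hx hy in
theorem eq_of_weight_one {μ : Fin P.n → ℤ} (hw : HasWeight c μ) (hμ : occ μ 1 ≠ 0)
    (m m' : Fin P.n → ℤ) (hc : c (m, m') ≠ 0) :
    (m = ev 0 ∧ m' = ev 1) ∨ (m = ev 1 ∧ m' = ev 0) := by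
  have h0 : 0 < P.n := P.one_le
  have key : ∀ m m' : Fin P.n → ℤ, c (m, m') ≠ 0 →
      (occ m 0 = 1 ∧ occ m' 0 = 0 ∧ occ m 1 = 0 ∧ occ m' 1 = 1) ∨
      (occ m 0 = 0 ∧ occ m' 0 = 1 ∧ occ m 1 = 1 ∧ occ m' 1 = 0) := by
    intro m m' hc
    have := hw _ hc
    rw [← this, occ_add'] at hμ
    simp only at hμ
    obtain ⟨a1, b1⟩ := h.nonneg m m' hc 1
    by_cases hm : 1 ≤ occ m 1
    · exact Or.inr (h.occ_of_site_one_left hx hy hl h1 m m' hc hm)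
    · exact Or.inl (h.occ_of_site_one_right hx hy hl h1 m m' hc (by omega))
  -- A trade between the second and third sites would destroy the pattern forced on the first two
  -- sites, or make an entry negative.
  have site2 : ∀ m m' : Fin P.n → ℤ, c (m, m') ≠ 0 → occ m 2 = 0 ∧ occ m' 2 = 0 := by
    intro m m' hc
    by_cases h2 : 2 < P.n
    · obtain ⟨a2, b2⟩ := h.nonneg m m' hc 2
      have hk := key m m' hc
      constructor
      · by_contra hz
        refine hc (h.mid_left (t := 1) h2 (by simp only [Nat.reduceAdd]; omega)
          (by_contra fun hne => ?_))
        have hk' := key _ _ hne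
        have hn := h.nonneg _ _ hne 1
        simp [occ_add', occ_sub', occ_ev, h0, h1] at hk' hn
        omega
      · by_contra hz
        refine hc (h.mid_right (t := 1) h2 (by simp only [Nat.reduceAdd]; omega)
          (by_contra fun hne => ?_))
        have hk' := key _ _ hne
        have hn := h.nonneg _ _ hne 1
        simp [occ_add', occ_sub', occ_ev, h0, h1] at hk' hn
        omega
    · simp [occ, h2]
  have hrest : ∀ t, 2 ≤ t → occ m t = 0 ∧ occ m' t = 0 := fun t ht =>
    h.site_eq_zero_of_le site2 ht m m' hc
  rcases key m m' hc with hk | hk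
  · refine Or.inl ⟨occ_ext fun t ht => ?_, occ_ext fun t ht => ?_⟩ <;>
    · obtain rfl | rfl | ht' : t = 0 ∨ t = 1 ∨ 2 ≤ t := by omega
      · simp [occ_ev, ht, hk]
      · simp [occ_ev, ht, hk]
      · have e0 : t ≠ 0 := by omega
        have e1 : t ≠ 1 := by omega
        simp [occ_ev, hrest t ht', e0, e1]
  · refine Or.inr ⟨occ_ext fun t ht => ?_, occ_ext fun t ht => ?_⟩ <;>
    · obtain rfl | rfl | ht' : t = 0 ∨ t = 1 ∨ 2 ≤ t := by omega
      · simp [occ_ev, ht, hk]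
      · simp [occ_ev, ht, hk]
      · have e0 : t ≠ 0 := by omega
        have e1 : t ≠ 1 := by omega
        simp [occ_ev, hrest t ht', e0, e1]

end long

end IsSingular

end Osc

/-! ### Vectors concentrated on the first site -/

namespace Osc

variable {K : Type*} [Field K] {P : Osc K}

/-- The occupation vector with `a` particles at the first site. -/
def axis {n : ℕ} (a : ℤ) : Fin n → ℤ := a • ev 0

theorem axis_add {n : ℕ} (a b : ℤ) : (axis a + b • ev 0 : Fin n → ℤ) = axis (a + b) :=
  (add_smul _ _ _).symm

theorem occ_axis_zero (a : ℤ) : occ (axis a : Fin P.n → ℤ) 0 = a := by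
  have h0 : 0 < P.n := P.one_le
  simp [axis, occ_smul, occ_ev, h0, -zsmul_eq_mul]

theorem occ_axis {n : ℕ} (a : ℤ) {t : ℕ} (ht : 0 < t) : occ (axis a : Fin n → ℤ) t = 0 := by
  have : t ≠ 0 := by omega
  simp [axis, occ_smul, occ_ev, this, -zsmul_eq_mul]

theorem eq_axis {m : Fin P.n → ℤ} (h : ∀ t, 1 ≤ t → occ m t = 0) : m = axis (occ m 0) := by
  refine occ_ext fun t _ => ?_
  rcases Nat.eq_zero_or_pos t with rfl | ht
  · rw [occ_axis_zero]
  · rw [occ_axis _ ht, h t ht]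

theorem sum_axis (a : ℤ) : ∑ j, (axis a : Fin P.n → ℤ) j = a := by
  have h0 : 0 < P.n := P.one_le
  rw [Finset.sum_eq_single (⟨0, h0⟩ : Fin P.n)]
  · simp [axis, ev]
  · intro j _ hj
    have : j.val ≠ 0 := fun h => hj (Fin.ext h)
    simp [axis, ev, this]
  · intro h; exact absurd (Finset.mem_univ _) h

theorem single_mem_of_forall {N : Submodule K (P.Pt →₀ K)} {c : P.Pt →₀ K} (hc : c ∈ N)
    (h0 : c ≠ 0) {v₀ : P.Pt} (h : ∀ p, c p ≠ 0 → p = v₀) : Finsupp.single v₀ 1 ∈ N := by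
  have e : c = Finsupp.single v₀ (c v₀) := by
    ext p
    by_cases hp : p = v₀
    · rw [hp, Finsupp.single_eq_same]
    · rw [Finsupp.single_eq_of_ne hp]
      by_contra hcp
      exact hp (h p hcp)
  have hv : c v₀ ≠ 0 := by
    intro hz
    rw [hz, Finsupp.single_zero] at e
    exact h0 e
  have := N.smul_mem (c v₀)⁻¹ hc
  rw [e] at this
  rwa [Finsupp.smul_single, Finsupp.single_eq_same, smul_eq_mul, inv_mul_cancel₀ hv] at this

section lowest

variable {x y : K} {S T : Set (Fin P.n → ℤ)} {N : Submodule K (P.Pt →₀ K)}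
  (hN : IsSub x y S T N) (hS : S ⊆ nonneg P.n) (hT : T ⊆ nonneg P.n)
  {c : P.Pt →₀ K} {μ : Fin P.n → ℤ} (h : IsLowest N c μ)
include hN hS hT h

theorem IsLowest.isSingular : IsSingular x y c :=
  ⟨fun _ _ hc t => hN.nonneg_of_ne hS hT h.mem hc t, fun _ hi => h.opF_eq_zero hN hi⟩

/-- The vector produced by `IsSub.exists_lowering` from the first site has smaller height, so it
vanishes; this is its coefficient at a point of the axis. -/
theorem IsLowest.lowering (a b : ℤ) :
    qRise P.q b P.right.step.toNat * c (axis a, axis (b + P.right.step)) +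
      (P.right.kval P.q 0)⁻¹ * (qRise P.q a P.right.step.toNat * P.q ^ (-P.right.step * b) *
        c (axis (a + P.right.step), axis b)) = 0 := by
  obtain ⟨d, hd, hw, C, hC, hdc⟩ := hN.exists_lowering hS hT h.mem h.wt (s := 0) P.one_le
  have hr : 0 < P.right.step := by cases P.right <;> simp [Node.step]
  have hd0 : d = 0 := by
    refine h.low d hd _ hw ?_
    have e1 := height_add (P := P) (μ - P.right.step • ev 0) (P.right.step • ev 0)
    rw [sub_add_cancel, height_smul, height_ev P.one_le] at e1
    push_cast at e1
    linarith
  have := hdc (axis a) (axis b) (fun t ht => occ_axis a ht) (fun t ht => occ_axis b ht)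
  rw [hd0, Finsupp.zero_apply, occ_axis_zero, occ_axis_zero, axis_add, axis_add] at this
  exact (mul_eq_zero.1 this.symm).resolve_left hC

omit hN hS hT h in
theorem IsSingular.first_axis (hc : IsSingular x y c) (a b : ℤ) :
    P.left.low P.q (a + P.left.step) * x⁻¹ * c (axis (a + P.left.step), axis b) +
      (P.left.kval P.q a)⁻¹ * (P.left.low P.q (b + P.left.step) * y⁻¹) *
        c (axis a, axis (b + P.left.step)) = 0 := by
  have := hc.first (axis a) (axis b)
  rwa [occ_axis_zero, occ_axis_zero, axis_add, axis_add] at this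

end lowest

/-! ### Left vertex short: types D and A -/

section short

variable {x y : K} {S T : Set (Fin P.n → ℤ)} {N : Submodule K (P.Pt →₀ K)}
  (hN : IsSub x y S T N) (hS : S ⊆ nonneg P.n) (hT : T ⊆ nonneg P.n) (hx : x ≠ 0) (hy : y ≠ 0)

/-- The recursion coming from `f_0` when the vertex `0` is short. -/
theorem IsSingular.first_short {c : P.Pt →₀ K} (hc : IsSingular x y c) (hx : x ≠ 0) (hy : y ≠ 0)
    {s I : K} (hl : P.left = .short s I) (a b : ℤ) :
    I * s * P.q ^ a * y * (qInt P.q (a + 1) * c (axis (a + 1), axis b)) =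
      x * (qInt P.q (b + 1) * c (axis a, axis (b + 1))) := by
  have h1 := hc.first_axis a b
  have hend := P.left_isEnd
  rw [hl] at h1 hend
  obtain ⟨hs, hI⟩ := hend
  have hs0 : s ≠ 0 := by rintro rfl; exact P.q_ne (by rw [← hs]; simp)
  have hI0 : I ≠ 0 := by rintro rfl; simp at hI
  have hk := Node.kappa_ne P.q_pow
  have hqa := zpow_ne_zero a P.q_ne
  simp only [Node.low, Node.kval, Node.step] at h1
  generalize (P.q + 1) / (P.q - 1) = k at *
  field_simp at h1
  apply mul_left_cancel₀ hk
  linear_combination h1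

include hN hS hT hx hy

/-- The relations from `f_0` and from lowering are two linear equations for the coefficients at `(a
+ 1, b)` and `(a, b + 1)`. As `(I s)² = -q`, eliminating one of them leaves the factor `x +
q^(a+b+1) y`. Every point of the axis other than the vacuum is of one of these two forms. -/
theorem IsSub.vacuum_mem_of_short_short {s I s' I' : K} (hl : P.left = .short s I)
    (hr : P.right = .short s' I') (hs : I' * s' = I * s) (hN0 : N ≠ ⊥)
    (hxy : ∀ l : ℕ, 1 ≤ l → x + P.q ^ l * y ≠ 0) :
    Finsupp.single ((axis 0, axis 0) : P.Pt) 1 ∈ N := by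
  obtain ⟨c, μ, h⟩ := hN.exists_isLowest hS hT hN0
  have hc := h.isSingular hN hS hT
  refine single_mem_of_forall h.mem h.ne ?_
  rintro ⟨m, m'⟩ hp
  have hsite := fun t ht => hc.site_eq_zero_of_short hx hy (by rw [hl]; rfl) (t := t) ht m m' hp
  have hm := eq_axis fun t ht => (hsite t ht).1
  have hm' := eq_axis fun t ht => (hsite t ht).2
  obtain ⟨ha, hb⟩ := hc.nonneg m m' hp 0
  have hend := P.left_isEnd
  rw [hl] at hend
  obtain ⟨hs2, hI⟩ := hend
  have hs0 : s ≠ 0 := by rintro rfl; exact P.q_ne (by rw [← hs2]; simp)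
  have hI0 : I ≠ 0 := by rintro rfl; simp at hI
  have key : ∀ a b : ℤ, 0 ≤ a → 0 ≤ b → c (axis (a + 1), axis b) = 0 ∧
      c (axis a, axis (b + 1)) = 0 := by
    intro a b ha hb
    have r1 := hc.first_short hx hy hl a b
    have r2 := h.lowering hN hS hT a b
    have hqb := zpow_ne_zero b P.q_ne
    have hI' : I' ≠ 0 := by rintro rfl; simp [hI0, hs0] at hs
    have hs' : s' ≠ 0 := by rintro rfl; simp [hI0, hs0] at hs
    simp only [hr, Node.kval, Node.step, Int.toNat_one, qRise_one, zpow_zero, mul_one, neg_mul,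
      one_mul, zpow_neg] at r2
    rw [hs] at r2
    field_simp at r2
    have n1 := qInt_ne_zero P.q_ne P.q_pow (show a + 1 ≠ 0 by omega)
    have n2 := qInt_ne_zero P.q_ne P.q_pow (show b + 1 ≠ 0 by omega)
    have hab : P.q ^ (a + b + 1).toNat = P.q ^ a * P.q ^ b * P.q := by
      rw [← zpow_natCast, Int.toNat_of_nonneg (by omega), zpow_add_one₀ P.q_ne,
        zpow_add₀ P.q_ne]
    have hne := hxy (a + b + 1).toNat (by omega)
    rw [hab] at hne
    have hIs : I * s * (I * s) = -P.q := by rw [← hs2]; linear_combination s ^ 2 * hI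
    have c1 : c (axis (a + 1), axis b) = 0 := by
      have : (x + P.q ^ a * P.q ^ b * P.q * y) * (qInt P.q (a + 1) *
          c (axis (a + 1), axis b)) = 0 := by
        linear_combination (-x) * r2 - I * s * P.q ^ b * r1 +
          P.q ^ a * P.q ^ b * y * (qInt P.q (a + 1) * c (axis (a + 1), axis b)) * hIs
      exact (mul_eq_zero.1 ((mul_eq_zero.1 this).resolve_left hne)).resolve_left n1
    refine ⟨c1, ?_⟩
    rw [c1, mul_zero, mul_zero] at r1
    exact (mul_eq_zero.1 ((mul_eq_zero.1 r1.symm).resolve_left hx)).resolve_left n2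
  rw [hm, hm'] at hp
  generalize occ m 0 = a at *
  generalize occ m' 0 = b at *
  have ha0 : a = 0 := by
    by_contra h0
    refine hp ?_
    have := (key (a - 1) b (by omega) hb).1
    rwa [sub_add_cancel] at this
  have hb0 : b = 0 := by
    by_contra h0
    refine hp ?_
    have := (key a (b - 1) ha (by omega)).2
    rwa [sub_add_cancel] at this
  rw [hm, hm', ha0, hb0]

/-- Lowering now removes two particles, so three coefficients with the same total are tied together
by two relations from `f_0` and one from lowering. This settles totals of at least two; total one
has too few particles to be lowered directly and is treated separately. -/
theorem IsSub.vacuum_mem_of_short_long {s I : K} (hl : P.left = .short s I)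
    (hr : P.right = .long) (hN0 : N ≠ ⊥)
    (hxy : ∀ l : ℕ, 1 ≤ l → x ^ 2 + P.q ^ (2 * l - 1) * y ^ 2 ≠ 0) :
    Finsupp.single ((axis 0, axis 0) : P.Pt) 1 ∈ N := by
  obtain ⟨c, μ, h⟩ := hN.exists_isLowest hS hT hN0
  have hc := h.isSingular hN hS hT
  have h0n : 0 < P.n := P.one_le
  have hax : ∀ m m', c (m, m') ≠ 0 → m = axis (occ m 0) ∧ m' = axis (occ m' 0) := by
    intro m m' hp
    have hsite := fun t ht => hc.site_eq_zero_of_short hx hy (by rw [hl]; rfl) (t := t) ht m m' hp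
    exact ⟨eq_axis fun t ht => (hsite t ht).1, eq_axis fun t ht => (hsite t ht).2⟩
  have hend := P.left_isEnd
  rw [hl] at hend
  obtain ⟨hs2, hI⟩ := hend
  have hs0 : s ≠ 0 := by rintro rfl; exact P.q_ne (by rw [← hs2]; simp)
  have hI0 : I ≠ 0 := by rintro rfl; simp at hI
  have hIs : I * s * (I * s) = -P.q := by rw [← hs2]; linear_combination s ^ 2 * hI
  have hq := P.q_ne
  have hnz : ∀ v : ℤ, 0 < v → qInt P.q v ≠ 0 := fun v hv =>
    qInt_ne_zero P.q_ne P.q_pow (by omega)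
  have key : ∀ a b : ℤ, 0 ≤ a → 0 ≤ b → c (axis (a + 2), axis b) = 0 ∧
      c (axis (a + 1), axis (b + 1)) = 0 ∧ c (axis a, axis (b + 2)) = 0 := by
    intro a b ha hb
    have r1 := hc.first_short hx hy hl (a + 1) b
    have r2 := hc.first_short hx hy hl a (b + 1)
    have r3 := h.lowering hN hS hT a b
    have hqb := zpow_ne_zero b P.q_ne
    have hqa := zpow_ne_zero a P.q_ne
    rw [show a + 1 + 1 = a + 2 by ring] at r1
    rw [show b + 1 + 1 = b + 2 by ring] at r2
    simp only [hr, Node.kval, Node.step, show (2 : ℤ).toNat = 2 from rfl, qRise_two, neg_mul,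
      mul_zero, zero_add, zpow_one, zpow_neg, two_mul, zpow_add₀ P.q_ne] at r1 r2 r3
    field_simp at r3
    have n1 := hnz (a + 1) (by omega)
    have n2 := hnz (b + 1) (by omega)
    have n3 := hnz (a + 2) (by omega)
    have n4 := hnz (b + 2) (by omega)
    -- Here the index `l` of the hypothesis is `a + b + 2`, hence at least 2; the value `l = 1` is
    -- left for the one-particle weight.
    have hab : P.q ^ (2 * (a + b + 2).toNat - 1) =
        (P.q ^ a) ^ 2 * (P.q ^ b) ^ 2 * P.q ^ 3 := by
      have e : ((2 * (a + b + 2).toNat - 1 : ℕ) : ℤ) = a + a + (b + b) + 3 := by omega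
      rw [← zpow_natCast, e, zpow_add₀ P.q_ne, zpow_add₀ P.q_ne, zpow_add₀ P.q_ne,
        zpow_add₀ P.q_ne, zpow_ofNat]
      ring
    have hne := hxy (a + b + 2).toNat (by omega)
    rw [hab] at hne
    generalize P.q ^ a = A at *
    generalize P.q ^ b = B at *
    have c1 : c (axis (a + 2), axis b) = 0 := by
      have : (x ^ 2 + A ^ 2 * B ^ 2 * P.q ^ 3 * y ^ 2) * (qInt P.q (a + 1) * qInt P.q (a + 2) *
          c (axis (a + 2), axis b)) = 0 := by
        linear_combination (-x ^ 2) * r3 - P.q * B ^ 2 * x * qInt P.q (b + 1) * r2 -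
          P.q * B ^ 2 * I * s * A * y * qInt P.q (a + 1) * r1 +
          P.q ^ 2 * A ^ 2 * B ^ 2 * y ^ 2 * (qInt P.q (a + 1) * qInt P.q (a + 2) *
            c (axis (a + 2), axis b)) * hIs
      exact (mul_eq_zero.1 ((mul_eq_zero.1 this).resolve_left hne)).resolve_left (mul_ne_zero n1 n3)
    rw [c1, mul_zero, mul_zero] at r1
    have c2 := (mul_eq_zero.1 ((mul_eq_zero.1 r1.symm).resolve_left hx)).resolve_left n2
    rw [c2, mul_zero, mul_zero] at r2
    exact ⟨c1, c2, (mul_eq_zero.1 ((mul_eq_zero.1 r2.symm).resolve_left hx)).resolve_left n4⟩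
  -- First `e_0` adds a particle, then lowering removes both. The result has weight zero, of smaller
  -- height, so it vanishes; its vacuum coefficient is the missing equation, with determinant a
  -- multiple of `x² + q y²`.
  have key1 : μ = axis 1 → c = 0 := by
    intro hμ
    obtain ⟨d, hd, hw, C, hC, hdc⟩ := hN.exists_lowering hS hT (hN.e c h.mem ⟨0, by omega⟩)
      (h.wt.opE x y _) (s := 0) h0n
    have hd0 : d = 0 := by
      refine h.low d hd _ hw ?_
      rw [hμ, shift_first, hl, hr, axis, Node.step, Node.step, ← add_smul, ← sub_smul,
        height_smul, height_smul, height_ev h0n]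
      norm_num
    have r1 := hdc (axis 0) (axis 0) (fun t ht => occ_axis 0 ht) (fun t ht => occ_axis 0 ht)
    rw [hd0, Finsupp.zero_apply, axis_add, opE_first, opE_first, hl, hr,
      sub_eq_add_neg (axis _), sub_eq_add_neg (axis _), ← neg_smul, axis_add, axis_add,
      hN.eq_zero_left hS hT h.mem (m := axis (0 + -(Node.short s I).step)) 0
        (by rw [occ_axis_zero]; simp [Node.step]),
      hN.eq_zero_right hS hT h.mem (m' := axis (0 + -(Node.short s I).step)) 0
        (by rw [occ_axis_zero]; simp [Node.step])] at r1
    have r2 := hc.first_short hx hy hl 0 0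
    have q1 : qInt P.q 1 = 1 := qInt_one P.q_ne P.q_pow
    have n2 := hnz 2 (by norm_num)
    simp only [Node.step, Node.kval, occ_axis_zero, show (2 : ℤ).toNat = 2 from rfl, qRise_two,
      mul_zero, zero_add, add_zero, zpow_zero, zpow_one, mul_one, one_mul, q1,
      show (2 : ℤ) + -1 = 1 by norm_num] at r1 r2
    have hne := hxy 1 le_rfl
    rw [show 2 * 1 - 1 = 1 from rfl, pow_one] at hne
    have r3 := (mul_eq_zero.1 r1.symm).resolve_left hC
    field_simp at r3
    have c10 : c (axis 1, axis 0) = 0 := by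
      have : I * s * (x ^ 2 + P.q * y ^ 2) * c (axis 1, axis 0) = 0 := by
        apply mul_left_cancel₀ n2
        linear_combination x * r3 + qInt P.q 2 * P.q * y * r2
      exact (mul_eq_zero.1 this).resolve_left (mul_ne_zero (mul_ne_zero hI0 hs0) hne)
    rw [c10, mul_zero] at r2
    have c01 := (mul_eq_zero.1 r2.symm).resolve_left hx
    ext ⟨m, m'⟩
    by_contra hp
    obtain ⟨hm, hm'⟩ := hax m m' hp
    have hw' := h.wt _ hp
    have hn := hc.nonneg m m' hp 0
    have hsum : occ m 0 + occ m' 0 = 1 := by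
      rw [← occ_add', ← occ_axis_zero (P := P) 1, ← hμ, ← hw']
    rw [hm, hm'] at hp
    obtain ⟨e1, e2⟩ | ⟨e1, e2⟩ : (occ m 0 = 1 ∧ occ m' 0 = 0) ∨ (occ m 0 = 0 ∧ occ m' 0 = 1) := by
      omega
    · rw [e1, e2] at hp; exact hp c10
    · rw [e1, e2] at hp; exact hp c01
  refine single_mem_of_forall h.mem h.ne ?_
  rintro ⟨m, m'⟩ hp
  obtain ⟨hm, hm'⟩ := hax m m' hp
  obtain ⟨ha, hb⟩ := hc.nonneg m m' hp 0
  have hμ := h.wt _ hp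
  simp only at hμ
  rw [hm, hm'] at hp hμ
  rw [hm, hm']
  generalize occ m 0 = a at *
  generalize occ m' 0 = b at *
  have t1 : ¬ 2 ≤ a := fun h2 => hp (by simpa using (key (a - 2) b (by omega) hb).1)
  have t2 : ¬ 2 ≤ b := fun h2 => hp (by simpa using (key a (b - 2) ha (by omega)).2.2)
  have t3 : ¬ (1 ≤ a ∧ 1 ≤ b) := fun h2 =>
    hp (by simpa using (key (a - 1) (b - 1) (by omega) (by omega)).2.1)
  have t4 : ¬ a + b = 1 := fun h2 => by
    refine h.ne (key1 ?_)
    rw [← hμ, ← h2]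
    exact (add_smul _ _ _).symm
  rw [show a = 0 by omega, show b = 0 by omega]

end short

/-! ### Both end vertices long: type C -/

section long

variable {x y : K} {S T : Set (Fin P.n → ℤ)} {N : Submodule K (P.Pt →₀ K)}
  (hN : IsSub x y S T N) (hS : S ⊆ nonneg P.n) (hT : T ⊆ nonneg P.n) (hx : x ≠ 0) (hy : y ≠ 0)
  (hl : P.left = .long) (hr : P.right = .long) {c : P.Pt →₀ K} {μ : Fin P.n → ℤ}
  (h : IsLowest N c μ)
include hN hS hT hx hy hl hr h

/-- Both `f_0` and lowering move pairs of particles, so they relate the same two coefficients.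
Eliminating one leaves the factor `x - q^(2(a+b+1)) y`. -/
theorem IsLowest.eq_zero_of_long {a b : ℤ} (ha : 0 ≤ a) (hb : 0 ≤ b)
    (hxy : x ≠ P.q ^ (2 * (a + b + 1)) * y) :
    c (axis (a + 2), axis b) = 0 ∧ c (axis a, axis (b + 2)) = 0 := by
  have hc := h.isSingular hN hS hT
  have r1 := hc.first_axis a b
  have r2 := h.lowering hN hS hT a b
  have hq := P.q_ne
  have hqb := zpow_ne_zero b P.q_ne
  have hqa := zpow_ne_zero a P.q_ne
  have hnz : ∀ v : ℤ, 0 < v → qInt P.q v ≠ 0 := fun v hv =>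
    qInt_ne_zero P.q_ne P.q_pow (by omega)
  have h2 := hnz 2 (by norm_num)
  have n1 := hnz (a + 1) (by omega)
  have n2 := hnz (b + 1) (by omega)
  have n3 := hnz (a + 2) (by omega)
  have n4 := hnz (b + 2) (by omega)
  have ea : a + 2 - 1 = a + 1 := by ring
  have eb : b + 2 - 1 = b + 1 := by ring
  have e3 : P.q ^ (2 * (a + b + 1)) = (P.q ^ a) ^ 2 * (P.q ^ b) ^ 2 * P.q ^ 2 := by
    rw [show 2 * (a + b + 1) = a + a + (b + b) + 2 by ring, zpow_add₀ hq, zpow_add₀ hq,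
      zpow_add₀ hq, zpow_add₀ hq, zpow_ofNat]
    ring
  rw [e3] at hxy
  simp only [hr, hl, Node.kval, Node.step, Node.low, show (2 : ℤ).toNat = 2 from rfl, qRise_two,
    neg_mul, mul_zero, zero_add, zpow_one, zpow_neg, two_mul, zpow_add₀ P.q_ne, ea, eb] at r1 r2
  generalize P.q ^ a = A at *
  generalize P.q ^ b = B at *
  field_simp at r1 r2
  have c1 : c (axis (a + 2), axis b) = 0 := by
    have : (x - A ^ 2 * B ^ 2 * P.q ^ 2 * y) * (qInt P.q (a + 1) * qInt P.q (a + 2) *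
        c (axis (a + 2), axis b)) = 0 := by
      linear_combination (-x) * r2 - P.q * B ^ 2 * r1
    exact (mul_eq_zero.1 ((mul_eq_zero.1 this).resolve_left (sub_ne_zero.2 hxy))).resolve_left
      (mul_ne_zero n1 n3)
  refine ⟨c1, ?_⟩
  rw [c1, mul_zero, neg_zero, add_zero, mul_zero, zero_mul] at r2
  simpa [hq, n2, n4, hqb] using r2

/-- A vector with one particle at each of the first two sites is not of lowest height. -/
theorem IsLowest.occ_one_eq_zero (hxy : y ≠ P.q ^ 2 * x ∨ ¬ (ev 0 ∈ S ∧ ev 0 ∈ T)) :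
    occ μ 1 = 0 := by
  have hc := h.isSingular hN hS hT
  by_contra hμ
  have h0 : 0 < P.n := P.one_le
  -- In rank one there is no second site, and `occ` returns its default value 0.
  have h1 : 1 < P.n := by
    by_contra h1
    exact hμ (by simp [occ, h1])
  have hpt := hc.eq_of_weight_one hx hy hl h1 h.wt hμ
  have hmid := hc.mid (t := 0) h1 (ev 0) (ev 0)
  have q1 : qInt P.q 1 = 1 := qInt_one P.q_ne P.q_pow
  simp only [zero_add, occ_ev, h0, h1, add_sub_cancel_left] at hmid
  norm_num [q1] at hmid
  have hα : c (ev 0, ev 1) ≠ 0 := by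
    intro hα
    rw [hα, mul_zero, add_zero] at hmid
    refine h.ne (Finsupp.ext fun p => ?_)
    obtain ⟨m, m'⟩ := p
    by_contra hp
    rcases hpt m m' hp with ⟨rfl, rfl⟩ | ⟨rfl, rfl⟩
    · exact hp hα
    · exact hp hmid
  have hβ : c (ev 1, ev 0) ≠ 0 := by
    intro hβ
    rw [hβ, zero_add] at hmid
    exact mul_ne_zero P.q_ne hα hmid
  -- Both coefficients being nonzero puts `ev 0` in `S` and in `T`, which cannot happen for opposite
  -- parities; only the inequality remains.
  have hne := hxy.resolve_right fun hST =>
    hST ⟨(hN.supp c h.mem _ hα).1, (hN.supp c h.mem _ hβ).2⟩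
  have hμ' : μ = ev 0 + ev 1 := (h.wt _ hα).symm
  have hc1 := hN.e c h.mem ⟨0, by omega⟩
  -- Applying `e_0`, then `e_1`, then removing two particles from the second site leads from weight
  -- `ev 0 + ev 1`, of height 3, to `2 ev 0`, of height 2. The coefficient at `(ev 0, ev 0)`,
  -- combined with the `f_1` equation, gives the factor `y - q² x`.
  obtain ⟨d, hd, hw, C, hC, hdc⟩ := hN.exists_lowering hS hT
    (hN.e _ hc1 ⟨0 + 1, by omega⟩) ((h.wt.opE x y ⟨0, by omega⟩).opE x y ⟨0 + 1, by omega⟩)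
    (s := 1) h1
  have hd0 : d = 0 := by
    refine h.low d hd _ hw ?_
    have e : μ + P.shift ⟨0, by omega⟩ + P.shift ⟨0 + 1, by omega⟩ - P.right.step • ev 1 =
        (2 : ℤ) • ev 0 := by
      rw [hμ', shift_first, shift_mid h1, hl, hr, Node.step]
      simp only [zero_add]
      module
    rw [e, hμ', height_add, height_smul, height_ev h0, height_ev h1]
    norm_num
  have r := hdc (ev 0) (ev 0) (fun t ht => by rw [occ_ev, if_neg (by omega)])
    (fun t ht => by rw [occ_ev, if_neg (by omega)])
  have e1 : (ev 0 + (2 : ℤ) • ev 1 + ev 0 - ev 1 : Fin P.n → ℤ) = (2 : ℤ) • ev 0 + ev 1 := by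
    module
  rw [hd0, Finsupp.zero_apply, opE_mid x y h1, opE_mid x y h1, hr, Node.step, zero_add, e1,
    hN.eq_zero_left hS hT hc1 (m := ev 0 + ev 0 - ev 1) 1 (by
      simp [occ_sub', occ_add', occ_ev, h1]),
    hN.eq_zero_right hS hT hc1 (m' := ev 0 + ev 0 - ev 1) 1 (by
      simp [occ_sub', occ_add', occ_ev, h1]), opE_first, opE_first, hl, Node.step,
    hN.eq_zero_left hS hT h.mem (m := ev 0 - (2 : ℤ) • ev 0) 0 (by
      simp [occ_sub', occ_smul, occ_ev, h0, -zsmul_eq_mul]),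
    hN.eq_zero_right hS hT h.mem (m' := ev 0 - (2 : ℤ) • ev 0) 0 (by
      simp [occ_sub', occ_smul, occ_ev, h0, -zsmul_eq_mul]), add_sub_cancel_left] at r
  have r' := (mul_eq_zero.1 r.symm).resolve_left hC
  simp [occ_add', occ_smul, occ_ev, h0, h1, -zsmul_eq_mul, qRise_two, Node.kval, q1] at r'
  have hq := P.q_ne
  have n2 := qInt_ne_zero P.q_ne P.q_pow (show (2 : ℤ) ≠ 0 by norm_num)
  field_simp at r'
  have : qInt P.q 2 ^ 2 * ((y - P.q ^ 2 * x) * c (ev 0, ev 1)) = 0 := by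
    linear_combination r' - qInt P.q 2 ^ 2 * P.q * x * hmid
  exact mul_ne_zero (pow_ne_zero 2 n2) (mul_ne_zero (sub_ne_zero.2 hne) hα) this

/-- An empty second site confines the vector to the first one. There `IsLowest.eq_zero_of_long`
leaves at most one particle in each factor, and parity decides between none and one. -/
theorem IsLowest.single_mem_of_long (hμ : occ μ 1 = 0) {ε₁ ε₂ : ℤˣ} (hS' : S = parity P.n ε₁)
    (hT' : T = parity P.n ε₂) {a₀ b₀ : ℤ} (ha : a₀ = 0 ∨ a₀ = 1) (hb : b₀ = 0 ∨ b₀ = 1)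
    (ha' : a₀.negOnePow = ε₁) (hb' : b₀.negOnePow = ε₂)
    (hxy : ∀ k : ℕ, x ≠ P.q ^ (2 * (a₀ + b₀ + 2 * k + 1)) * y) :
    Finsupp.single ((axis a₀, axis b₀) : P.Pt) 1 ∈ N := by
  have hc := h.isSingular hN hS hT
  refine single_mem_of_forall h.mem h.ne ?_
  rintro ⟨m, m'⟩ hp
  have hsite := fun t ht => hc.site_eq_zero_of_le (s := 1) (fun m m' hp => by
    have := h.wt _ hp
    have h1 := hc.nonneg m m' hp 1
    rw [← this, occ_add'] at hμ
    dsimp only at hμ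
    omega) (t := t) ht m m' hp
  have hm := eq_axis fun t ht => (hsite t ht).1
  have hm' := eq_axis fun t ht => (hsite t ht).2
  obtain ⟨hp1, hp2⟩ := hN.supp c h.mem _ hp
  obtain ⟨hpos, hpos'⟩ := hc.nonneg m m' hp 0
  rw [hS'] at hp1
  rw [hT'] at hp2
  have p1 := hp1.2
  have p2 := hp2.2
  dsimp only at p1 p2
  rw [hm] at p1 hp ⊢
  rw [hm'] at p2 hp ⊢
  rw [sum_axis, ← ha', Int.negOnePow_eq_iff] at p1
  rw [sum_axis, ← hb', Int.negOnePow_eq_iff] at p2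
  generalize occ m 0 = a at *
  generalize occ m' 0 = b at *
  obtain ⟨i, hi⟩ := p1
  obtain ⟨j, hj⟩ := p2
  have t1 : a < 2 := by
    by_contra h2
    have := (h.eq_zero_of_long hN hS hT hx hy hl hr (a := a - 2) (b := b) (by omega) hpos' (by
      -- Since `a = a₀ + 2 i` and `b = b₀ + 2 j`, the total after removing a pair is `a₀ + b₀ + 2 (i
      -- + j - 1)`.
      have := hxy (i + j - 1).toNat
      rwa [show a₀ + b₀ + 2 * ((i + j - 1).toNat : ℤ) = a - 2 + b by omega] at this)).1
    rw [sub_add_cancel] at this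
    exact hp this
  have t2 : b < 2 := by
    by_contra h2
    have := (h.eq_zero_of_long hN hS hT hx hy hl hr (a := a) (b := b - 2) hpos (by omega) (by
      have := hxy (i + j - 1).toNat
      rwa [show a₀ + b₀ + 2 * ((i + j - 1).toNat : ℤ) = a + (b - 2) by omega] at this)).2
    rw [sub_add_cancel] at this
    exact hp this
  rw [show a = a₀ by omega, show b = b₀ by omega]

end long

end Osc

/-! ### Inverse parameters and conclusion -/

/-- For the orthogonal complement the parameters are inverted, which exchanges `x` and `y` in the
excluded relations. This is why the hypotheses exclude both signs of the exponent. -/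
theorem add_inv_mul_inv_ne {K : Type*} [Field K] {a x y : K} (hx : x ≠ 0) (hy : y ≠ 0)
    (h : y + a * x ≠ 0) : x⁻¹ + a * y⁻¹ ≠ 0 := by
  intro h'
  apply h
  field_simp at h'
  linear_combination h'

theorem inv_ne_mul_inv {K : Type*} [Field K] {a x y : K} (hx : x ≠ 0) (hy : y ≠ 0)
    (h : y ≠ a * x) : x⁻¹ ≠ a * y⁻¹ := by
  intro h'
  apply h
  field_simp at h'
  linear_combination h'

theorem exists_negOnePow_eq (ε : ℤˣ) : ∃ a : ℤ, (a = 0 ∨ a = 1) ∧ a.negOnePow = ε := by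
  rcases Int.units_eq_one_or ε with rfl | rfl
  · exact ⟨0, Or.inl rfl, by simp⟩
  · exact ⟨1, Or.inr rfl, by simp⟩

namespace Osc

variable {K : Type*} [Field K] {P : Osc K}

theorem axis_mem_nonneg {a : ℤ} (ha : 0 ≤ a) : axis a ∈ nonneg P.n := by
  intro j
  simp only [axis, ev, Pi.smul_apply, smul_eq_mul]
  split_ifs <;> simp [ha]

theorem axis_mem_parity {a : ℤ} (ha : 0 ≤ a) {ε : ℤˣ} (h : a.negOnePow = ε) :
    axis a ∈ parity P.n ε :=
  ⟨axis_mem_nonneg ha, by rw [sum_axis, h]⟩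

/-- For equal signs `a = b`, and the exponents met are `4 l - 2` with `l = a + k + 1`; for opposite
signs they are `4 l` with `l = k + 1`. The reversed inequality is needed only for equal signs and `l
= 1`, to exclude the vector on the first two sites. -/
theorem IsSub.vacuum_mem_of_long_long {x y : K} {ε₁ ε₂ : ℤˣ} {N : Submodule K (P.Pt →₀ K)}
    (hN : IsSub x y (parity P.n ε₁) (parity P.n ε₂) N) (hx : x ≠ 0) (hy : y ≠ 0)
    (hl : P.left = .long) (hr : P.right = .long) (hN0 : N ≠ ⊥) {a b : ℤ} (ha : a = 0 ∨ a = 1)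
    (hb : b = 0 ∨ b = 1) (ha' : a.negOnePow = ε₁) (hb' : b.negOnePow = ε₂)
    (h1 : ∀ l : ℕ, 1 ≤ l → ε₁ = ε₂ → x ≠ P.q ^ (4 * l - 2) * y ∧ y ≠ P.q ^ (4 * l - 2) * x)
    (h2 : ∀ l : ℕ, 1 ≤ l → ε₁ ≠ ε₂ → x ≠ P.q ^ (4 * l) * y) :
    Finsupp.single ((axis a, axis b) : P.Pt) 1 ∈ N := by
  have hS : parity P.n ε₁ ⊆ nonneg P.n := fun m hm => hm.1
  have hT : parity P.n ε₂ ⊆ nonneg P.n := fun m hm => hm.1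
  obtain ⟨c, μ, h⟩ := hN.exists_isLowest hS hT hN0
  have hμ : occ μ 1 = 0 := by
    refine h.occ_one_eq_zero hN hS hT hx hy hl hr ?_
    by_cases he : ε₁ = ε₂
    · exact Or.inl (h1 1 le_rfl he).2
    · exact Or.inr fun hm => he (hm.1.2.symm.trans hm.2.2)
  refine h.single_mem_of_long hN hS hT hx hy hl hr hμ rfl rfl ha hb ha' hb' fun k => ?_
  by_cases he : ε₁ = ε₂
  · rw [← ha', ← hb', Int.negOnePow_eq_iff] at he
    obtain ⟨i, hi⟩ := he
    have e : (2 * (a + b + 2 * k + 1) : ℤ) = ((4 * (a.toNat + k + 1) - 2 : ℕ) : ℤ) := by omega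
    rw [e, zpow_natCast]
    exact (h1 _ (by omega) (by rw [← ha', ← hb', Int.negOnePow_eq_iff]; exact ⟨i, hi⟩)).1
  · have hab : a ≠ b := by rintro rfl; exact he (ha'.symm.trans hb')
    have e : (2 * (a + b + 2 * k + 1) : ℤ) = ((4 * (k + 1) : ℕ) : ℤ) := by omega
    rw [e, zpow_natCast]
    exact h2 _ (by omega) he

end Osc

end QOsc

open QOsc in
theorem proposition3p9 {K : Type*} [Field K] [CharZero K] (n : ℕ) (hn : 1 ≤ n) :
    (∀ (s I : K) (hs : s ≠ 0) (hs' : ∀ m : ℕ, 0 < m → s ^ m ≠ 1) (hI : I ^ 2 = -1)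
      (x y : K) (hx : x ≠ 0) (hy : y ≠ 0),
      (∀ l : ℕ, 1 ≤ l → x + (s ^ 2) ^ l * y ≠ 0 ∧ y + (s ^ 2) ^ l * x ≠ 0) →
      Uq.IsIrreducible
        (Uq.tensor (Osc.repD n hn s I hs hs' hI x hx) (Osc.repD n hn s I hs hs' hI y hy))) ∧
    (∀ (s I : K) (hs : s ≠ 0) (hs' : ∀ m : ℕ, 0 < m → s ^ m ≠ 1) (hI : I ^ 2 = -1)
      (x y : K) (hx : x ≠ 0) (hy : y ≠ 0),
      (∀ l : ℕ, 1 ≤ l →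
        x ^ 2 + (s ^ 2) ^ (2 * l - 1) * y ^ 2 ≠ 0 ∧ y ^ 2 + (s ^ 2) ^ (2 * l - 1) * x ^ 2 ≠ 0) →
      Uq.IsIrreducible
        (Uq.tensor (Osc.repA n hn s I hs hs' hI x hx) (Osc.repA n hn s I hs hs' hI y hy))) ∧
    (∀ (q : K) (hq : q ≠ 0) (hq' : ∀ m : ℕ, 0 < m → q ^ m ≠ 1) (ε₁ ε₂ : ℤˣ)
      (x y : K) (hx : x ≠ 0) (hy : y ≠ 0),
      (∀ l : ℕ, 1 ≤ l → ε₁ = ε₂ → x ≠ q ^ (4 * l - 2) * y ∧ y ≠ q ^ (4 * l - 2) * x) →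
      (∀ l : ℕ, 1 ≤ l → ε₁ ≠ ε₂ → x ≠ q ^ (4 * l) * y ∧ y ≠ q ^ (4 * l) * x) →
      Uq.IsIrreducible
        (Uq.tensor (Osc.repC n hn q hq hq' ε₁ x hx) (Osc.repC n hn q hq hq' ε₂ y hy))) := by
  refine ⟨?_, ?_, ?_⟩
  · intro s I hs hs' hI x y hx hy hxy
    let P := Osc.typeD n hn s I hs hs' hI
    refine Osc.isIrreducible_of_vacuum (P := P) hx hy (Osc.closed_nonneg P) (Osc.closed_nonneg P)
      subset_rfl subset_rfl (v₀ := (Osc.axis 0, Osc.axis 0)) (Osc.axis_mem_nonneg (P := P) le_rfl)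
      (Osc.axis_mem_nonneg (P := P) le_rfl) (fun N hN hN0 => ?_) (fun N hN hN0 => ?_)
    · exact hN.vacuum_mem_of_short_short subset_rfl subset_rfl hx hy rfl rfl rfl hN0
        fun l hl => (hxy l hl).1
    · exact hN.vacuum_mem_of_short_short subset_rfl subset_rfl (inv_ne_zero hx) (inv_ne_zero hy)
        rfl rfl rfl hN0 fun l hl => add_inv_mul_inv_ne hx hy (hxy l hl).2
  · intro s I hs hs' hI x y hx hy hxy
    let P := Osc.typeA n hn s I hs hs' hI
    refine Osc.isIrreducible_of_vacuum (P := P) hx hy (Osc.closed_nonneg P) (Osc.closed_nonneg P)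
      subset_rfl subset_rfl (v₀ := (Osc.axis 0, Osc.axis 0)) (Osc.axis_mem_nonneg (P := P) le_rfl)
      (Osc.axis_mem_nonneg (P := P) le_rfl) (fun N hN hN0 => ?_) (fun N hN hN0 => ?_)
    · exact hN.vacuum_mem_of_short_long subset_rfl subset_rfl hx hy rfl rfl hN0
        fun l hl => (hxy l hl).1
    · refine hN.vacuum_mem_of_short_long subset_rfl subset_rfl (inv_ne_zero hx) (inv_ne_zero hy)
        rfl rfl hN0 fun l hl => ?_
      rw [inv_pow, inv_pow]
      exact add_inv_mul_inv_ne (pow_ne_zero 2 hx) (pow_ne_zero 2 hy) (hxy l hl).2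
  · intro q hq hq' ε₁ ε₂ x y hx hy h1 h2
    let P := Osc.typeC n hn q hq hq'
    -- The vacuum of each factor has 0 or 1 particle at the first site, according to its sign.
    obtain ⟨a, ha, ha'⟩ := exists_negOnePow_eq ε₁
    obtain ⟨b, hb, hb'⟩ := exists_negOnePow_eq ε₂
    refine Osc.isIrreducible_of_vacuum (P := P) hx hy
      (fun x => Osc.closed_parity (P := P) rfl rfl x ε₁)
      (fun x => Osc.closed_parity (P := P) rfl rfl x ε₂)
      (fun m hm => hm.1) (fun m hm => hm.1) (v₀ := (Osc.axis a, Osc.axis b))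
      (Osc.axis_mem_parity (P := P) (by omega) ha') (Osc.axis_mem_parity (P := P) (by omega) hb')
      (fun N hN hN0 => ?_) (fun N hN hN0 => ?_)
    · exact hN.vacuum_mem_of_long_long hx hy rfl rfl hN0 ha hb ha' hb' h1
        fun l hl he => (h2 l hl he).1
    · exact hN.vacuum_mem_of_long_long (inv_ne_zero hx) (inv_ne_zero hy) rfl rfl hN0 ha hb ha' hb'
        (fun l hl he => ⟨inv_ne_mul_inv hx hy (h1 l hl he).2, inv_ne_mul_inv hy hx (h1 l hl he).1⟩)
        fun l hl he => inv_ne_mul_inv hx hy (h2 l hl he).2
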